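/- Let $N\ge 1$ and let $\mathcal O\subset\mathbb R^N$ be an open set, possibly unbounded, with uniformly Lipschitz boundary $\Gamma$ (finitely many Lipschitz graph charts $W_i$ cover $\Gamma$, and for some $\varepsilon>0$ every ball of radius $\varepsilon$ centred on $\Gamma$ lies in some $W_i$), exterior unit normal $\mathbf n$ and surface measure $\sigma$. Let $\nu,c\in L^\infty(\mathcal O)$, $\mathbf b\in (W^{1,\infty}(\mathcal O))^N$, $p,q,s\in L^\infty(\Gamma)$, and let $\mathbf r$ be a tangential vector field on $\Gamma$ with components in $W^{1,\infty}(\Gamma)$. Suppose that for some constants $\nu_0,\alpha_0>0$ $$\nu\ge\nu_0,\qquad c+\tfrac12\nabla\cdot\mathbf b\ge\alpha_0\qquad\text{a.e. in }\mathcal O,$$ $$p-\tfrac{\mathbf b\cdot\mathbf n}{2}+\tfrac q2\nabla_\Gamma\cdot\mathbf r>0,\qquad q\ge 0,\qquad s>0\qquad\text{a.e. on }\Gamma,$$ and that either $q=0$ a.e. on $\Gamma$ (Robin case), or there are constants $q_0,s_0>0$ with $q\ge q_0$ and $s\ge s_0$ a.e. on $\Gamma$ (Ventcell case). Put $\mathcal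 B=H^1(\mathcal O)$ in the Robin case and $\mathcal B=H^1_1(\mathcal O)=\{v\in H^1(\mathcal O):\ v|_\Gamma\in H^1(\Gamma)\}$ in the Ventcell case, and for $w,v\in\mathcal B$ $$m(w,v)=(w,v)_{L^2(\mathcal O)}+(qw,v)_{L^2(\Gamma)},$$ $$a(w,v)=\int_{\mathcal O}\tfrac12\big((\mathbf b\cdot\nabla w)v-(\mathbf b\cdot\nabla v)w\big)dx+\int_{\mathcal O}\nu\nabla w\cdot\nabla v\,dx+\int_{\mathcal O}\big(c+\tfrac12\nabla\cdot\mathbf b\big)wv\,dx$$ $$\qquad+\int_\Gamma\Big(\big(p-\tfrac{\mathbf b\cdot\mathbf n}2+\tfrac q2\nabla_\Gamma\cdot\mathbf r\big)wv+\tfrac q2\big(\nabla_\Gamma\cdot(\mathbf rw)v-\nabla_\Gamma\cdot(\mathbf rv)w\big)+qs\nabla_\Gamma w\cdot\nabla_\Gamma v\Big)d\sigma,$$ where all the terms with the factor $q$ are absent in the Robin case. Let $0=t_0<t_1<\dots<t_M=T$, $I_n=(t_n,t_{n+1}]$, let $d\ge0$ be an integer, and let $\mathcal P_d$ be the set of functions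 $V$ on $[0,T]$ whose restriction to each $I_n$, $0\le n<M$, is of the form $V(t)=\sum_{i=0}^d t^i\varphi_i$ with $\varphi_i\in\mathcal B$. Let $u_0\in\mathcal B$, $f\in L^2(0,T;L^2(\mathcal O))$ and $g\in L^2(0,T;L^2(\Gamma))$. Then there is exactly one $U\in\mathcal P_d$ such that $U(0)=u_0$ and, for all $V\in\mathcal P_d$ and all $0\le n<M$, $$\int_{I_n}\big(m(\dot U,V)+a(U,V)\big)dt+m\big(U(t_n^+)-U(t_n^-),V(t_n^+)\big)=\int_{I_n}\big((f,V)_{L^2(\mathcal O)}+(g,V)_{L^2(\Gamma)}\big)dt,$$ where $U(t_n^+)$, $V(t_n^+)$ are the limits from the right and $U(t_n^-)=U(t_n)$ (for $n\ge1$ the limit from the left, for $n=0$ the initial value $u_0$). -/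

import Mathlib

open MeasureTheory Set Filter
open scoped Topology NNReal ENNReal ContDiff

noncomputable section

/-- Euclidean space `ℝ^k`. -/
abbrev Eucl (k : ℕ) : Type := EuclideanSpace ℝ (Fin k)

/-! ### Weak gradients and Sobolev functions on open sets -/

/-- `G` is the weak (distributional) gradient of `v` in the open set `V`. -/
def HasWeakGradient {k : ℕ} (V : Set (Eucl k)) (v : Eucl k → ℝ) (G : Eucl k → Eucl k) : Prop :=
  LocallyIntegrableOn v V ∧ LocallyIntegrableOn G V ∧
    ∀ ψ : Eucl k → ℝ, ContDiff ℝ ∞ ψ → HasCompactSupport ψ → tsupport ψ ⊆ V →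
      ∀ ξ : Eucl k,
        ∫ x in V, v x * fderiv ℝ ψ x ξ = -∫ x in V, inner ℝ (G x) ξ * ψ x

open Classical in
/-- The weak gradient (unique up to a null set; `0` if there is none). -/
def weakGradient {k : ℕ} (V : Set (Eucl k)) (v : Eucl k → ℝ) : Eucl k → Eucl k :=
  if h : ∃ G, HasWeakGradient V v G then h.choose else 0

/-- `v ∈ W^{1,p}(V)`. -/
def MemW1 {k : ℕ} (V : Set (Eucl k)) (p : ℝ≥0∞) (v : Eucl k → ℝ) : Prop :=
  MemLp v p (volume.restrict V) ∧
    ∃ G, MemLp G p (volume.restrict V) ∧ HasWeakGradient V v G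

/-- The weak divergence of a vector field in the open set `V`. -/
def weakDiv {k : ℕ} (V : Set (Eucl k)) (F : Eucl k → Eucl k) (x : Eucl k) : ℝ :=
  ∑ i, weakGradient V (fun y => F y i) x i

/-! ### Geometry of the boundary -/

/-- An orthonormal coordinate system `x ↦ (y, t) ∈ ℝ^m × ℝ` of `ℝ^{m+1}`. -/
abbrev Frame (m : ℕ) : Type := Eucl (m + 1) ≃ₗᵢ[ℝ] WithLp 2 (Eucl m × ℝ)

/-- The point of the graph of `γ` above `y`, in the coordinates `e`. -/
def graphPoint {m : ℕ} (e : Frame m) (γ : Eucl m → ℝ) (y : Eucl m) : Eucl (m + 1) :=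
  e.symm (WithLp.toLp 2 (y, γ y))

/-- Inside the open set `W`, the set `O` is the part strictly above the graph of the Lipschitz
function `γ`, in the orthonormal coordinates `e`. -/
def IsGraphChart {m : ℕ} (O W : Set (Eucl (m + 1))) (e : Frame m) (γ : Eucl m → ℝ) : Prop :=
  IsOpen W ∧ (∃ K : ℝ≥0, LipschitzWith K γ) ∧ ∀ x ∈ W, (x ∈ O ↔ γ (e x).fst < (e x).snd)

/-- `O` is an open set with (uniformly) Lipschitz boundary: finitely many Lipschitz graph charts
cover the boundary, with a positive Lebesgue number. The set may be unbounded, and so may the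
charts. -/
def IsLipschitzDomain {m : ℕ} (O : Set (Eucl (m + 1))) : Prop :=
  IsOpen O ∧ ∃ (k : ℕ) (W : Fin k → Set (Eucl (m + 1))) (e : Fin k → Frame m)
    (γ : Fin k → Eucl m → ℝ) (ε : ℝ), 0 < ε ∧
      (∀ i, IsGraphChart O (W i) (e i) (γ i)) ∧
      ∀ x ∈ frontier O, ∃ i, Metric.ball x ε ⊆ W i

/-- The surface measure on `Γ = ∂O`: the normalized `m`-dimensional Hausdorff measure. -/
def surfaceMeasure {m : ℕ} (O : Set (Eucl (m + 1))) : Measure (Eucl (m + 1)) :=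
  (Measure.euclideanHausdorffMeasure m).restrict (frontier O)

/-- `n` is the exterior unit normal to `O` at `x`: near `x`, up to arbitrarily thin cones around
the hyperplane orthogonal to `n`, the set `O` is the half-space opposite to `n`. -/
def IsOuterNormal {k : ℕ} (O : Set (Eucl k)) (x n : Eucl k) : Prop :=
  ‖n‖ = 1 ∧ ∀ ε > 0, ∀ᶠ y in 𝓝 x,
    (inner ℝ (y - x) n < -(ε * ‖y - x‖) → y ∈ O) ∧ (ε * ‖y - x‖ < inner ℝ (y - x) n → y ∉ O)

open Classical in
/-- The exterior unit normal (`0` where there is none). -/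
def outerNormal {k : ℕ} (O : Set (Eucl k)) (x : Eucl k) : Eucl k :=
  if h : ∃ n, IsOuterNormal O x n then h.choose else 0

/-! ### Tangential calculus on the boundary -/

/-- `G` is the weak tangential gradient of `φ` on `Γ = ∂O`: it is tangential, and in every
Lipschitz graph chart `X` of `Γ` one has `∇ (φ ∘ X) = (DX)ᵀ (G ∘ X)` weakly. -/
def HasTangentialGradient {m : ℕ} (O : Set (Eucl (m + 1))) (φ : Eucl (m + 1) → ℝ)
    (G : Eucl (m + 1) → Eucl (m + 1)) : Prop :=
  (∀ᵐ x ∂(surfaceMeasure O), inner ℝ (G x) (outerNormal O x) = 0) ∧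
    ∀ (W : Set (Eucl (m + 1))) (e : Frame m) (γ : Eucl m → ℝ), IsGraphChart O W e γ →
      HasWeakGradient (graphPoint e γ ⁻¹' W) (fun y => φ (graphPoint e γ y))
        (fun y => (fderiv ℝ (graphPoint e γ) y).adjoint (G (graphPoint e γ y)))

open Classical in
/-- The weak tangential gradient `∇_Γ φ` (unique up to a null set; `0` if there is none). -/
def tangentialGradient {m : ℕ} (O : Set (Eucl (m + 1))) (φ : Eucl (m + 1) → ℝ) :
    Eucl (m + 1) → Eucl (m + 1) :=
  if h : ∃ G, HasTangentialGradient O φ G then h.choose else 0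

/-- `φ ∈ W^{1,p}(Γ)`, `Γ = ∂O`. -/
def MemW1Boundary {m : ℕ} (O : Set (Eucl (m + 1))) (p : ℝ≥0∞) (φ : Eucl (m + 1) → ℝ) : Prop :=
  MemLp φ p (surfaceMeasure O) ∧
    ∃ G, MemLp G p (surfaceMeasure O) ∧ HasTangentialGradient O φ G

/-- The surface divergence `∇_Γ · F = ∑ᵢ (∇_Γ Fᵢ)ᵢ` of a vector field along `Γ = ∂O`, given by
its Cartesian components. -/
def surfaceDiv {m : ℕ} (O : Set (Eucl (m + 1))) (F : Eucl (m + 1) → Eucl (m + 1))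
    (x : Eucl (m + 1)) : ℝ :=
  ∑ i, tangentialGradient O (fun y => F y i) x i

/-! ### Traces and the function spaces -/

/-- `τ ∈ L²(Γ)` is the trace of `v ∈ H¹(O)`: there are `uⱼ ∈ C_c^∞(ℝ^{m+1})` with `uⱼ → v` in
`H¹(O)` and `uⱼ|_Γ → τ` in `L²(Γ)`. -/
def IsTrace {m : ℕ} (O : Set (Eucl (m + 1))) (v τ : Eucl (m + 1) → ℝ) : Prop :=
  MemLp τ 2 (surfaceMeasure O) ∧ ∃ u : ℕ → Eucl (m + 1) → ℝ,
    (∀ j, ContDiff ℝ ∞ (u j) ∧ HasCompactSupport (u j)) ∧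
    Tendsto (fun j => eLpNorm (fun x => u j x - v x) 2 (volume.restrict O)) atTop (𝓝 0) ∧
    Tendsto (fun j => eLpNorm (fun x => gradient (u j) x - weakGradient O v x) 2
      (volume.restrict O)) atTop (𝓝 0) ∧
    Tendsto (fun j => eLpNorm (fun x => u j x - τ x) 2 (surfaceMeasure O)) atTop (𝓝 0)

open Classical in
/-- The trace `v|_Γ` (unique up to a null set; `0` if there is none). -/
def trace {m : ℕ} (O : Set (Eucl (m + 1))) (v : Eucl (m + 1) → ℝ) : Eucl (m + 1) → ℝ :=
  if h : ∃ τ, IsTrace O v τ then h.choose else 0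

/-- The Lebesgue space `L²(O)`. -/
abbrev L2 {m : ℕ} (O : Set (Eucl (m + 1))) : Type := Lp ℝ 2 (volume.restrict O)

/-- The Lebesgue space `L²(Γ)`, `Γ = ∂O`. -/
abbrev L2Boundary {m : ℕ} (O : Set (Eucl (m + 1))) : Type := Lp ℝ 2 (surfaceMeasure O)

/-- `H¹(O)`. -/
def H1 {m : ℕ} (O : Set (Eucl (m + 1))) : Set (L2 O) := {v | MemW1 O 2 v}

/-- `H¹₁(O) = {v ∈ H¹(O), v|_Γ ∈ H¹(Γ)}`. -/
def H11 {m : ℕ} (O : Set (Eucl (m + 1))) : Set (L2 O) :=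
  {v | v ∈ H1 O ∧ MemW1Boundary O 2 (trace O v)}

/-! ### The local problem -/

/-- Coefficients of the equation in `O` (`ν`, `b`, `c`) and of the boundary operator
(`p`, `q`, `r`, `s`). -/
structure Coefficients (m : ℕ) where
  ν : Eucl (m + 1) → ℝ
  b : Eucl (m + 1) → Eucl (m + 1)
  c : Eucl (m + 1) → ℝ
  p : Eucl (m + 1) → ℝ
  q : Eucl (m + 1) → ℝ
  r : Eucl (m + 1) → Eucl (m + 1)
  s : Eucl (m + 1) → ℝ

variable {m : ℕ}

/-- The regularity of the coefficients: `ν, c ∈ L^∞(O)`, `b ∈ W^{1,∞}(O)` (through its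
representative that is continuous up to the boundary), `p, q, s ∈ L^∞(Γ)`, and `r` a tangential
field in `W^{1,∞}(Γ)`. -/
structure Coefficients.Regular (C : Coefficients m) (O : Set (Eucl (m + 1))) : Prop where
  ν_bdd : MemLp C.ν ∞ (volume.restrict O)
  b_cont : ContinuousOn C.b (closure O)
  b_W1 : ∀ i, MemW1 O ∞ (fun x => C.b x i)
  c_bdd : MemLp C.c ∞ (volume.restrict O)
  p_bdd : MemLp C.p ∞ (surfaceMeasure O)
  q_bdd : MemLp C.q ∞ (surfaceMeasure O)
  r_tangential : ∀ᵐ x ∂(surfaceMeasure O), inner ℝ (C.r x) (outerNormal O x) = 0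
  r_W1 : ∀ i, MemW1Boundary O ∞ (fun x => C.r x i)
  s_bdd : MemLp C.s ∞ (surfaceMeasure O)

/-- The boundary coefficient `p - b·n/2 + (q/2) ∇_Γ·r`. -/
def Coefficients.boundaryWeight (C : Coefficients m) (O : Set (Eucl (m + 1)))
    (x : Eucl (m + 1)) : ℝ :=
  C.p x - inner ℝ (C.b x) (outerNormal O x) / 2 + C.q x / 2 * surfaceDiv O C.r x

/-- The bilinear form `m(w, v) = (w, v)_{L²(O)} + (q w, v)_{L²(Γ)}`. -/
def massForm (C : Coefficients m) (O : Set (Eucl (m + 1))) (w v : L2 O) : ℝ :=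
  (∫ x in O, w x * v x) + ∫ x, C.q x * trace O w x * trace O v x ∂(surfaceMeasure O)

/-- The bilinear form `a(w, v)`. -/
def energyForm (C : Coefficients m) (O : Set (Eucl (m + 1))) (w v : L2 O) : ℝ :=
  (∫ x in O, 1 / 2 * (inner ℝ (C.b x) (weakGradient O w x) * v x
      - inner ℝ (C.b x) (weakGradient O v x) * w x))
  + (∫ x in O, C.ν x * inner ℝ (weakGradient O w x) (weakGradient O v x))
  + (∫ x in O, (C.c x + 1 / 2 * weakDiv O C.b x) * (w x * v x))
  + ∫ x, (C.boundaryWeight O x * (trace O w x * trace O v x)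
      + C.q x / 2 * (surfaceDiv O (fun y => trace O w y • C.r y) x * trace O v x
          - surfaceDiv O (fun y => trace O v y • C.r y) x * trace O w x)
      + C.q x * C.s x * inner ℝ (tangentialGradient O (trace O w) x)
          (tangentialGradient O (trace O v) x)) ∂(surfaceMeasure O)

/-- The linear form `L(v) = (f, v)_{L²(O)} + (g, v)_{L²(Γ)}`. -/
def loadForm {O : Set (Eucl (m + 1))} (f : L2 O) (g : L2Boundary O) (v : L2 O) : ℝ :=
  (∫ x in O, f x * v x) + ∫ x, g x * trace O v x ∂(surfaceMeasure O)

open Classical in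
/-- The space `𝓑`: `H¹(O)` if `q = 0` a.e. on `Γ`, and `H¹₁(O)` otherwise. -/
def trialSpace (C : Coefficients m) (O : Set (Eucl (m + 1))) : Set (L2 O) :=
  if C.q =ᵐ[surfaceMeasure O] 0 then H1 O else H11 O

/-! ### The time-discontinuous Galerkin scheme -/

/-- `V` belongs to `𝓟_d(𝓑, 𝓣)`: on each interval `(tₙ, tₙ₊₁]`, `n < M`, it is a polynomial of
degree at most `d` with coefficients in `𝓑`. -/
def IsPiecewisePoly {X : Type*} [AddCommGroup X] [Module ℝ X] (B : Set X) (d M : ℕ)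
    (t : ℕ → ℝ) (V : ℝ → X) : Prop :=
  ∀ n < M, ∃ φ : ℕ → X, (∀ i, φ i ∈ B) ∧
    ∀ τ ∈ Ioc (t n) (t (n + 1)), V τ = ∑ i ∈ Finset.range (d + 1), τ ^ i • φ i

/-- `U` solves the discontinuous Galerkin scheme of degree `d` on the mesh `t 0 < ⋯ < t M`, with
initial value `u₀` and data `f`, `g`. As the intervals are closed on the right, and by the
initial condition, the left limit `U(tₙ⁻)` is the value `U (t n)`. -/
def IsDGSolution (C : Coefficients m) (O : Set (Eucl (m + 1))) (d M : ℕ) (t : ℕ → ℝ)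
    (u₀ : L2 O) (f : ℝ → L2 O) (g : ℝ → L2Boundary O) (U : ℝ → L2 O) : Prop :=
  IsPiecewisePoly (trialSpace C O) d M t U ∧ U (t 0) = u₀ ∧
    ∀ V : ℝ → L2 O, IsPiecewisePoly (trialSpace C O) d M t V → ∀ n < M,
      (∫ τ in Ioc (t n) (t (n + 1)),
          (massForm C O (deriv U τ) (V τ) + energyForm C O (U τ) (V τ)))
        + massForm C O (Function.rightLim U (t n) - U (t n)) (Function.rightLim V (t n))
      = ∫ τ in Ioc (t n) (t (n + 1)), loadForm (f τ) (g τ) (V τ)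

end

open MeasureTheory Set Filter
open scoped Topology NNReal ENNReal ContDiff

/-! ### Integration lemmas -/

/-! On one interval the unknown is a vector of `d + 1` coefficients in the trial space, and the
scheme is one linear equation for it whose right-hand side contains the data and the value inherited
from the left. Testing with the solution itself gives `∫ m(U', U) + m(U(a⁺), U(a⁺)) = ½ m(U(b),
U(b)) + ½ m(U(a⁺), U(a⁺)) ≥ 0`, so the form of the step dominates `∫ a(U, U) ≥ κ ∫ ‖U‖²`. The Gram
matrix of the monomials on the interval is positive definite, so this integral controls all
coefficients (`exists_le_integral_sq_norm_polyCurve`), and Lax-Milgram solves the step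
(`existsUnique_galerkinStep`). Recursion over the mesh glues the steps together
(`exists_unique_galerkinScheme`).

What remains is a Hilbert structure on the trial space for which `m` and `a` are bounded and `a` is
coercive (`exists_hilbert_model`). The trial space is identified with a closed subspace of a product
of four `L²` spaces holding a function, its gradient, its trace and the tangential gradient of the
trace; in the Robin case the last component is zero. On the diagonal the two antisymmetric first
order parts of `a` vanish, `ν₀` and `α₀` bound the gradient and the function, and `q₀ s₀` bounds the
tangential gradient. The boundary weight has no positive lower bound, so the trace component is
absorbed by the trace inequality instead.

Weak gradient, trace, tangential gradient and normal are defined by choice, so each needs uniqueness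
before the forms can be rewritten on the model. For traces this rests on the trace inequality
`IsLipschitzDomain.exists_trace_bound`; their existence needs in addition the density of test
functions, `IsLipschitzDomain.exists_smooth_approx`, where mollifiers are shifted into the domain
along the cone above a Lipschitz graph. Tangential gradients are handled in graph charts: the
parametrization distorts measures by bounded factors, Rademacher's theorem gives the normal almost
everywhere, and the pull-back together with tangentiality determines the vector. -/

lemma integrableOn_smul_of_tsupport_subset {k : ℕ} {F : Type*}
    [NormedAddCommGroup F] [NormedSpace ℝ F] {V : Set (Eucl k)} {G : Eucl k → F}
    (hG : LocallyIntegrableOn G V) {ψ : Eucl k → ℝ} (hψ : Continuous ψ)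
    (hc : HasCompactSupport ψ) (hs : tsupport ψ ⊆ V) :
    IntegrableOn (fun x => ψ x • G x) V := by
  have h1 : IntegrableOn G (tsupport ψ) := hG.integrableOn_compact_subset hs hc
  have h2 : IntegrableOn (fun x => ψ x • G x) (tsupport ψ) :=
    h1.continuousOn_smul hψ.continuousOn hc
  have h3 : Integrable (fun x => ψ x • G x) := by
    rw [← integrableOn_iff_integrable_of_support_subset (s := tsupport ψ)]
    · exact h2
    · intro x hx
      refine subset_tsupport _ ?_
      intro h
      exact hx (by simp [h])
  exact h3.integrableOn

lemma locallyIntegrableOn_of_memLp {k : ℕ} {F : Type*} [NormedAddCommGroup F]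
    {V : Set (Eucl k)} {G : Eucl k → F} {p : ℝ≥0∞} (hp : 1 ≤ p)
    (hG : MemLp G p (volume.restrict V)) : LocallyIntegrableOn G V :=
  locallyIntegrableOn_of_locallyIntegrable_restrict (hG.locallyIntegrable hp)

lemma tendsto_zero_of_le_const_mul {ι : Type*} {l : Filter ι} {F a : ι → ℝ≥0∞}
    (h : Tendsto F l (𝓝 0)) {c : ℝ≥0∞} (hc : c ≠ ⊤) (hle : ∀ j, a j ≤ c * F j) :
    Tendsto a l (𝓝 0) := by
  have hb : Tendsto (fun j => c * F j) l (𝓝 0) := by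
    simpa using ENNReal.Tendsto.const_mul h (Or.inr hc)
  exact tendsto_of_tendsto_of_tendsto_of_le_of_le tendsto_const_nhds hb (fun _ => zero_le) hle

lemma tendsto_integral_mul_of_eLpNorm {α : Type*} [MeasurableSpace α] {μ : Measure α}
    {f u : α → ℝ} {w : ℕ → α → ℝ} (hf : MemLp f 2 μ) (hu : MemLp u 2 μ)
    (hw : ∀ j, MemLp (w j) 2 μ)
    (h : Tendsto (fun j => eLpNorm (fun x => w j x - u x) 2 μ) atTop (𝓝 0)) :
    Tendsto (fun j => ∫ x, f x * w j x ∂μ) atTop (𝓝 (∫ x, f x * u x ∂μ)) := by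
  refine tendsto_integral_of_L1 _ (hf.aestronglyMeasurable.mul hu.aestronglyMeasurable)
    (Eventually.of_forall fun j => hf.integrable_mul (hw j)) ?_
  refine tendsto_zero_of_le_const_mul h hf.eLpNorm_lt_top.ne fun j => ?_
  have := eLpNorm_smul_le_mul_eLpNorm (p := 2) (q := 2) (r := 1)
    ((hw j).sub hu).aestronglyMeasurable hf.aestronglyMeasurable
  calc ∫⁻ x, ‖f x * w j x - f x * u x‖ₑ ∂μ
      = eLpNorm (f • (w j - u)) 1 μ := by
        rw [eLpNorm_one_eq_lintegral_enorm]
        congr with x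
        simp [mul_sub]
    _ ≤ _ := this

/-! ### Calculus of weak gradients -/

lemma HasWeakGradient.congr {k : ℕ} {V : Set (Eucl k)} {v v' : Eucl k → ℝ}
    {G G' : Eucl k → Eucl k} (h : HasWeakGradient V v G)
    (hv : v =ᵐ[volume.restrict V] v') (hG : G =ᵐ[volume.restrict V] G') :
    HasWeakGradient V v' G' := by
  refine ⟨h.1.congr hv, h.2.1.congr hG, fun ψ h1 h2 h3 ξ => ?_⟩
  have e1 : ∫ x in V, v x * fderiv ℝ ψ x ξ = ∫ x in V, v' x * fderiv ℝ ψ x ξ :=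
    integral_congr_ae (by filter_upwards [hv] with x hx; rw [hx])
  have e2 : ∫ x in V, inner ℝ (G x) ξ * ψ x = ∫ x in V, inner ℝ (G' x) ξ * ψ x :=
    integral_congr_ae (by filter_upwards [hG] with x hx; rw [hx])
  rw [← e1, ← e2]
  exact h.2.2 ψ h1 h2 h3 ξ

lemma continuous_fderiv_apply_of_contDiff {k : ℕ} {ψ : Eucl k → ℝ} (h : ContDiff ℝ ∞ ψ)
    (ξ : Eucl k) : Continuous (fun x => fderiv ℝ ψ x ξ) :=
  (h.continuous_fderiv (by simp)).clm_apply continuous_const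

lemma tsupport_fderiv_apply_subset' {k : ℕ} (ψ : Eucl k → ℝ) (ξ : Eucl k) :
    tsupport (fun x => fderiv ℝ ψ x ξ) ⊆ tsupport ψ := tsupport_fderiv_apply_subset ℝ ξ

lemma HasWeakGradient.integrable_mul_fderiv {k : ℕ} {V : Set (Eucl k)} {v : Eucl k → ℝ}
    {G : Eucl k → Eucl k} (h : HasWeakGradient V v G) {ψ : Eucl k → ℝ} (h1 : ContDiff ℝ ∞ ψ)
    (h2 : HasCompactSupport ψ) (h3 : tsupport ψ ⊆ V) (ξ : Eucl k) :
    IntegrableOn (fun x => v x * fderiv ℝ ψ x ξ) V := by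
  have := integrableOn_smul_of_tsupport_subset h.1
    (continuous_fderiv_apply_of_contDiff h1 ξ)
    (h2.of_isClosed_subset (isClosed_tsupport _) (tsupport_fderiv_apply_subset' ψ ξ))
    ((tsupport_fderiv_apply_subset' ψ ξ).trans h3)
  simpa [mul_comm] using this

lemma HasWeakGradient.integrable_inner_mul {k : ℕ} {V : Set (Eucl k)} {v : Eucl k → ℝ}
    {G : Eucl k → Eucl k} (h : HasWeakGradient V v G) {ψ : Eucl k → ℝ} (h1 : ContDiff ℝ ∞ ψ)
    (h2 : HasCompactSupport ψ) (h3 : tsupport ψ ⊆ V) (ξ : Eucl k) :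
    IntegrableOn (fun x => inner ℝ (G x) ξ * ψ x) V := by
  have := integrableOn_smul_of_tsupport_subset h.2.1 h1.continuous h2 h3
  have : IntegrableOn (fun x => inner ℝ (ψ x • G x) ξ) V := this.inner_const (𝕜 := ℝ) ξ
  refine this.congr_fun_ae (Eventually.of_forall fun x => ?_)
  simp [inner_smul_left, mul_comm]

lemma HasWeakGradient.add {k : ℕ} {V : Set (Eucl k)} {v v' : Eucl k → ℝ}
    {G G' : Eucl k → Eucl k} (h : HasWeakGradient V v G) (h' : HasWeakGradient V v' G') :
    HasWeakGradient V (fun x => v x + v' x) (fun x => G x + G' x) := by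
  refine ⟨h.1.add h'.1, h.2.1.add h'.2.1, fun ψ h1 h2 h3 ξ => ?_⟩
  simp only [add_mul, inner_add_left]
  rw [integral_add (h.integrable_mul_fderiv h1 h2 h3 ξ) (h'.integrable_mul_fderiv h1 h2 h3 ξ),
    integral_add (h.integrable_inner_mul h1 h2 h3 ξ) (h'.integrable_inner_mul h1 h2 h3 ξ),
    h.2.2 ψ h1 h2 h3, h'.2.2 ψ h1 h2 h3]
  ring

lemma HasWeakGradient.const_mul {k : ℕ} {V : Set (Eucl k)} {v : Eucl k → ℝ}
    {G : Eucl k → Eucl k} (h : HasWeakGradient V v G) (a : ℝ) :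
    HasWeakGradient V (fun x => a * v x) (fun x => a • G x) := by
  refine ⟨h.1.smul a, h.2.1.smul a, fun ψ h1 h2 h3 ξ => ?_⟩
  simp only [mul_assoc, inner_smul_left, integral_const_mul, h.2.2 ψ h1 h2 h3]
  simp

/-- The fundamental lemma of the calculus of variations, applied to `G - G'` and checked against
each direction `ξ`. -/
lemma HasWeakGradient.ae_eq {k : ℕ} {V : Set (Eucl k)} (hV : IsOpen V) {v : Eucl k → ℝ}
    {G G' : Eucl k → Eucl k} (h : HasWeakGradient V v G) (h' : HasWeakGradient V v G') :
    G =ᵐ[volume.restrict V] G' := by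
  have key : ∀ᵐ x, x ∈ V → (G - G') x = 0 := by
    refine hV.ae_eq_zero_of_integral_contDiff_smul_eq_zero (h.2.1.sub h'.2.1) ?_
    intro g h1 h2 h3
    have hi : IntegrableOn (fun x => g x • (G - G') x) V :=
      integrableOn_smul_of_tsupport_subset (h.2.1.sub h'.2.1)
        h1.continuous h2 h3
    rw [← setIntegral_eq_integral_of_forall_compl_eq_zero (s := V)]
    swap
    · intro x hx
      rw [image_eq_zero_of_notMem_tsupport (fun hx' => hx (h3 hx')), zero_smul]
    refine ext_inner_right ℝ fun ξ => ?_
    rw [inner_zero_left, real_inner_comm, ← integral_inner hi]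
    have e : ∀ x, inner ℝ ξ (g x • (G - G') x)
        = inner ℝ (G x) ξ * g x - inner ℝ (G' x) ξ * g x := by
      intro x
      simp only [Pi.sub_apply, inner_smul_right, inner_sub_right, real_inner_comm ξ]
      ring
    simp only [e]
    rw [integral_sub (h.integrable_inner_mul h1 h2 h3 ξ) (h'.integrable_inner_mul h1 h2 h3 ξ)]
    have e1 := h.2.2 g h1 h2 h3 ξ
    have e2 := h'.2.2 g h1 h2 h3 ξ
    linarith
  refine (ae_restrict_iff' hV.measurableSet).2 ?_
  filter_upwards [key] with x hx hxV
  exact sub_eq_zero.1 (hx hxV)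

/-- The chosen gradient is accessible only through uniqueness; every later computation with
`weakGradient` passes through this lemma. -/
lemma weakGradient_ae_eq {k : ℕ} {V : Set (Eucl k)} (hV : IsOpen V) {v : Eucl k → ℝ}
    {G : Eucl k → Eucl k} (h : HasWeakGradient V v G) :
    weakGradient V v =ᵐ[volume.restrict V] G := by
  have hex : ∃ G, HasWeakGradient V v G := ⟨G, h⟩
  rw [weakGradient, dif_pos hex]
  exact hex.choose_spec.ae_eq hV h

lemma inner_gradient_left' {k : ℕ} (φ : Eucl k → ℝ) (x ξ : Eucl k) :
    inner ℝ (gradient φ x) ξ = fderiv ℝ φ x ξ := by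
  rw [gradient, InnerProductSpace.toDual_symm_apply]

lemma continuous_gradient_of_contDiff {k : ℕ} {φ : Eucl k → ℝ} (h : ContDiff ℝ ∞ φ) :
    Continuous (gradient φ) :=
  (InnerProductSpace.toDual ℝ (Eucl k)).symm.continuous.comp (h.continuous_fderiv (by simp))

/-- The product of a weakly differentiable function and a smooth one. -/
lemma HasWeakGradient.smooth_mul {k : ℕ} {V : Set (Eucl k)} (hV : IsOpen V) {v : Eucl k → ℝ}
    {G : Eucl k → Eucl k} (h : HasWeakGradient V v G) {φ : Eucl k → ℝ} (hφ : ContDiff ℝ ∞ φ) :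
    HasWeakGradient V (fun x => φ x * v x) (fun x => φ x • G x + v x • gradient φ x) := by
  have i1 : LocallyIntegrableOn (fun x => φ x • G x) V :=
    h.2.1.continuousOn_smul hV.isLocallyClosed hφ.continuous.continuousOn
  have i2 : LocallyIntegrableOn (fun x => v x • gradient φ x) V :=
    h.1.smul_continuousOn hV.isLocallyClosed (continuous_gradient_of_contDiff hφ).continuousOn
  refine ⟨h.1.continuousOn_smul hV.isLocallyClosed hφ.continuous.continuousOn, i1.add i2,
    fun ψ h1 h2 h3 ξ => ?_⟩
  have hs : tsupport (fun x => φ x * ψ x) ⊆ tsupport ψ := tsupport_mul_subset_right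
  have c1 : ContDiff ℝ ∞ (fun x => φ x * ψ x) := hφ.mul h1
  have c2 : HasCompactSupport (fun x => φ x * ψ x) := h2.mul_left
  -- The product `φ ψ` is again an admissible test function; the term `ψ ∂φ` of its derivative
  -- produces the summand `v ∇φ`.
  have e := h.2.2 _ c1 c2 (hs.trans h3) ξ
  have hd : ∀ x, fderiv ℝ (fun x => φ x * ψ x) x ξ
      = φ x * fderiv ℝ ψ x ξ + ψ x * fderiv ℝ φ x ξ := by
    intro x
    have d1 : DifferentiableAt ℝ φ x := hφ.differentiable (by simp) x
    have d2 : DifferentiableAt ℝ ψ x := h1.differentiable (by simp) x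
    rw [fderiv_fun_mul d1 d2]
    simp
  simp only [hd] at e
  have j1 : IntegrableOn (fun x => φ x * v x * fderiv ℝ ψ x ξ) V := by
    have hc : Continuous (fun x => φ x * fderiv ℝ ψ x ξ) :=
      hφ.continuous.mul (continuous_fderiv_apply_of_contDiff h1 ξ)
    have hsub : tsupport (fun x => φ x * fderiv ℝ ψ x ξ) ⊆ tsupport ψ :=
      tsupport_mul_subset_right.trans (tsupport_fderiv_apply_subset' ψ ξ)
    have := integrableOn_smul_of_tsupport_subset h.1 hc
      (h2.of_isClosed_subset (isClosed_tsupport _) hsub) (hsub.trans h3)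
    refine this.congr_fun_ae (Eventually.of_forall fun x => ?_)
    simp only [smul_eq_mul]; ring
  have j2 : IntegrableOn (fun x => v x * ψ x * fderiv ℝ φ x ξ) V := by
    have hc : Continuous (fun x => ψ x * fderiv ℝ φ x ξ) :=
      h1.continuous.mul (continuous_fderiv_apply_of_contDiff hφ ξ)
    have hsub : tsupport (fun x => ψ x * fderiv ℝ φ x ξ) ⊆ tsupport ψ :=
      tsupport_mul_subset_left
    have := integrableOn_smul_of_tsupport_subset h.1 hc
      (h2.of_isClosed_subset (isClosed_tsupport _) hsub) (hsub.trans h3)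
    refine this.congr_fun_ae (Eventually.of_forall fun x => ?_)
    simp only [smul_eq_mul]; ring
  have j3 := h.integrable_inner_mul c1 c2 (hs.trans h3) ξ
  have e1 : ∀ x, v x * (φ x * fderiv ℝ ψ x ξ + ψ x * fderiv ℝ φ x ξ)
      = φ x * v x * fderiv ℝ ψ x ξ + v x * ψ x * fderiv ℝ φ x ξ := fun x => by ring
  have e2 : ∀ x, inner ℝ (φ x • G x + v x • gradient φ x) ξ * ψ x
      = inner ℝ (G x) ξ * (φ x * ψ x) + v x * ψ x * fderiv ℝ φ x ξ := fun x => by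
    rw [inner_add_left, inner_smul_left, inner_smul_left, inner_gradient_left']
    simp only [conj_trivial]
    ring
  simp only [e1] at e
  simp only [e2]
  rw [integral_add j1 j2] at e
  rw [integral_add j3 j2]
  linarith

lemma eLpNorm_inner_const_le {α : Type*} [MeasurableSpace α] {μ : Measure α} {k : ℕ}
    (F : α → Eucl k) (ξ : Eucl k) :
    eLpNorm (fun x => inner ℝ (F x) ξ) 2 μ ≤ ENNReal.ofReal ‖ξ‖ * eLpNorm F 2 μ :=
  eLpNorm_le_mul_eLpNorm_of_ae_le_mul (Eventually.of_forall fun x => by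
    rw [mul_comm]; exact norm_inner_le_norm _ _) 2

/-- Weak gradients are stable under `L²` limits. -/
lemma HasWeakGradient.of_tendsto {k : ℕ} {V : Set (Eucl k)} {v : Eucl k → ℝ}
    {G : Eucl k → Eucl k} {w : ℕ → Eucl k → ℝ} {H : ℕ → Eucl k → Eucl k}
    (hw : ∀ j, HasWeakGradient V (w j) (H j))
    (mw : ∀ j, MemLp (w j) 2 (volume.restrict V)) (mH : ∀ j, MemLp (H j) 2 (volume.restrict V))
    (mv : MemLp v 2 (volume.restrict V)) (mG : MemLp G 2 (volume.restrict V))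
    (tv : Tendsto (fun j => eLpNorm (fun x => w j x - v x) 2 (volume.restrict V)) atTop (𝓝 0))
    (tG : Tendsto (fun j => eLpNorm (fun x => H j x - G x) 2 (volume.restrict V)) atTop (𝓝 0)) :
    HasWeakGradient V v G := by
  refine ⟨locallyIntegrableOn_of_memLp one_le_two mv, locallyIntegrableOn_of_memLp one_le_two mG,
    fun ψ h1 h2 h3 ξ => ?_⟩
  have mψ : MemLp ψ 2 (volume.restrict V) :=
    (h1.continuous.memLp_of_hasCompactSupport h2).restrict V
  have mψ' : MemLp (fun x => fderiv ℝ ψ x ξ) 2 (volume.restrict V) :=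
    ((continuous_fderiv_apply_of_contDiff h1 ξ).memLp_of_hasCompactSupport
      (h2.of_isClosed_subset (isClosed_tsupport _) (tsupport_fderiv_apply_subset' ψ ξ))).restrict V
  have t1 := tendsto_integral_mul_of_eLpNorm mψ' mv mw tv
  have t2 := tendsto_integral_mul_of_eLpNorm (w := fun j x => inner ℝ (H j x) ξ)
    (u := fun x => inner ℝ (G x) ξ) mψ (mG.inner_const ξ) (fun j => (mH j).inner_const ξ) (by
      refine tendsto_zero_of_le_const_mul tG (c := ENNReal.ofReal ‖ξ‖) ENNReal.ofReal_ne_top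
        fun j => ?_
      refine le_trans (le_of_eq ?_) (eLpNorm_inner_const_le _ ξ)
      simp only [inner_sub_left])
  have e : ∀ j, ∫ x in V, fderiv ℝ ψ x ξ * w j x = -∫ x in V, ψ x * inner ℝ (H j x) ξ := by
    intro j
    have := (hw j).2.2 ψ h1 h2 h3 ξ
    simp only [mul_comm (fderiv ℝ ψ _ ξ), mul_comm (ψ _)]
    exact this
  simp only [e] at t1
  have := tendsto_nhds_unique t1 t2.neg
  simp only [mul_comm (fderiv ℝ ψ _ ξ), mul_comm (ψ _)] at this
  exact this

/-- Weak differentiability is a local property. -/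
lemma HasWeakGradient.of_forall_smooth_mul {k : ℕ} {V : Set (Eucl k)} (hV : IsOpen V)
    {v : Eucl k → ℝ} {G : Eucl k → Eucl k}
    (hv : LocallyIntegrableOn v V) (hG : LocallyIntegrableOn G V)
    (h : ∀ φ : Eucl k → ℝ, ContDiff ℝ ∞ φ → HasCompactSupport φ → tsupport φ ⊆ V →
      HasWeakGradient V (fun x => φ x * v x) (fun x => φ x • G x + v x • gradient φ x)) :
    HasWeakGradient V v G := by
  refine ⟨hv, hG, fun ψ h1 h2 h3 ξ => ?_⟩
  -- A cutoff `φ` equal to `1` on a neighbourhood of the support of `ψ` has zero gradient there, so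
  -- the identity for `φ v` tested with `ψ` is the one for `v`.
  obtain ⟨δ, hδ, hδV⟩ := h2.exists_cthickening_subset_open hV h3
  obtain ⟨φ, hφ, -, hφs, hφ1⟩ := exists_contMDiff_support_eq_eq_one_iff
    (modelWithCornersSelf ℝ (Eucl k)) (n := ⊤)
    (Metric.isOpen_thickening (δ := δ) (E := tsupport ψ))
    (Metric.isClosed_cthickening (δ := δ / 2) (E := tsupport ψ))
    (Metric.cthickening_subset_thickening' hδ (by linarith) _)
  have hφc : ContDiff ℝ ∞ φ := hφ.contDiff
  have hts : tsupport φ ⊆ Metric.cthickening δ (tsupport ψ) := by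
    rw [tsupport, hφs]
    exact Metric.closure_thickening_subset_cthickening _ _
  have hcomp : HasCompactSupport φ :=
    IsCompact.of_isClosed_subset h2.cthickening (isClosed_tsupport _) hts
  have e := (h φ hφc hcomp (hts.trans hδV)).2.2 ψ h1 h2 h3 ξ
  have one : ∀ x ∈ tsupport ψ, φ x = 1 := fun x hx =>
    (hφ1 x).1 (Metric.self_subset_cthickening _ hx)
  have grad : ∀ x ∈ tsupport ψ, gradient φ x = 0 := fun x hx => by
    have : φ =ᶠ[𝓝 x] fun _ => 1 := by
      have : Metric.cthickening (δ / 2) (tsupport ψ) ∈ 𝓝 x :=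
        mem_of_superset (Metric.isOpen_thickening.mem_nhds
          (Metric.self_subset_thickening (half_pos hδ) _ hx))
          (Metric.thickening_subset_cthickening _ _)
      filter_upwards [this] with y hy
      exact (hφ1 y).1 hy
    rw [gradient, this.fderiv_eq]
    simp
  have e1 : ∀ x, φ x * v x * fderiv ℝ ψ x ξ = v x * fderiv ℝ ψ x ξ := fun x => by
    by_cases hx : x ∈ tsupport ψ
    · rw [one x hx, one_mul]
    · rw [image_eq_zero_of_notMem_tsupport (f := fun x => fderiv ℝ ψ x ξ)
        (fun h => hx (tsupport_fderiv_apply_subset' ψ ξ h))]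
      simp
  have e2 : ∀ x, inner ℝ (φ x • G x + v x • gradient φ x) ξ * ψ x = inner ℝ (G x) ξ * ψ x := by
    intro x
    by_cases hx : x ∈ tsupport ψ
    · rw [one x hx, grad x hx]; simp
    · rw [image_eq_zero_of_notMem_tsupport hx]; simp
  simpa only [e1, e2] using e

/-! ### Mollification in `L²` -/

lemma eLpNorm_two_sq {α F : Type*} [MeasurableSpace α] [NormedAddCommGroup F] {μ : Measure α}
    (f : α → F) : eLpNorm f 2 μ ^ 2 = ∫⁻ x, ‖f x‖ₑ ^ 2 ∂μ := by
  have := eLpNorm_nnreal_pow_eq_lintegral (f := f) (μ := μ) (p := 2) (by norm_num)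
  simpa using this

lemma eLpNorm_two_le_of_sq {α F : Type*} [MeasurableSpace α] [NormedAddCommGroup F]
    {μ : Measure α} {f : α → F} {ε : ℝ≥0∞} (h : ∫⁻ x, ‖f x‖ₑ ^ 2 ∂μ ≤ ε ^ 2) :
    eLpNorm f 2 μ ≤ ε := by
  rw [← eLpNorm_two_sq] at h
  exact (ENNReal.pow_le_pow_left_iff two_ne_zero).1 h

/-- Jensen's inequality for the probability density `κ`, obtained from Cauchy-Schwarz after
splitting `κ = κ^{1/2} κ^{1/2}`. -/
lemma sq_lintegral_mul_le {α : Type*} [MeasurableSpace α] {μ : Measure α} {κ h : α → ℝ≥0∞}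
    (hκ : AEMeasurable κ μ) (hκ1 : ∫⁻ x, κ x ∂μ = 1) (hh : AEMeasurable h μ) :
    (∫⁻ x, κ x * h x ∂μ) ^ 2 ≤ ∫⁻ x, κ x * h x ^ 2 ∂μ := by
  have key := ENNReal.lintegral_mul_le_Lp_mul_Lq μ (p := 2) (q := 2)
    (Real.HolderConjugate.two_two) (f := fun x => κ x ^ (1 / 2 : ℝ) * h x)
    (g := fun x => κ x ^ (1 / 2 : ℝ)) ((hκ.pow_const _).mul hh) (hκ.pow_const _)
  have e0 : ∀ x, κ x ^ (1 / 2 : ℝ) * κ x ^ (1 / 2 : ℝ) = κ x := fun x => by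
    rw [← ENNReal.rpow_add_of_nonneg _ _ (by norm_num) (by norm_num)]; norm_num
  have e1 : ∀ x, ((fun x => κ x ^ (1 / 2 : ℝ) * h x) * fun x => κ x ^ (1 / 2 : ℝ)) x
      = κ x * h x := fun x => by
    simp only [Pi.mul_apply]
    rw [mul_right_comm, e0]
  have e2 : ∀ x, (κ x ^ (1 / 2 : ℝ) * h x) ^ (2 : ℝ) = κ x * h x ^ 2 := fun x => by
    rw [ENNReal.rpow_two, mul_pow, sq (κ x ^ (1 / 2 : ℝ)), e0]
  have e3 : ∀ x, (κ x ^ (1 / 2 : ℝ)) ^ (2 : ℝ) = κ x := fun x => by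
    rw [ENNReal.rpow_two, sq, e0]
  simp only [e1, e2, e3, hκ1, ENNReal.one_rpow, mul_one] at key
  calc (∫⁻ x, κ x * h x ∂μ) ^ 2 ≤ ((∫⁻ x, κ x * h x ^ 2 ∂μ) ^ (1 / 2 : ℝ)) ^ 2 := by gcongr
    _ = _ := by
      rw [← ENNReal.rpow_two, ← ENNReal.rpow_mul]; norm_num

/-- Continuity of translations in `L²`: composition with measure preserving maps depends
continuously on the map. -/
lemma tendsto_eLpNorm_translate_sub {k : ℕ} {F : Type*} [NormedAddCommGroup F]
    {f : Eucl k → F} (hf : MemLp f 2 volume) :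
    Tendsto (fun t => eLpNorm (fun x => f (x - t) - f x) 2 volume) (𝓝 0) (𝓝 0) := by
  have hm : ∀ t : Eucl k, MeasurePreserving (ContinuousMap.mk (fun x : Eucl k => x - t)
      (by fun_prop)) volume volume := fun t => measurePreserving_sub_right volume t
  have hcont : Continuous fun t : Eucl k => ContinuousMap.mk (fun x : Eucl k => x - t)
      (by fun_prop) :=
    ContinuousMap.continuous_of_continuous_uncurry _ (by
      change Continuous fun p : Eucl k × Eucl k => p.2 - p.1
      fun_prop)
  have h := (continuous_const (y := hf.toLp f)).compMeasurePreservingLp hcont hm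
    (ENNReal.ofNat_ne_top)
  have h0 := h.tendsto 0
  rw [tendsto_iff_edist_tendsto_0] at h0
  refine h0.congr fun t => ?_
  rw [Lp.edist_def]
  refine eLpNorm_congr_ae ?_
  have a1 := Lp.coeFn_compMeasurePreserving (hf.toLp f) (hm t)
  have a2 := Lp.coeFn_compMeasurePreserving (hf.toLp f) (hm 0)
  have a3 := (hm t).quasiMeasurePreserving.ae_eq_comp hf.coeFn_toLp
  have a4 := (hm 0).quasiMeasurePreserving.ae_eq_comp hf.coeFn_toLp
  filter_upwards [a1, a2, a3, a4] with x h1 h2 h3 h4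
  simp only [Pi.sub_apply, h1, h2]
  simp only [Function.comp_apply] at h3 h4 ⊢
  rw [h3, h4]
  simp

/-- The error is the `κ`-average of `f(· - t) - f`; Jensen pointwise and Tonelli bound it by the
worst translation error over the shifts that `κ` sees. The kernel need not be centred at the origin,
which permits mollifiers shifted into a domain. -/
lemma eLpNorm_mollify_sub_le {k : ℕ} {F : Type*} [NormedAddCommGroup F] [NormedSpace ℝ F]
    [CompleteSpace F] {f : Eucl k → F} (hf : MemLp f 2 volume) {κ : Eucl k → ℝ}
    (hκ : Continuous κ) (hκc : HasCompactSupport κ) (hκ0 : ∀ x, 0 ≤ κ x) (hκ1 : ∫ x, κ x = 1)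
    {ε : ℝ≥0∞} (hε : ∀ t, κ t ≠ 0 → eLpNorm (fun x => f (x - t) - f x) 2 volume ≤ ε) :
    eLpNorm (fun x => (∫ t, κ (x - t) • f t) - f x) 2 volume ≤ ε := by
  have hκi : Integrable κ := hκ.integrable_of_hasCompactSupport hκc
  have hκl : ∫⁻ x, ENNReal.ofReal (κ x) = 1 := by
    rw [← ofReal_integral_eq_lintegral_ofReal hκi (Eventually.of_forall hκ0), hκ1]; simp
  have hloc : LocallyIntegrable f := hf.locallyIntegrable one_le_two
  have hsub : ∀ x : Eucl k, AEStronglyMeasurable (fun t => f (x - t)) volume := fun x =>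
    hf.aestronglyMeasurable.comp_measurePreserving (Measure.measurePreserving_sub_left volume x)
  have hpt : ∀ x, ‖(∫ t, κ (x - t) • f t) - f x‖ₑ ^ 2
      ≤ ∫⁻ t, ENNReal.ofReal (κ t) * ‖f (x - t) - f x‖ₑ ^ 2 := by
    intro x
    have i1 : Integrable (fun t => κ t • f (x - t)) := by
      have : Integrable (fun t => κ (x - t) • f t) := by
        refine hloc.integrable_smul_left_of_hasCompactSupport (by fun_prop) ?_
        exact hκc.comp_homeomorph (Homeomorph.subLeft x)
      have := (Measure.measurePreserving_sub_left volume x).integrable_comp_of_integrable this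
      simpa [Function.comp_def] using this
    have e1 : (∫ t, κ (x - t) • f t) = ∫ t, κ t • f (x - t) := by
      rw [← integral_sub_left_eq_self _ volume x]
      simp
    have e2 : (∫ t, κ t • f (x - t)) - f x = ∫ t, κ t • (f (x - t) - f x) := by
      simp only [smul_sub]
      rw [integral_sub i1 (hκi.smul_const _), integral_smul_const, hκ1, one_smul]
    rw [e1, e2]
    refine le_trans ?_ (sq_lintegral_mul_le (hκ.measurable.ennreal_ofReal.aemeasurable) hκl
      ((hsub x).sub aestronglyMeasurable_const).enorm)
    gcongr
    refine (enorm_integral_le_lintegral_enorm _).trans (le_of_eq ?_)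
    congr with t
    rw [enorm_smul, Real.enorm_of_nonneg (hκ0 t)]
  refine eLpNorm_two_le_of_sq ?_
  refine (lintegral_mono hpt).trans ?_
  rw [lintegral_lintegral_swap]
  swap
  · have q1 : AEStronglyMeasurable (fun p : Eucl k × Eucl k => f (p.1 - p.2))
        (volume.prod volume) :=
      hf.aestronglyMeasurable.comp_quasiMeasurePreserving
        (quasiMeasurePreserving_sub_of_right_invariant volume volume)
    have q2 : AEStronglyMeasurable (fun p : Eucl k × Eucl k => f p.1)
        (volume.prod volume) := hf.aestronglyMeasurable.comp_fst
    exact ((hκ.measurable.comp measurable_snd).ennreal_ofReal.aemeasurable).mul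
      ((q1.sub q2).enorm.pow_const 2)
  calc ∫⁻ t, ∫⁻ x, ENNReal.ofReal (κ t) * ‖f (x - t) - f x‖ₑ ^ 2
      = ∫⁻ t, ENNReal.ofReal (κ t) * eLpNorm (fun x => f (x - t) - f x) 2 volume ^ 2 := by
        congr with t
        rw [lintegral_const_mul' _ _ ENNReal.ofReal_ne_top, eLpNorm_two_sq]
    _ ≤ ∫⁻ t, ENNReal.ofReal (κ t) * ε ^ 2 := by
        refine lintegral_mono fun t => ?_
        by_cases ht : κ t = 0
        · simp [ht]
        · gcongr
          exact hε t ht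
    _ = ε ^ 2 := by
        rw [lintegral_mul_const _ hκ.measurable.ennreal_ofReal, hκl, one_mul]

lemma gradient_eq_zero_of_notMem_tsupport {k : ℕ} {φ : Eucl k → ℝ} {x : Eucl k}
    (h : x ∉ tsupport φ) : gradient φ x = 0 := by
  have : fderiv ℝ φ x = 0 := by
    by_contra hne
    exact h (support_fderiv_subset ℝ hne)
  rw [gradient, this]; simp

lemma hasCompactSupport_gradient {k : ℕ} {φ : Eucl k → ℝ} (h : HasCompactSupport φ) :
    HasCompactSupport (gradient φ) :=
  HasCompactSupport.intro h fun _ hx => gradient_eq_zero_of_notMem_tsupport hx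

lemma memLp_smul_of_hasCompactSupport {α F : Type*} [TopologicalSpace α] [MeasurableSpace α]
    [OpensMeasurableSpace α] {μ : Measure α} [NormedAddCommGroup F] [NormedSpace ℝ F]
    {φ : α → ℝ} (hφ : Continuous φ) (hc : HasCompactSupport φ) {f : α → F}
    {p : ℝ≥0∞} (hf : MemLp f p μ) : MemLp (fun x => φ x • f x) p μ := by
  obtain ⟨B, hB⟩ := hφ.bounded_above_of_compact_support hc
  exact hf.of_le_mul (c := B) (hφ.aestronglyMeasurable.smul hf.aestronglyMeasurable)
    (Eventually.of_forall fun x => by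
      rw [norm_smul]
      exact mul_le_mul_of_nonneg_right (hB x) (norm_nonneg _))

lemma memLp_smul_gradient {k : ℕ} {μ : Measure (Eucl k)} {φ : Eucl k → ℝ}
    (hφ : ContDiff ℝ ∞ φ) (hc : HasCompactSupport φ) {v : Eucl k → ℝ} {p : ℝ≥0∞}
    (hv : MemLp v p μ) : MemLp (fun x => v x • gradient φ x) p μ := by
  obtain ⟨B, hB⟩ := (continuous_gradient_of_contDiff hφ).bounded_above_of_compact_support
    (hasCompactSupport_gradient hc)
  exact hv.of_le_mul (c := B) (hv.aestronglyMeasurable.smul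
    (continuous_gradient_of_contDiff hφ).aestronglyMeasurable)
    (Eventually.of_forall fun x => by
      rw [norm_smul, mul_comm]
      exact mul_le_mul_of_nonneg_right (hB x) (norm_nonneg _))

lemma exists_mollifier {k : ℕ} (c : Eucl k) {ρ : ℝ} (hρ : 0 < ρ) :
    ∃ κ : Eucl k → ℝ, ContDiff ℝ ∞ κ ∧ HasCompactSupport κ ∧
      tsupport κ ⊆ Metric.closedBall c ρ ∧ (∀ x, 0 ≤ κ x) ∧ ∫ x, κ x = 1 := by
  let b : ContDiffBump c :=
    { rIn := ρ / 2, rOut := ρ, rIn_pos := half_pos hρ, rIn_lt_rOut := half_lt_self hρ }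
  exact ⟨b.normed volume, b.contDiff_normed, b.hasCompactSupport_normed,
    b.tsupport_normed_eq.le, b.nonneg_normed, b.integral_normed⟩

/-- Extension by zero generally destroys weak differentiability across the boundary of `V`, so the
derivative may be moved from the kernel to `v` only at points `x` where the reflected kernel `κ(x -
·)` is a test function in `V`, or where it meets no part of `v` and `G` at all. -/
lemma gradient_convolution_of_hasWeakGradient {k : ℕ} {V : Set (Eucl k)} (hV : IsOpen V)
    {v : Eucl k → ℝ} {G : Eucl k → Eucl k} (h : HasWeakGradient V v G)
    (mw : LocallyIntegrable (V.indicator v)) (mH : LocallyIntegrable (V.indicator G))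
    {κ : Eucl k → ℝ} (κs : ContDiff ℝ ∞ κ) (κc : HasCompactSupport κ) {x : Eucl k}
    (hx : (∀ t, x - t ∈ tsupport κ → t ∈ V) ∨ ∀ t, x - t ∈ tsupport κ → v t = 0 ∧ G t = 0) :
    gradient (convolution (V.indicator v) κ (ContinuousLinearMap.mul ℝ ℝ) volume) x
      = ∫ t, κ (x - t) • V.indicator G t := by
  classical
  have d := (κc.hasFDerivAt_convolution_right (ContinuousLinearMap.mul ℝ ℝ) mw
    (κs.of_le (by simp)) x).fderiv
  have ψs : ContDiff ℝ ∞ fun t => κ (x - t) := κs.comp (by fun_prop)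
  have ψc : HasCompactSupport fun t => κ (x - t) := κc.comp_homeomorph (Homeomorph.subLeft x)
  refine ext_inner_right ℝ fun ξ => ?_
  rw [inner_gradient_left']
  have iH : Integrable (fun t => κ (x - t) • V.indicator G t) :=
    mH.integrable_smul_left_of_hasCompactSupport ψs.continuous ψc
  have e1 : fderiv ℝ (convolution (V.indicator v) κ (ContinuousLinearMap.mul ℝ ℝ) volume) x ξ
      = ∫ t, V.indicator v t * fderiv ℝ κ (x - t) ξ := by
    rw [d, convolution_precompR_apply _ mw (κc.fderiv ℝ)
      (κs.continuous_fderiv (by simp)), convolution_def]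
    simp
  have e2 : inner ℝ (∫ t, κ (x - t) • V.indicator G t) ξ
      = ∫ t, inner ℝ (V.indicator G t) ξ * κ (x - t) := by
    rw [real_inner_comm, ← integral_inner iH]
    congr with t
    rw [inner_smul_right, real_inner_comm, mul_comm]
  rw [e1, e2]
  rcases hx with hx | hx
  · have ψt : tsupport (fun t => κ (x - t)) ⊆ V := by
      have hcl : IsClosed {t | x - t ∈ tsupport κ} :=
        (isClosed_tsupport κ).preimage (by fun_prop)
      have hsub : Function.support (fun t => κ (x - t)) ⊆ {t | x - t ∈ tsupport κ} :=
        fun t ht => subset_tsupport κ ht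
      exact (closure_minimal hsub hcl).trans hx
    have e := h.2.2 _ ψs ψc ψt ξ
    have hd : ∀ t, fderiv ℝ (fun t => κ (x - t)) t ξ = -fderiv ℝ κ (x - t) ξ := by
      intro t
      have h1 : HasFDerivAt κ (fderiv ℝ κ (x - t)) (x - t) :=
        (κs.differentiable (by simp) _).hasFDerivAt
      have h2 : HasFDerivAt (fun t => κ (x - t)) _ t :=
        h1.comp t ((hasFDerivAt_id t).const_sub x)
      rw [h2.fderiv]
      simp
    simp only [hd, mul_neg, integral_neg, neg_inj] at e
    rw [← integral_indicator hV.measurableSet, ← integral_indicator hV.measurableSet] at e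
    refine (integral_congr_ae (Eventually.of_forall fun t => ?_)).trans
      (e.trans (integral_congr_ae (Eventually.of_forall fun t => ?_)))
    · simp only [indicator_apply]; split_ifs <;> simp
    · simp only [indicator_apply]; split_ifs <;> simp
  · refine integral_congr_ae (Eventually.of_forall fun t => ?_)
    by_cases ht : x - t ∈ tsupport κ
    · simp [indicator_apply, (hx t ht).1, (hx t ht).2]
    · have k1 : fderiv ℝ κ (x - t) = 0 := by
        by_contra hne'
        exact ht (support_fderiv_subset ℝ hne')
      simp [k1, image_eq_zero_of_notMem_tsupport ht]

/-- If, near the support of the cutoff `φ`, small translates of points of `V` along a cone stay in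
`V`, then `φ v` is the `H¹(V)` limit of test functions of the whole space. -/
lemma exists_smooth_approx_of_cone {k : ℕ} {V : Set (Eucl k)} (hV : IsOpen V) {v : Eucl k → ℝ}
    {G : Eucl k → Eucl k} (h : HasWeakGradient V v G) (mv : MemLp v 2 (volume.restrict V))
    (mG : MemLp G 2 (volume.restrict V)) {φ : Eucl k → ℝ} (hφ : ContDiff ℝ ∞ φ)
    (hφc : HasCompactSupport φ) (c₀ : Eucl k) {r : ℝ} (hr : 0 < r)
    (hcone : ∀ᶠ δ in 𝓝[>] (0 : ℝ), ∀ x ∈ V,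
      (Metric.closedBall (x + δ • c₀) (δ * r) ∩ tsupport φ).Nonempty →
        Metric.closedBall (x + δ • c₀) (δ * r) ⊆ V) {ε : ℝ≥0∞} (hε : 0 < ε) :
    ∃ u : Eucl k → ℝ, ContDiff ℝ ∞ u ∧ HasCompactSupport u ∧
      eLpNorm (fun x => u x - φ x * v x) 2 (volume.restrict V) ≤ ε ∧
      eLpNorm (fun x => gradient u x - (φ x • G x + v x • gradient φ x)) 2
        (volume.restrict V) ≤ ε := by
  classical
  set w : Eucl k → ℝ := V.indicator fun x => φ x * v x with hw
  set H : Eucl k → Eucl k := V.indicator fun x => φ x • G x + v x • gradient φ x with hH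
  have mw : MemLp w 2 volume := (memLp_indicator_iff_restrict hV.measurableSet).2
    (memLp_smul_of_hasCompactSupport hφ.continuous hφc mv)
  have mH : MemLp H 2 volume := (memLp_indicator_iff_restrict hV.measurableSet).2
    ((memLp_smul_of_hasCompactSupport hφ.continuous hφc mG).add (memLp_smul_gradient hφ hφc mv))
  have ev : ∀ᶠ t in 𝓝 (0 : Eucl k), eLpNorm (fun x => w (x - t) - w x) 2 volume ≤ ε ∧
      eLpNorm (fun x => H (x - t) - H x) 2 volume ≤ ε :=
    ((tendsto_eLpNorm_translate_sub mw).eventually_le_const hε).and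
      ((tendsto_eLpNorm_translate_sub mH).eventually_le_const hε)
  obtain ⟨η, hη, hηball⟩ := Metric.eventually_nhds_iff_ball.1 ev
  have hsmall : ∀ᶠ δ in 𝓝[>] (0 : ℝ), δ * (‖c₀‖ + r) < η := by
    have : Tendsto (fun δ : ℝ => δ * (‖c₀‖ + r)) (𝓝[>] 0) (𝓝 0) := by
      have : Tendsto (fun δ : ℝ => δ * (‖c₀‖ + r)) (𝓝 0) (𝓝 (0 * (‖c₀‖ + r))) :=
        (continuous_id.mul continuous_const).tendsto 0
      rw [zero_mul] at this
      exact this.mono_left nhdsWithin_le_nhds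
    exact this.eventually_lt_const hη
  obtain ⟨δ, ⟨hcone, hsmall⟩, hδ⟩ :=
    ((hcone.and hsmall).and (self_mem_nhdsWithin)).exists
  replace hδ : 0 < δ := hδ
  -- With the kernel centred at `-δ c₀`, the convolution at `x` samples `w` in the ball about `x + δ
  -- c₀`, which the cone condition keeps inside `V`.
  obtain ⟨κ, κs, κc, κt, κ0, κ1⟩ := exists_mollifier (-(δ • c₀)) (mul_pos hδ hr)
  have κε : ∀ t, κ t ≠ 0 → t ∈ Metric.ball (0 : Eucl k) η := by
    intro t ht
    have := κt (subset_tsupport _ ht)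
    rw [mem_closedBall_iff_norm] at this
    rw [mem_ball_iff_norm]
    have e : t - 0 = (t - -(δ • c₀)) - δ • c₀ := by abel
    rw [e]
    calc ‖t - -(δ • c₀) - δ • c₀‖ ≤ ‖t - -(δ • c₀)‖ + ‖δ • c₀‖ := norm_sub_le _ _
      _ ≤ δ * r + δ * ‖c₀‖ := by rw [norm_smul, Real.norm_of_nonneg hδ.le]; linarith
      _ < η := by linarith
  have memκ : ∀ x t, x - t ∈ tsupport κ → t ∈ Metric.closedBall (x + δ • c₀) (δ * r) := by
    intro x t ht
    have := κt ht
    rw [mem_closedBall_iff_norm] at this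
    rw [mem_closedBall_iff_norm, ← norm_neg]
    rwa [show -(t - (x + δ • c₀)) = x - t - -(δ • c₀) by abel]
  have wloc : LocallyIntegrable w := mw.locallyIntegrable one_le_two
  let u : Eucl k → ℝ := convolution w κ (ContinuousLinearMap.mul ℝ ℝ) volume
  have u_eq : ∀ x, u x = ∫ t, κ (x - t) • w t := fun x => by
    simp [u, convolution_def, mul_comm]
  have us : ContDiff ℝ ∞ u := κc.contDiff_convolution_right _ wloc κs
  have wc : HasCompactSupport w := by
    refine HasCompactSupport.intro hφc fun x hx => ?_
    rw [hw, indicator_apply]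
    split_ifs
    · rw [image_eq_zero_of_notMem_tsupport hx, zero_mul]
    · rfl
  have uc : HasCompactSupport u := wc.convolution _ κc
  have ugrad : ∀ x ∈ V, gradient u x = ∫ t, κ (x - t) • H t := by
    intro x hx
    refine gradient_convolution_of_hasWeakGradient hV (h.smooth_mul hV hφ) wloc
      (mH.locallyIntegrable one_le_two) κs κc ?_
    -- If the sampled ball misses the support of `φ`, the localized function and its gradient vanish
    -- on it and no cone condition is needed.
    by_cases hne : (Metric.closedBall (x + δ • c₀) (δ * r) ∩ tsupport φ).Nonempty
    · exact Or.inl fun t ht => hcone x hx hne (memκ x t ht)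
    · refine Or.inr fun t ht => ?_
      have htφ : t ∉ tsupport φ := fun h' => hne ⟨t, memκ x t ht, h'⟩
      simp [image_eq_zero_of_notMem_tsupport htφ, gradient_eq_zero_of_notMem_tsupport htφ]
  refine ⟨u, us, uc, ?_, ?_⟩
  · refine le_trans ?_ (eLpNorm_mollify_sub_le mw κs.continuous κc κ0 κ1
      fun t ht => (hηball t (κε t ht)).1)
    refine le_trans (le_of_eq (eLpNorm_congr_ae ?_)) (eLpNorm_restrict_le _ _ _ V)
    filter_upwards [ae_restrict_mem hV.measurableSet] with x hx
    rw [u_eq, hw, indicator_of_mem hx]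
  · refine le_trans ?_ (eLpNorm_mollify_sub_le mH κs.continuous κc κ0 κ1
      fun t ht => (hηball t (κε t ht)).2)
    refine le_trans (le_of_eq (eLpNorm_congr_ae ?_)) (eLpNorm_restrict_le _ _ _ V)
    filter_upwards [ae_restrict_mem hV.measurableSet] with x hx
    rw [ugrad x hx, hH, indicator_of_mem hx]

/-- A cutoff with compact support in `V` has positive distance to the complement, so the cone
condition holds with zero shift: ordinary centred mollification. -/
lemma exists_smooth_approx_of_tsupport_subset {k : ℕ} {V : Set (Eucl k)} (hV : IsOpen V)
    {v : Eucl k → ℝ} {G : Eucl k → Eucl k} (h : HasWeakGradient V v G)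
    (mv : MemLp v 2 (volume.restrict V)) (mG : MemLp G 2 (volume.restrict V))
    {φ : Eucl k → ℝ} (hφ : ContDiff ℝ ∞ φ) (hφc : HasCompactSupport φ) (hφV : tsupport φ ⊆ V)
    {ε : ℝ≥0∞} (hε : 0 < ε) :
    ∃ u : Eucl k → ℝ, ContDiff ℝ ∞ u ∧ HasCompactSupport u ∧
      eLpNorm (fun x => u x - φ x * v x) 2 (volume.restrict V) ≤ ε ∧
      eLpNorm (fun x => gradient u x - (φ x • G x + v x • gradient φ x)) 2
        (volume.restrict V) ≤ ε := by
  refine exists_smooth_approx_of_cone hV h mv mG hφ hφc 0 one_pos ?_ hε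
  obtain ⟨η, hη, hηV⟩ := hφc.exists_cthickening_subset_open hV hφV
  have : ∀ᶠ δ in 𝓝[>] (0 : ℝ), δ < η / 2 :=
    (eventually_lt_nhds (half_pos hη)).filter_mono nhdsWithin_le_nhds
  filter_upwards [this] with δ hδ x _ ⟨y, hy, hyφ⟩ z hz
  rw [smul_zero, add_zero, mul_one] at hy hz
  refine hηV (Metric.mem_cthickening_of_dist_le z y η _ hyφ ?_)
  have h1 := Metric.mem_closedBall.1 hy
  have h2 := Metric.mem_closedBall.1 hz
  have := dist_triangle_right z y x
  linarith

lemma eLpNorm_smul_le_of_ae_bound {α F : Type*} [MeasurableSpace α] {μ : Measure α}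
    [NormedAddCommGroup F] [NormedSpace ℝ F] {g : α → ℝ} {c : ℝ} (hg : ∀ᵐ x ∂μ, ‖g x‖ ≤ c)
    (f : α → F) : eLpNorm (fun x => g x • f x) 2 μ ≤ ENNReal.ofReal c * eLpNorm f 2 μ :=
  eLpNorm_le_mul_eLpNorm_of_ae_le_mul (by
    filter_upwards [hg] with x hx
    rw [norm_smul]
    exact mul_le_mul_of_nonneg_right hx (norm_nonneg _)) 2

lemma eLpNorm_smul_le_of_ae_bound' {α F : Type*} [MeasurableSpace α] {μ : Measure α}
    [NormedAddCommGroup F] [NormedSpace ℝ F] {g : α → F} {c : ℝ} (hg : ∀ᵐ x ∂μ, ‖g x‖ ≤ c)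
    (f : α → ℝ) : eLpNorm (fun x => f x • g x) 2 μ ≤ ENNReal.ofReal c * eLpNorm f 2 μ :=
  eLpNorm_le_mul_eLpNorm_of_ae_le_mul (by
    filter_upwards [hg] with x hx
    rw [norm_smul, mul_comm]
    exact mul_le_mul_of_nonneg_right hx (norm_nonneg _)) 2

lemma exists_ae_norm_le_of_memLp_top {α F : Type*} [MeasurableSpace α] {μ : Measure α}
    [NormedAddCommGroup F] {g : α → F} (hg : MemLp g ⊤ μ) : ∃ c, 0 ≤ c ∧ ∀ᵐ x ∂μ, ‖g x‖ ≤ c := by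
  refine ⟨(eLpNormEssSup g μ).toReal, ENNReal.toReal_nonneg, ?_⟩
  have h2 : eLpNormEssSup g μ ≠ ⊤ := by
    have := hg.eLpNorm_lt_top
    rw [eLpNorm_exponent_top] at this
    exact this.ne
  filter_upwards [ae_le_eLpNormEssSup (f := g) (μ := μ)] with x hx
  rw [← toReal_enorm]
  exact ENNReal.toReal_mono h2 hx

lemma memLp_two_smul {α F : Type*} [MeasurableSpace α] {μ : Measure α}
    [NormedAddCommGroup F] [NormedSpace ℝ F] {g : α → ℝ} {f : α → F} (hg : MemLp g ⊤ μ)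
    (hf : MemLp f 2 μ) : MemLp (fun x => g x • f x) 2 μ := hf.smul hg

lemma memLp_two_smul' {α F : Type*} [MeasurableSpace α] {μ : Measure α}
    [NormedAddCommGroup F] [NormedSpace ℝ F] {g : α → ℝ} {f : α → F} (hg : MemLp g 2 μ)
    (hf : MemLp f ⊤ μ) : MemLp (fun x => g x • f x) 2 μ := hf.smul hg

lemma memLp_contDiff {k : ℕ} {V : Set (Eucl k)} {u : Eucl k → ℝ} (hu : ContDiff ℝ ∞ u)
    (hc : HasCompactSupport u) (p : ℝ≥0∞) : MemLp u p (volume.restrict V) :=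
  (hu.continuous.memLp_of_hasCompactSupport hc).restrict V

lemma memLp_gradient {k : ℕ} {V : Set (Eucl k)} {u : Eucl k → ℝ} (hu : ContDiff ℝ ∞ u)
    (hc : HasCompactSupport u) (p : ℝ≥0∞) : MemLp (gradient u) p (volume.restrict V) :=
  ((continuous_gradient_of_contDiff hu).memLp_of_hasCompactSupport
    (hasCompactSupport_gradient hc)).restrict V

/-- The product of a function in `H¹` and a function in `W^{1,∞}`. -/
lemma HasWeakGradient.mul {k : ℕ} {V : Set (Eucl k)} (hV : IsOpen V)
    {v g : Eucl k → ℝ} {G H : Eucl k → Eucl k} (h : HasWeakGradient V v G)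
    (h' : HasWeakGradient V g H)
    (mv : MemLp v 2 (volume.restrict V)) (mG : MemLp G 2 (volume.restrict V))
    (mg : MemLp g ⊤ (volume.restrict V)) (mH : MemLp H ⊤ (volume.restrict V)) :
    HasWeakGradient V (fun x => v x * g x) (fun x => g x • G x + v x • H x) := by
  have mp1 : MemLp (fun x => v x * g x) 2 (volume.restrict V) := memLp_two_smul' mv mg
  have mp2 : MemLp (fun x => g x • G x + v x • H x) 2 (volume.restrict V) :=
    (memLp_two_smul mg mG).add (memLp_two_smul' mv mH)
  refine HasWeakGradient.of_forall_smooth_mul hV (locallyIntegrableOn_of_memLp one_le_two mp1)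
    (locallyIntegrableOn_of_memLp one_le_two mp2) fun φ hφ hφc hφV => ?_
  -- Locally `v` is an `H¹` limit of test functions `u j`. For `u j * g` the product rule is the
  -- smooth one with the roles of the factors exchanged, and essential boundedness of `g` and `H`
  -- carries it to the limit.
  have hex := fun j : ℕ => exists_smooth_approx_of_tsupport_subset hV h mv mG hφ hφc hφV
    (ε := ((j : ℝ≥0∞) + 1)⁻¹) (by simp)
  choose u us uc u1 u2 using hex
  have t0 : Tendsto (fun j : ℕ => ((j : ℝ≥0∞) + 1)⁻¹) atTop (𝓝 0) := by
    have := (ENNReal.tendsto_inv_nat_nhds_zero).comp (tendsto_add_atTop_nat 1)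
    simpa [Function.comp_def] using this
  obtain ⟨cg, cg0, hcg⟩ := exists_ae_norm_le_of_memLp_top mg
  obtain ⟨cH, cH0, hcH⟩ := exists_ae_norm_le_of_memLp_top mH
  have mφv : MemLp (fun x => φ x * v x) 2 (volume.restrict V) :=
    memLp_smul_of_hasCompactSupport hφ.continuous hφc mv
  have mφG : MemLp (fun x => φ x • G x + v x • gradient φ x) 2 (volume.restrict V) :=
    (memLp_smul_of_hasCompactSupport hφ.continuous hφc mG).add (memLp_smul_gradient hφ hφc mv)
  refine HasWeakGradient.of_tendsto (fun j => h'.smooth_mul hV (us j))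
    (fun j => memLp_two_smul' (memLp_contDiff (us j) (uc j) 2) mg)
    (fun j => (memLp_two_smul' (memLp_contDiff (us j) (uc j) 2) mH).add
      (memLp_two_smul mg (memLp_gradient (us j) (uc j) 2)))
    (memLp_smul_of_hasCompactSupport hφ.continuous hφc mp1)
    ((memLp_smul_of_hasCompactSupport hφ.continuous hφc mp2).add
      (memLp_smul_gradient hφ hφc mp1)) ?_ ?_
  · refine tendsto_zero_of_le_const_mul t0 (c := ENNReal.ofReal cg) ENNReal.ofReal_ne_top
      fun j => ?_
    refine le_trans (le_of_eq ?_) ((eLpNorm_smul_le_of_ae_bound hcg _).trans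
      (mul_le_mul_right (u1 j) _))
    congr with x
    simp only [smul_eq_mul]
    ring
  · refine tendsto_zero_of_le_const_mul t0 (c := ENNReal.ofReal cH + ENNReal.ofReal cg)
      (by simp) fun j => ?_
    have m1 : MemLp (fun x => (u j x - φ x * v x) • H x) 2 (volume.restrict V) :=
      memLp_two_smul' ((memLp_contDiff (us j) (uc j) 2).sub mφv) mH
    have m2 : MemLp (fun x => g x • (gradient (u j) x - (φ x • G x + v x • gradient φ x))) 2
        (volume.restrict V) :=
      memLp_two_smul mg ((memLp_gradient (us j) (uc j) 2).sub mφG)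
    rw [add_mul]
    refine le_trans (le_of_eq ?_) ((eLpNorm_add_le m1.aestronglyMeasurable
      m2.aestronglyMeasurable one_le_two).trans (add_le_add
        ((eLpNorm_smul_le_of_ae_bound' hcH _).trans (mul_le_mul_right (u1 j) _))
        ((eLpNorm_smul_le_of_ae_bound hcg _).trans (mul_le_mul_right (u2 j) _))))
    congr with x : 1
    simp only [Pi.add_apply]
    module

/-! ### Density of test functions in `H¹` of a Lipschitz domain -/

lemma tendsto_eLpNorm_two_of_dominated {α F : Type*} [MeasurableSpace α] {μ : Measure α}
    [NormedAddCommGroup F] {f : ℕ → α → F} {g : α → ℝ} (hf : ∀ j, AEStronglyMeasurable (f j) μ)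
    (hg : MemLp g 2 μ) (hle : ∀ j x, ‖f j x‖ ≤ ‖g x‖) (h0 : ∀ x, ∀ᶠ j in atTop, f j x = 0) :
    Tendsto (fun j => eLpNorm (f j) 2 μ) atTop (𝓝 0) := by
  have key : Tendsto (fun j => ∫⁻ x, ‖f j x‖ₑ ^ 2 ∂μ) atTop (𝓝 (∫⁻ _, 0 ∂μ)) := by
    refine tendsto_lintegral_of_dominated_convergence' (fun x => ‖g x‖ₑ ^ 2)
      (fun j => (hf j).enorm.pow_const 2) (fun j => Eventually.of_forall fun x => ?_) ?_
      (Eventually.of_forall fun x => ?_)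
    · have : ‖f j x‖ₑ ≤ ‖g x‖ₑ := enorm_le_iff_norm_le.2 (hle j x)
      exact pow_le_pow_left' this 2
    · rw [← eLpNorm_two_sq]
      exact ENNReal.pow_ne_top hg.eLpNorm_lt_top.ne
    · refine Tendsto.congr' (f₁ := fun _ => 0) ?_ tendsto_const_nhds
      filter_upwards [h0 x] with j hj
      simp [hj]
  simp only [lintegral_zero, ← eLpNorm_two_sq] at key
  have := (ENNReal.continuous_rpow_const (y := (1 / 2 : ℝ))).tendsto 0 |>.comp key
  simp only [Function.comp_def, ← ENNReal.rpow_two, ← ENNReal.rpow_mul] at this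
  simpa using this

/-- A sequence of smooth cutoffs exhausting the space, with bounded gradients. -/
lemma exists_cutoff_sequence (k : ℕ) : ∃ (χ : ℕ → Eucl k → ℝ) (c : ℝ),
    (∀ n, ContDiff ℝ ∞ (χ n)) ∧ (∀ n, HasCompactSupport (χ n)) ∧
    (∀ n x, ‖χ n x‖ ≤ 1) ∧ (∀ n x, ‖gradient (χ n) x‖ ≤ c) ∧
    (∀ x, ∀ᶠ n in atTop, χ n x = 1) ∧ ∀ x, ∀ᶠ n in atTop, gradient (χ n) x = 0 := by
  let b : ContDiffBump (0 : Eucl k) :=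
    { rIn := 1, rOut := 2, rIn_pos := one_pos, rIn_lt_rOut := one_lt_two }
  have bs : ContDiff ℝ ∞ b := b.contDiff
  have bc : HasCompactSupport b := b.hasCompactSupport
  obtain ⟨c, hc⟩ := (bs.continuous_fderiv (by simp)).bounded_above_of_compact_support
    (bc.fderiv ℝ)
  let s : ℕ → ℝ := fun n => ((n : ℝ) + 1)⁻¹
  have s0 : ∀ n, 0 < s n := fun n => by positivity
  have s1 : ∀ n, s n ≤ 1 := fun n => inv_le_one_of_one_le₀ (by
    have : (0 : ℝ) ≤ n := Nat.cast_nonneg n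
    linarith)
  have hsmall : ∀ x : Eucl k, ∀ᶠ n in atTop, ‖s n • x‖ < 1 := by
    intro x
    have : Tendsto (fun n : ℕ => ‖s n • x‖) atTop (𝓝 0) := by
      have h1 : Tendsto s atTop (𝓝 0) := by
        simpa [s, one_div] using tendsto_one_div_add_atTop_nhds_zero_nat (𝕜 := ℝ)
      have := (h1.smul_const x).norm
      simpa using this
    exact this.eventually_lt_const one_pos
  have hd : ∀ n x, fderiv ℝ (fun x => b (s n • x)) x = s n • fderiv ℝ b (s n • x) := by
    intro n x
    have h1 : HasFDerivAt b (fderiv ℝ b (s n • x)) (s n • x) :=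
      (bs.differentiable (by simp) _).hasFDerivAt
    have h2 := h1.comp x ((hasFDerivAt_id x).const_smul (s n))
    have h3 := h2.fderiv
    ext ξ
    have h4 := congrArg (fun L => L ξ) h3
    simpa [Function.comp_def] using h4
  have hnear : ∀ y : Eucl k, ‖y‖ < 1 → b =ᶠ[𝓝 y] fun _ => 1 := by
    intro y hy
    filter_upwards [Metric.isOpen_ball.mem_nhds (mem_ball_zero_iff.2 hy)] with z hz
    exact b.one_of_mem_closedBall (Metric.ball_subset_closedBall hz)
  refine ⟨fun n x => b (s n • x), c, fun n => bs.comp (by fun_prop), fun n => ?_, fun n x => ?_,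
    fun n x => ?_, fun x => ?_, fun x => ?_⟩
  · exact bc.comp_smul (s0 n).ne'
  · rw [Real.norm_of_nonneg b.nonneg]
    exact b.le_one
  · rw [gradient, LinearIsometryEquiv.norm_map, hd, norm_smul, Real.norm_of_nonneg (s0 n).le]
    calc s n * ‖fderiv ℝ b (s n • x)‖ ≤ 1 * ‖fderiv ℝ b (s n • x)‖ :=
          mul_le_mul_of_nonneg_right (s1 n) (norm_nonneg _)
      _ ≤ c := by rw [one_mul]; exact hc _
  · filter_upwards [hsmall x] with n hn
    exact (hnear _ hn).eq_of_nhds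
  · filter_upwards [hsmall x] with n hn
    rw [gradient, hd, (hnear _ hn).fderiv_eq]
    simp

/-- Let `x` lie above the graph, move it up by `δ` and then by `ζ` with `‖ζ‖ ≤ δ r`. The height
gains at least `δ - δ r` while the graph rises by at most `K δ r`. Since `r (1 + K) = 1/2`, a gain
of at least `δ / 2` remains. Compactness of `S` keeps all points concerned in `W`, where the graph
describes `O`. -/
lemma IsGraphChart.eventually_cone {m : ℕ} {O W : Set (Eucl (m + 1))} {e : Frame m}
    {γ : Eucl m → ℝ} (h : IsGraphChart O W e γ) {S : Set (Eucl (m + 1))} (hS : IsCompact S)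
    (hSW : S ⊆ W) : ∃ r : ℝ, 0 < r ∧ ∀ᶠ δ in 𝓝[>] (0 : ℝ), ∀ x ∈ O,
      (Metric.closedBall (x + δ • e.symm (WithLp.toLp 2 (0, 1))) (δ * r) ∩ S).Nonempty →
        Metric.closedBall (x + δ • e.symm (WithLp.toLp 2 (0, 1))) (δ * r) ⊆ O := by
  obtain ⟨hW, ⟨K, hK⟩, hchart⟩ := h
  set c₀ : Eucl (m + 1) := e.symm (WithLp.toLp 2 (0, 1)) with hc₀
  have ec : e c₀ = WithLp.toLp 2 (0, 1) := by simp [hc₀]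
  obtain ⟨η, hη, hηW⟩ := hS.exists_cthickening_subset_open hW hSW
  set r : ℝ := (2 * (1 + K))⁻¹ with hr
  have K0 : (0 : ℝ) ≤ K := K.2
  have r0 : 0 < r := by positivity
  have rK : r * (1 + K) = 1 / 2 := by rw [hr]; field_simp
  refine ⟨r, r0, ?_⟩
  have : ∀ᶠ δ in 𝓝[>] (0 : ℝ), δ * (2 * r + ‖c₀‖) < η := by
    have : Tendsto (fun δ : ℝ => δ * (2 * r + ‖c₀‖)) (𝓝 0) (𝓝 (0 * (2 * r + ‖c₀‖))) :=
      (continuous_id.mul continuous_const).tendsto 0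
    rw [zero_mul] at this
    exact (this.eventually_lt_const hη).filter_mono nhdsWithin_le_nhds
  filter_upwards [this, self_mem_nhdsWithin] with δ hδ hδ0 x hx ⟨y, hy, hyS⟩ z hz
  replace hδ0 : 0 < δ := hδ0
  have h1 := Metric.mem_closedBall.1 hy
  have h2 := Metric.mem_closedBall.1 hz
  have hδc : dist x (x + δ • c₀) = δ * ‖c₀‖ := by
    rw [dist_self_add_right, norm_smul, Real.norm_of_nonneg hδ0.le]
  have c0n : 0 ≤ δ * ‖c₀‖ := by positivity
  have hxW : x ∈ W := hηW (Metric.mem_cthickening_of_dist_le x y η _ hyS (by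
    have := dist_triangle_right x y (x + δ • c₀)
    nlinarith [mul_pos hδ0 r0]))
  have hzW : z ∈ W := hηW (Metric.mem_cthickening_of_dist_le z y η _ hyS (by
    have := dist_triangle_right z y (x + δ • c₀)
    nlinarith))
  have hxO := (hchart x hxW).1 hx
  refine (hchart z hzW).2 ?_
  set ζ : Eucl (m + 1) := z - (x + δ • c₀) with hζ
  have hζn : ‖ζ‖ ≤ δ * r := by rw [hζ, ← dist_eq_norm]; exact h2
  have ez : e z = e x + δ • e c₀ + e ζ := by
    rw [← map_smul, ← map_add, ← map_add, hζ]; congr 1; abel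
  have f1 : (e z).fst = (e x).fst + (e ζ).fst := by rw [ez, ec]; simp
  have f2 : (e z).snd = (e x).snd + δ + (e ζ).snd := by rw [ez, ec]; simp
  have n1 : ‖(e ζ).fst‖ ≤ δ * r := (WithLp.norm_fst_le _ _).trans (by rwa [e.norm_map])
  have n2 : ‖(e ζ).snd‖ ≤ δ * r := (WithLp.norm_snd_le _ _).trans (by rwa [e.norm_map])
  have lip : γ (e z).fst - γ (e x).fst ≤ K * (δ * r) := by
    have := hK.dist_le_mul (e z).fst (e x).fst
    rw [f1, dist_self_add_left, Real.dist_eq] at this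
    rw [f1]
    exact (le_abs_self _).trans (this.trans (mul_le_mul_of_nonneg_left n1 K0))
  have n3 := (abs_le.1 (Real.norm_eq_abs (e ζ).snd ▸ n2)).1
  have e4 : δ * r * (1 + K) = δ / 2 := by rw [mul_assoc, rK]; ring
  nlinarith

lemma gradient_finset_sum {k : ℕ} {ι : Type*} (s : Finset ι) {u : ι → Eucl k → ℝ}
    (hu : ∀ i ∈ s, ContDiff ℝ ∞ (u i)) (x : Eucl k) :
    gradient (fun x => ∑ i ∈ s, u i x) x = ∑ i ∈ s, gradient (u i) x := by
  simp only [gradient]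
  rw [fderiv_fun_sum fun i hi => (hu i hi).differentiable (by simp) x, map_sum]

/-- Restrictions of test functions are dense in `H¹` of a Lipschitz domain. -/
lemma IsLipschitzDomain.exists_smooth_approx {m : ℕ} {O : Set (Eucl (m + 1))}
    (hO : IsLipschitzDomain O) {v : Eucl (m + 1) → ℝ} {G : Eucl (m + 1) → Eucl (m + 1)}
    (h : HasWeakGradient O v G) (mv : MemLp v 2 (volume.restrict O))
    (mG : MemLp G 2 (volume.restrict O)) {ε : ℝ≥0∞} (hε : 0 < ε) :
    ∃ u : Eucl (m + 1) → ℝ, ContDiff ℝ ∞ u ∧ HasCompactSupport u ∧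
      eLpNorm (fun x => u x - v x) 2 (volume.restrict O) ≤ ε ∧
      eLpNorm (fun x => gradient u x - G x) 2 (volume.restrict O) ≤ ε := by
  obtain ⟨hopen, N, W, e, γ, ρ, hρ, hchart, hcov⟩ := hO
  -- cut off at infinity
  obtain ⟨χ, c, χs, χc, χ1, χg, χlim, χglim⟩ := exists_cutoff_sequence (m + 1)
  have t1 : Tendsto (fun n => eLpNorm (fun x => χ n x * v x - v x) 2 (volume.restrict O))
      atTop (𝓝 0) := by
    refine tendsto_eLpNorm_two_of_dominated (g := fun x => 2 * v x)
      (fun n => ((χs n).continuous.aestronglyMeasurable.mul mv.aestronglyMeasurable).sub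
        mv.aestronglyMeasurable) (mv.const_mul 2) (fun n x => ?_) (fun x => ?_)
    · rw [norm_mul, Real.norm_ofNat]
      refine (norm_sub_le _ _).trans ?_
      rw [norm_mul]
      nlinarith [χ1 n x, norm_nonneg (v x)]
    · filter_upwards [χlim x] with n hn
      rw [hn]; ring
  have t2 : Tendsto (fun n => eLpNorm (fun x => (χ n x • G x + v x • gradient (χ n) x) - G x) 2
      (volume.restrict O)) atTop (𝓝 0) := by
    refine tendsto_eLpNorm_two_of_dominated (g := fun x => 2 * ‖G x‖ + |c| * ‖v x‖)
      (fun n => (((χs n).continuous.aestronglyMeasurable.smul mG.aestronglyMeasurable).add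
        (mv.aestronglyMeasurable.smul
          (continuous_gradient_of_contDiff (χs n)).aestronglyMeasurable)).sub
        mG.aestronglyMeasurable) ((mG.norm.const_mul 2).add (mv.norm.const_mul |c|))
      (fun n x => ?_) (fun x => ?_)
    · rw [Real.norm_of_nonneg (by positivity)]
      refine (norm_sub_le _ _).trans ?_
      have := norm_add_le (χ n x • G x) (v x • gradient (χ n) x)
      rw [norm_smul, norm_smul] at this
      have hc := (χg n x).trans (le_abs_self c)
      nlinarith [χ1 n x, norm_nonneg (G x), norm_nonneg (v x)]
    · filter_upwards [χlim x, χglim x] with n hn hn'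
      rw [hn, hn']; simp
  have hε2 : 0 < ε / 2 := ENNReal.half_pos hε.ne'
  obtain ⟨n, hn1, hn2⟩ :=
    ((t1.eventually_le_const hε2).and (t2.eventually_le_const hε2)).exists
  -- localize
  let U : Option (Fin N) → Set (Eucl (m + 1)) := fun i => i.elim O W
  have hU : ∀ i, IsOpen (U i) := fun i => by
    cases i with
    | none => exact hopen
    | some i => exact (hchart i).1
  have hUcov : closure O ⊆ ⋃ i, U i := by
    intro x hx
    by_cases hxO : x ∈ O
    · exact mem_iUnion.2 ⟨none, hxO⟩
    · have hxf : x ∈ frontier O := ⟨hx, fun hxi => hxO (interior_subset hxi)⟩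
      obtain ⟨i, hi⟩ := hcov x hxf
      exact mem_iUnion.2 ⟨some i, hi (Metric.mem_ball_self hρ)⟩
  obtain ⟨f, hf⟩ := SmoothPartitionOfUnity.exists_isSubordinate
    (modelWithCornersSelf ℝ (Eucl (m + 1))) (isClosed_closure (s := O)) U hU hUcov
  -- The index `none` stands for the interior piece `O`. The charts may be unbounded; the factor `χ
  -- n` is what makes the supports compact.
  let φ : Option (Fin N) → Eucl (m + 1) → ℝ := fun i x => f i x * χ n x
  have φs : ∀ i, ContDiff ℝ ∞ (φ i) := fun i => ((f i).contMDiff.contDiff).mul (χs n)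
  have φc : ∀ i, HasCompactSupport (φ i) := fun i => (χc n).mul_left
  have φU : ∀ i, tsupport (φ i) ⊆ U i := fun i => tsupport_mul_subset_left.trans (hf i)
  have fsum : ∀ x ∈ O, ∑ i, φ i x = χ n x := fun x hx => by
    have := f.sum_eq_one (subset_closure hx)
    rw [finsum_eq_sum_of_fintype] at this
    simp only [φ, ← Finset.sum_mul, this, one_mul]
  have gsum : ∀ x ∈ O, ∑ i, gradient (φ i) x = gradient (χ n) x := fun x hx => by
    rw [← gradient_finset_sum _ fun i _ => φs i]
    have : (fun x => ∑ i, φ i x) =ᶠ[𝓝 x] χ n := by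
      filter_upwards [hopen.mem_nhds hx] with y hy using fsum y hy
    rw [gradient, gradient, this.fderiv_eq]
  -- Half of the tolerance pays for the cutoff at infinity, the rest is shared by the `N` charts and
  -- the interior piece.
  set ε' : ℝ≥0∞ := ε / 2 / (N + 1 : ℕ) with hε'
  have ε'0 : 0 < ε' := ENNReal.div_pos hε2.ne' (ENNReal.natCast_ne_top _)
  have hloc : ∀ i, ∃ u : Eucl (m + 1) → ℝ, ContDiff ℝ ∞ u ∧ HasCompactSupport u ∧
      eLpNorm (fun x => u x - φ i x * v x) 2 (volume.restrict O) ≤ ε' ∧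
      eLpNorm (fun x => gradient u x - (φ i x • G x + v x • gradient (φ i) x)) 2
        (volume.restrict O) ≤ ε' := by
    intro i
    cases i with
    | none =>
      exact exists_smooth_approx_of_tsupport_subset hopen h mv mG (φs _) (φc _) (φU none) ε'0
    | some i =>
      obtain ⟨r, hr, hcone⟩ := (hchart i).eventually_cone (φc (some i)) (φU (some i))
      exact exists_smooth_approx_of_cone hopen h mv mG (φs _) (φc _) _ hr hcone ε'0
  choose u us uc u1 u2 using hloc
  have hsumε : ∑ _i : Option (Fin N), ε' = ε / 2 := by
    rw [Finset.sum_const, Finset.card_univ, Fintype.card_option, Fintype.card_fin, nsmul_eq_mul,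
      hε']
    exact ENNReal.mul_div_cancel (by simp) (ENNReal.natCast_ne_top _)
  have mφv : ∀ i, MemLp (fun x => φ i x * v x) 2 (volume.restrict O) := fun i =>
    memLp_smul_of_hasCompactSupport (φs i).continuous (φc i) mv
  have mφG : ∀ i, MemLp (fun x => φ i x • G x + v x • gradient (φ i) x) 2 (volume.restrict O) :=
    fun i => (memLp_smul_of_hasCompactSupport (φs i).continuous (φc i) mG).add
      (memLp_smul_gradient (φs i) (φc i) mv)
  refine ⟨fun x => ∑ i, u i x, ContDiff.sum fun i _ => us i, ?_, ?_, ?_⟩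
  · exact HasCompactSupport.intro (isCompact_iUnion fun i => uc i) fun x hx =>
      Finset.sum_eq_zero fun i _ => image_eq_zero_of_notMem_tsupport fun hi =>
        hx (mem_iUnion.2 ⟨i, hi⟩)
  · have m1 : ∀ i ∈ Finset.univ, AEStronglyMeasurable (fun x => u i x - φ i x * v x)
        (volume.restrict O) :=
      fun i _ => ((memLp_contDiff (us i) (uc i) 2).sub (mφv i)).aestronglyMeasurable
    have m2 : AEStronglyMeasurable (fun x => χ n x * v x - v x) (volume.restrict O) :=
      ((χs n).continuous.aestronglyMeasurable.mul mv.aestronglyMeasurable).sub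
        mv.aestronglyMeasurable
    have b1 := (eLpNorm_sum_le m1 one_le_two).trans (Finset.sum_le_sum fun i _ => u1 i)
    rw [hsumε] at b1
    have b2 := (eLpNorm_add_le (Finset.aestronglyMeasurable_sum _ m1) m2 one_le_two).trans
      (add_le_add b1 hn1)
    rw [ENNReal.add_halves] at b2
    refine le_trans (le_of_eq (eLpNorm_congr_ae ?_)) b2
    filter_upwards [ae_restrict_mem hopen.measurableSet] with x hx
    simp only [Pi.add_apply, Finset.sum_apply, Finset.sum_sub_distrib, ← Finset.sum_mul,
      fsum x hx]
    ring
  · have m1 : ∀ i ∈ Finset.univ, AEStronglyMeasurable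
        (fun x => gradient (u i) x - (φ i x • G x + v x • gradient (φ i) x))
        (volume.restrict O) :=
      fun i _ => ((memLp_gradient (us i) (uc i) 2).sub (mφG i)).aestronglyMeasurable
    have m2 : AEStronglyMeasurable (fun x => (χ n x • G x + v x • gradient (χ n) x) - G x)
        (volume.restrict O) :=
      (((χs n).continuous.aestronglyMeasurable.smul mG.aestronglyMeasurable).add
        (mv.aestronglyMeasurable.smul
          (continuous_gradient_of_contDiff (χs n)).aestronglyMeasurable)).sub
        mG.aestronglyMeasurable
    have b1 := (eLpNorm_sum_le m1 one_le_two).trans (Finset.sum_le_sum fun i _ => u2 i)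
    rw [hsumε] at b1
    have b2 := (eLpNorm_add_le (Finset.aestronglyMeasurable_sum _ m1) m2 one_le_two).trans
      (add_le_add b1 hn2)
    rw [ENNReal.add_halves] at b2
    refine le_trans (le_of_eq (eLpNorm_congr_ae ?_)) b2
    filter_upwards [ae_restrict_mem hopen.measurableSet] with x hx
    rw [gradient_finset_sum _ fun i _ => us i]
    simp only [Pi.add_apply, Finset.sum_apply, Finset.sum_sub_distrib, Finset.sum_add_distrib,
      ← Finset.sum_smul, ← Finset.smul_sum, fsum x hx, gsum x hx]
    abel

/-! ### Graph charts and the surface measure -/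

lemma LipschitzWith.euclideanHausdorffMeasure_image_le {X Y : Type*} [EMetricSpace X]
    [EMetricSpace Y] [MeasurableSpace X] [BorelSpace X] [MeasurableSpace Y] [BorelSpace Y]
    {K : ℝ≥0} {f : X → Y} (h : LipschitzWith K f) (d : ℕ) (s : Set X) :
    (Measure.euclideanHausdorffMeasure d : Measure Y) (f '' s)
      ≤ (K : ℝ≥0∞) ^ d * (Measure.euclideanHausdorffMeasure d : Measure X) s := by
  rw [Measure.euclideanHausdorffMeasure_def, Measure.euclideanHausdorffMeasure_def]
  have := h.hausdorffMeasure_image_le (d := d) (Nat.cast_nonneg d) s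
  rw [ENNReal.rpow_natCast] at this
  rw [Measure.smul_apply, Measure.smul_apply, ENNReal.smul_def, ENNReal.smul_def, smul_eq_mul,
    smul_eq_mul, mul_left_comm]
  gcongr

lemma graphPoint_coord {m : ℕ} (e : Frame m) (γ : Eucl m → ℝ) (y : Eucl m) :
    e (graphPoint e γ y) = WithLp.toLp 2 (y, γ y) := by
  simp [graphPoint]

lemma graphPoint_fst {m : ℕ} (e : Frame m) (γ : Eucl m → ℝ) (y : Eucl m) :
    (e (graphPoint e γ y)).fst = y := by
  rw [graphPoint_coord]; rfl

lemma graphPoint_snd {m : ℕ} (e : Frame m) (γ : Eucl m → ℝ) (y : Eucl m) :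
    (e (graphPoint e γ y)).snd = γ y := by
  rw [graphPoint_coord]; rfl

lemma lipschitzWith_frame_fst {m : ℕ} (e : Frame m) : LipschitzWith 1 fun x => (e x).fst :=
  LipschitzWith.of_dist_le_mul fun x y => by
    rw [NNReal.coe_one, one_mul, dist_eq_norm, ← WithLp.sub_fst, ← map_sub, dist_eq_norm,
      ← e.norm_map (x - y)]
    exact WithLp.norm_fst_le _ _

lemma norm_toLp_le {m : ℕ} (a : Eucl m) (b : ℝ) :
    ‖(WithLp.toLp 2 (a, b) : WithLp 2 (Eucl m × ℝ))‖ ≤ ‖a‖ + ‖b‖ := by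
  rw [WithLp.prod_norm_eq_of_L2]
  refine Real.sqrt_le_iff.2 ⟨by positivity, ?_⟩
  simp only [WithLp.toLp_fst, WithLp.toLp_snd]
  nlinarith [norm_nonneg a, norm_nonneg b]

lemma lipschitzWith_graphPoint {m : ℕ} (e : Frame m) {γ : Eucl m → ℝ} {K : ℝ≥0}
    (h : LipschitzWith K γ) : LipschitzWith (1 + K) (graphPoint e γ) :=
  LipschitzWith.of_dist_le_mul fun x y => by
    have h1 := h.dist_le_mul x y
    have e1 : graphPoint e γ x - graphPoint e γ y
        = e.symm (WithLp.toLp 2 (x - y, γ x - γ y)) := by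
      rw [graphPoint, graphPoint, ← map_sub]; rfl
    rw [dist_eq_norm, e1, e.symm.norm_map]
    refine (norm_toLp_le _ _).trans ?_
    rw [← dist_eq_norm, ← dist_eq_norm]
    push_cast
    linarith

lemma measurableEmbedding_graphPoint {m : ℕ} (e : Frame m) {γ : Eucl m → ℝ} {K : ℝ≥0}
    (h : LipschitzWith K γ) : MeasurableEmbedding (graphPoint e γ) := by
  have hl : Function.LeftInverse (fun x => (e x).fst) (graphPoint e γ) := graphPoint_fst e γ
  exact (hl.isClosedEmbedding (lipschitzWith_frame_fst e).continuous
    (lipschitzWith_graphPoint e h).continuous).measurableEmbedding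

/-- Strict inequality in either direction is an open condition, hence places the point in the
interior of `O` or of its complement. A point on the graph is not in `O`, but is a limit of the
points vertically above it, which are. -/
lemma IsGraphChart.mem_frontier_iff {m : ℕ} {O W : Set (Eucl (m + 1))} {e : Frame m}
    {γ : Eucl m → ℝ} (h : IsGraphChart O W e γ) {x : Eucl (m + 1)} (hx : x ∈ W) :
    x ∈ frontier O ↔ γ (e x).fst = (e x).snd := by
  obtain ⟨hW, ⟨K, hK⟩, hchart⟩ := h
  have c1 : Continuous fun x : Eucl (m + 1) => γ (e x).fst :=
    hK.continuous.comp (lipschitzWith_frame_fst e).continuous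
  have c2 : Continuous fun x : Eucl (m + 1) => (e x).snd := by fun_prop
  constructor
  · intro hf
    rcases lt_trichotomy (γ (e x).fst) (e x).snd with hlt | heq | hgt
    · exfalso
      refine hf.2 (mem_interior_iff_mem_nhds.2 ?_)
      filter_upwards [hW.mem_nhds hx, (isOpen_lt c1 c2).mem_nhds hlt] with z hz hz'
      exact (hchart z hz).2 hz'
    · exact heq
    · exfalso
      have := mem_closure_iff_nhds.1 hf.1 _
        (inter_mem (hW.mem_nhds hx) ((isOpen_lt c2 c1).mem_nhds hgt))
      obtain ⟨z, ⟨hz, hz'⟩, hzO⟩ := this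
      exact lt_asymm hz' ((hchart z hz).1 hzO)
  · intro heq
    refine ⟨?_, fun hi => (lt_irrefl _ (heq ▸ (hchart x hx).1 (interior_subset hi)))⟩
    set c₀ : Eucl (m + 1) := e.symm (WithLp.toLp 2 (0, 1)) with hc₀
    have ec : e c₀ = WithLp.toLp 2 (0, 1) := by simp [hc₀]
    have ht : Tendsto (fun δ : ℝ => x + δ • c₀) (𝓝[>] 0) (𝓝 x) := by
      have : Continuous fun δ : ℝ => x + δ • c₀ := by fun_prop
      have := this.tendsto 0
      rw [zero_smul, add_zero] at this
      exact this.mono_left nhdsWithin_le_nhds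
    refine mem_closure_of_tendsto ht ?_
    filter_upwards [ht (hW.mem_nhds hx), self_mem_nhdsWithin] with δ hδ hδ0
    refine (hchart _ hδ).2 ?_
    rw [map_add, map_smul, ec]
    simpa [heq] using hδ0

lemma IsGraphChart.graphPoint_eq {m : ℕ} {O W : Set (Eucl (m + 1))} {e : Frame m}
    {γ : Eucl m → ℝ} (h : IsGraphChart O W e γ) {x : Eucl (m + 1)} (hx : x ∈ W)
    (hf : x ∈ frontier O) : graphPoint e γ (e x).fst = x := by
  rw [graphPoint, (h.mem_frontier_iff hx).1 hf]
  exact e.symm_apply_apply x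

lemma IsGraphChart.graphPoint_mem_frontier {m : ℕ} {O W : Set (Eucl (m + 1))} {e : Frame m}
    {γ : Eucl m → ℝ} (h : IsGraphChart O W e γ) {y : Eucl m} (hy : graphPoint e γ y ∈ W) :
    graphPoint e γ y ∈ frontier O := by
  rw [h.mem_frontier_iff hy, graphPoint_fst, graphPoint_snd]

/-- Lebesgue measure on the parameter domain is dominated by the surface measure. -/
lemma IsGraphChart.map_volume_le {m : ℕ} {O W : Set (Eucl (m + 1))} {e : Frame m}
    {γ : Eucl m → ℝ} (h : IsGraphChart O W e γ) :
    (volume.restrict (graphPoint e γ ⁻¹' W)).map (graphPoint e γ) ≤ surfaceMeasure O := by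
  obtain ⟨K, hK⟩ := h.2.1
  have hX := measurableEmbedding_graphPoint e hK
  refine Measure.le_iff.2 fun B hB => ?_
  rw [Measure.map_apply hX.measurable hB, Measure.restrict_apply (hX.measurable hB),
    surfaceMeasure, Measure.restrict_apply hB, ← EuclideanSpace.euclideanHausdorffMeasure_eq_volume]
  set A := graphPoint e γ ⁻¹' B ∩ graphPoint e γ ⁻¹' W with hA
  -- The vertical projection inverts the parametrization and is 1-Lipschitz, so it does not increase
  -- Hausdorff measure.
  have e1 : (fun x => (e x).fst) '' (graphPoint e γ '' A) = A := by
    rw [image_image]; simp only [graphPoint_fst, image_id']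
  have := (lipschitzWith_frame_fst e).euclideanHausdorffMeasure_image_le m (graphPoint e γ '' A)
  rw [e1, ENNReal.coe_one, one_pow, one_mul] at this
  refine this.trans (measure_mono ?_)
  rintro _ ⟨y, hy, rfl⟩
  exact ⟨hy.1, h.graphPoint_mem_frontier hy.2⟩

/-- In a chart, the surface measure is dominated by Lebesgue measure on the parameter domain. -/
lemma IsGraphChart.restrict_le_map {m : ℕ} {O W : Set (Eucl (m + 1))} {e : Frame m}
    {γ : Eucl m → ℝ} (h : IsGraphChart O W e γ) : ∃ c : ℝ≥0, (surfaceMeasure O).restrict W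
      ≤ c • (volume.restrict (graphPoint e γ ⁻¹' W)).map (graphPoint e γ) := by
  obtain ⟨K, hK⟩ := h.2.1
  have hX := measurableEmbedding_graphPoint e hK
  -- The parametrization is `(1 + K)`-Lipschitz and the measure has dimension `m`.
  refine ⟨(1 + K) ^ m, Measure.le_iff.2 fun B hB => ?_⟩
  rw [Measure.smul_apply, Measure.map_apply hX.measurable hB,
    Measure.restrict_apply (hX.measurable hB), Measure.restrict_apply hB, surfaceMeasure,
    Measure.restrict_apply (hB.inter h.1.measurableSet),
    ← EuclideanSpace.euclideanHausdorffMeasure_eq_volume, ENNReal.smul_def, smul_eq_mul,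
    ENNReal.coe_pow]
  refine le_trans (measure_mono ?_)
    ((lipschitzWith_graphPoint e hK).euclideanHausdorffMeasure_image_le m _)
  rintro x ⟨⟨hxB, hxW⟩, hxf⟩
  have := h.graphPoint_eq hxW hxf
  exact ⟨(e x).fst, ⟨by rw [mem_preimage, this]; exact hxB, by rw [mem_preimage, this]; exact hxW⟩,
    this⟩

/-- Only null sets and `L^p` bounds are carried between `Γ` and the parameter domain, so the two
one-sided comparisons of measures take the place of the area formula. -/
lemma IsGraphChart.ae_comp {m : ℕ} {O W : Set (Eucl (m + 1))} {e : Frame m}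
    {γ : Eucl m → ℝ} (h : IsGraphChart O W e γ) {P : Eucl (m + 1) → Prop}
    (hP : ∀ᵐ x ∂(surfaceMeasure O), P x) :
    ∀ᵐ y ∂(volume.restrict (graphPoint e γ ⁻¹' W)), P (graphPoint e γ y) := by
  obtain ⟨K, hK⟩ := h.2.1
  have hX := measurableEmbedding_graphPoint e hK
  exact hX.ae_map_iff.1 (hP.filter_mono (ae_mono h.map_volume_le))

lemma IsGraphChart.ae_of_comp {m : ℕ} {O W : Set (Eucl (m + 1))} {e : Frame m}
    {γ : Eucl m → ℝ} (h : IsGraphChart O W e γ) {P : Eucl (m + 1) → Prop}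
    (hP : ∀ᵐ y ∂(volume.restrict (graphPoint e γ ⁻¹' W)), P (graphPoint e γ y)) :
    ∀ᵐ x ∂((surfaceMeasure O).restrict W), P x := by
  obtain ⟨K, hK⟩ := h.2.1
  have hX := measurableEmbedding_graphPoint e hK
  obtain ⟨c, hc⟩ := h.restrict_le_map
  have h1 : ∀ᵐ x ∂((volume.restrict (graphPoint e γ ⁻¹' W)).map (graphPoint e γ)), P x :=
    hX.ae_map_iff.2 hP
  have h2 : (surfaceMeasure O).restrict W ≪
      (volume.restrict (graphPoint e γ ⁻¹' W)).map (graphPoint e γ) :=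
    (Measure.absolutelyContinuous_of_le hc).trans Measure.smul_absolutelyContinuous
  exact h2.ae_le h1

lemma IsGraphChart.memLp_comp {m : ℕ} {O W : Set (Eucl (m + 1))} {e : Frame m}
    {γ : Eucl m → ℝ} (h : IsGraphChart O W e γ) {F : Type*} [NormedAddCommGroup F]
    {f : Eucl (m + 1) → F} {p : ℝ≥0∞} (hf : MemLp f p (surfaceMeasure O)) :
    MemLp (fun y => f (graphPoint e γ y)) p (volume.restrict (graphPoint e γ ⁻¹' W)) := by
  obtain ⟨K, hK⟩ := h.2.1
  have hX := measurableEmbedding_graphPoint e hK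
  exact hX.memLp_map_measure_iff.1 (hf.mono_measure h.map_volume_le)

lemma IsGraphChart.eLpNorm_comp_le {m : ℕ} {O W : Set (Eucl (m + 1))} {e : Frame m}
    {γ : Eucl m → ℝ} (h : IsGraphChart O W e γ) {F : Type*} [NormedAddCommGroup F]
    (f : Eucl (m + 1) → F) (p : ℝ≥0∞) :
    eLpNorm (fun y => f (graphPoint e γ y)) p (volume.restrict (graphPoint e γ ⁻¹' W))
      ≤ eLpNorm f p (surfaceMeasure O) := by
  obtain ⟨K, hK⟩ := h.2.1
  have hX := measurableEmbedding_graphPoint e hK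
  refine le_trans (le_of_eq ?_) (eLpNorm_mono_measure f h.map_volume_le)
  exact (hX.eLpNorm_map_measure).symm

lemma IsGraphChart.isOpen_preimage {m : ℕ} {O W : Set (Eucl (m + 1))} {e : Frame m}
    {γ : Eucl m → ℝ} (h : IsGraphChart O W e γ) : IsOpen (graphPoint e γ ⁻¹' W) := by
  obtain ⟨K, hK⟩ := h.2.1
  exact h.1.preimage (lipschitzWith_graphPoint e hK).continuous

lemma IsLipschitzDomain.exists_charts {m : ℕ} {O : Set (Eucl (m + 1))}
    (hO : IsLipschitzDomain O) : ∃ (k : ℕ) (W : Fin k → Set (Eucl (m + 1))) (e : Fin k → Frame m)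
    (γ : Fin k → Eucl m → ℝ), (∀ i, IsGraphChart O (W i) (e i) (γ i)) ∧
      (surfaceMeasure O).restrict (⋃ i, W i) = surfaceMeasure O := by
  obtain ⟨-, k, W, e, γ, ε, hε, hchart, hcov⟩ := hO
  refine ⟨k, W, e, γ, hchart, ?_⟩
  have hsub : frontier O ⊆ ⋃ i, W i := fun x hx => by
    obtain ⟨i, hi⟩ := hcov x hx
    exact mem_iUnion.2 ⟨i, hi (Metric.mem_ball_self hε)⟩
  rw [surfaceMeasure, Measure.restrict_restrict (MeasurableSet.iUnion fun i =>
    (hchart i).1.measurableSet), inter_eq_self_of_subset_right hsub]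

/-- A property holds a.e. on the boundary if it holds a.e. in every chart. -/
lemma IsLipschitzDomain.ae_of_charts {m : ℕ} {O : Set (Eucl (m + 1))}
    (hO : IsLipschitzDomain O) {P : Eucl (m + 1) → Prop}
    (h : ∀ (W : Set (Eucl (m + 1))) (e : Frame m) (γ : Eucl m → ℝ), IsGraphChart O W e γ →
      ∀ᵐ y ∂(volume.restrict (graphPoint e γ ⁻¹' W)), P (graphPoint e γ y)) :
    ∀ᵐ x ∂(surfaceMeasure O), P x := by
  obtain ⟨k, W, e, γ, hchart, hres⟩ := hO.exists_charts
  rw [← hres, ae_restrict_iUnion_iff]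
  exact fun i => (hchart i).ae_of_comp (h _ _ _ (hchart i))

/-! ### The exterior normal -/

/-- Along `d = n' - n` one has `⟨d, n⟩ < 0 < ⟨d, n'⟩`, both of modulus `1 - ⟨n, n'⟩`. Hence for
small `s > 0` the point `x + s d` is in `O` according to `n` and outside according to `n'`. The cone
opening `ε` is chosen so that `ε ‖d‖` is half of this modulus. -/
lemma IsOuterNormal.unique {k : ℕ} {O : Set (Eucl k)} {x n n' : Eucl k}
    (h : IsOuterNormal O x n) (h' : IsOuterNormal O x n') : n = n' := by
  by_contra hne
  set d := n' - n with hd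
  have hd0 : 0 < ‖d‖ := norm_pos_iff.2 (sub_ne_zero.2 (Ne.symm hne))
  have hlt : inner ℝ n n' < 1 := by
    refine lt_of_le_of_ne ?_ fun he => hne ((inner_eq_one_iff_of_norm_eq_one h.1 h'.1).1 he)
    have := real_inner_le_norm n n'
    rwa [h.1, h'.1, one_mul] at this
  have hn : inner ℝ d n = inner ℝ n n' - 1 := by
    rw [hd, inner_sub_left, real_inner_self_eq_norm_sq, h.1, real_inner_comm]; norm_num
  have hn' : inner ℝ d n' = 1 - inner ℝ n n' := by
    rw [hd, inner_sub_left, real_inner_self_eq_norm_sq, h'.1]; norm_num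
  set ε := (1 - inner ℝ n n') / (2 * ‖d‖) with hε
  have hε0 : 0 < ε := div_pos (by linarith) (by linarith)
  have hεd : ε * ‖d‖ = (1 - inner ℝ n n') / 2 := by rw [hε]; field_simp
  have ht : Tendsto (fun s : ℝ => x + s • d) (𝓝[>] 0) (𝓝 x) := by
    have : Continuous fun s : ℝ => x + s • d := by fun_prop
    have := this.tendsto 0
    rw [zero_smul, add_zero] at this
    exact this.mono_left nhdsWithin_le_nhds
  obtain ⟨s, ⟨h1, h2⟩, hs⟩ := (((ht.eventually (h.2 ε hε0)).and
    (ht.eventually (h'.2 ε hε0))).and self_mem_nhdsWithin).exists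
  replace hs : 0 < s := hs
  rw [add_sub_cancel_left, norm_smul, Real.norm_of_nonneg hs.le, inner_smul_left] at h1 h2
  simp only [conj_trivial] at h1 h2
  refine h2.2 ?_ (h1.1 ?_)
  · rw [hn']; nlinarith
  · rw [hn]; nlinarith

lemma outerNormal_eq {k : ℕ} {O : Set (Eucl k)} {x n : Eucl k} (h : IsOuterNormal O x n) :
    outerNormal O x = n := by
  have hex : ∃ n, IsOuterNormal O x n := ⟨n, h⟩
  rw [outerNormal, dif_pos hex]
  exact hex.choose_spec.unique h

lemma norm_outerNormal_le {k : ℕ} (O : Set (Eucl k)) (x : Eucl k) : ‖outerNormal O x‖ ≤ 1 := by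
  rw [outerNormal]
  split_ifs with h
  · exact h.choose_spec.1.le
  · simp

/-- The unit normal pointing below the graph of `γ`. -/
noncomputable def graphNormal {m : ℕ} (e : Frame m) (γ : Eucl m → ℝ) (y : Eucl m) : Eucl (m + 1) :=
  (Real.sqrt (1 + ‖gradient γ y‖ ^ 2))⁻¹ • e.symm (WithLp.toLp 2 (gradient γ y, -1))

lemma inner_graphNormal {m : ℕ} (e : Frame m) (γ : Eucl m → ℝ) (y : Eucl m)
    (z : Eucl (m + 1)) : inner ℝ z (graphNormal e γ y) =
      (Real.sqrt (1 + ‖gradient γ y‖ ^ 2))⁻¹ * (inner ℝ (e z).fst (gradient γ y) - (e z).snd) := by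
  have : inner ℝ z (e.symm (WithLp.toLp 2 (gradient γ y, -1)))
      = inner ℝ (e z) (WithLp.toLp 2 (gradient γ y, (-1 : ℝ))) := by
    rw [← e.inner_map_map, e.apply_symm_apply]
  rw [graphNormal, inner_smul_right, this, WithLp.prod_inner_apply]
  congr 1
  simp [sub_eq_add_neg]

/-- In the chart, membership in `O` is decided by the sign of graph height minus height of `z`. This
difference equals `ρ ⟨z - x, n⟩` plus the linearization error of `γ`, with `ρ = √(1 + |∇γ|²)`. Near
`y` the error is at most `ε ρ ‖z - x‖`, so it cannot change the sign outside the thin cone. -/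
lemma IsGraphChart.isOuterNormal {m : ℕ} {O W : Set (Eucl (m + 1))} {e : Frame m}
    {γ : Eucl m → ℝ} (h : IsGraphChart O W e γ) {y : Eucl m} (hy : graphPoint e γ y ∈ W)
    (hd : DifferentiableAt ℝ γ y) :
    IsOuterNormal O (graphPoint e γ y) (graphNormal e γ y) := by
  obtain ⟨hW, -, hchart⟩ := h
  set ρ := Real.sqrt (1 + ‖gradient γ y‖ ^ 2) with hρ
  have ρ0 : 0 < ρ := Real.sqrt_pos.2 (by positivity)
  constructor
  · rw [graphNormal, norm_smul, e.symm.norm_map, WithLp.prod_norm_eq_of_L2]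
    simp only [WithLp.toLp_fst, WithLp.toLp_snd, norm_neg, norm_one, one_pow]
    rw [add_comm (‖gradient γ y‖ ^ 2), ← hρ, Real.norm_of_nonneg (inv_nonneg.2 ρ0.le),
      inv_mul_cancel₀ ρ0.ne']
  · intro ε hε
    have hlo := hd.hasGradientAt.hasFDerivAt.isLittleO.def (mul_pos hε ρ0)
    have ht : Tendsto (fun z : Eucl (m + 1) => (e z).fst) (𝓝 (graphPoint e γ y)) (𝓝 y) := by
      have := (lipschitzWith_frame_fst e).continuous.tendsto (graphPoint e γ y)
      rwa [graphPoint_fst] at this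
    filter_upwards [hW.mem_nhds hy, ht.eventually hlo] with z hz hzγ
    have c1 : (e (z - graphPoint e γ y)).fst = (e z).fst - y := by
      rw [map_sub, WithLp.sub_fst, graphPoint_fst]
    have c2 : (e (z - graphPoint e γ y)).snd = (e z).snd - γ y := by
      rw [map_sub, WithLp.sub_snd, graphPoint_snd]
    have n1 : ‖(e z).fst - y‖ ≤ ‖z - graphPoint e γ y‖ := by
      rw [← c1, ← e.norm_map (z - graphPoint e γ y)]
      exact WithLp.norm_fst_le _ _
    rw [InnerProductSpace.toDual_apply_apply, Real.norm_eq_abs, abs_le, real_inner_comm] at hzγ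
    rw [inner_graphNormal, c1, c2, ← hρ]
    have n2 : ε * ρ * ‖(e z).fst - y‖ ≤ ε * ρ * ‖z - graphPoint e γ y‖ :=
      mul_le_mul_of_nonneg_left n1 (by positivity)
    have hmul : ∀ a : ℝ, ρ * (ρ⁻¹ * a) = a := fun a => by field_simp
    constructor
    · intro hlt
      have := mul_lt_mul_of_pos_left hlt ρ0
      rw [hmul] at this
      refine (hchart z hz).2 ?_
      linarith [hzγ.2]
    · intro hlt hzO
      have := mul_lt_mul_of_pos_left hlt ρ0
      rw [hmul] at this
      have := (hchart z hz).1 hzO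
      linarith [hzγ.1]

/-- Rademacher's theorem for the Lipschitz function `γ`. -/
lemma IsGraphChart.ae_differentiableAt {m : ℕ} {O W : Set (Eucl (m + 1))} {e : Frame m}
    {γ : Eucl m → ℝ} (h : IsGraphChart O W e γ) :
    ∀ᵐ y ∂(volume.restrict (graphPoint e γ ⁻¹' W)), graphPoint e γ y ∈ W ∧
      DifferentiableAt ℝ γ y := by
  obtain ⟨K, hK⟩ := h.2.1
  exact (ae_restrict_mem h.isOpen_preimage.measurableSet).and
    (ae_restrict_of_ae hK.ae_differentiableAt)

lemma IsGraphChart.ae_outerNormal_eq {m : ℕ} {O W : Set (Eucl (m + 1))} {e : Frame m}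
    {γ : Eucl m → ℝ} (h : IsGraphChart O W e γ) :
    ∀ᵐ y ∂(volume.restrict (graphPoint e γ ⁻¹' W)),
      outerNormal O (graphPoint e γ y) = graphNormal e γ y := by
  filter_upwards [h.ae_differentiableAt] with y hy
  exact outerNormal_eq (h.isOuterNormal hy.1 hy.2)

lemma measurable_graphNormal {m : ℕ} (e : Frame m) (γ : Eucl m → ℝ) :
    Measurable (graphNormal e γ) := by
  have hg : Measurable (gradient γ) :=
    (InnerProductSpace.toDual ℝ (Eucl m)).symm.continuous.measurable.comp (measurable_fderiv ℝ γ)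
  have h1 : Measurable fun y => e.symm (WithLp.toLp 2 (gradient γ y, (-1 : ℝ))) := by
    have hc : Continuous fun a : Eucl m => e.symm (WithLp.toLp 2 (a, (-1 : ℝ))) := by fun_prop
    exact hc.measurable.comp hg
  exact ((hg.norm.pow_const 2).const_add 1).sqrt.inv.smul h1

/-- A pointwise choice carries no measurability; it comes from the explicit formula `graphNormal`,
valid almost everywhere in each of the finitely many charts. -/
lemma IsLipschitzDomain.aestronglyMeasurable_outerNormal {m : ℕ} {O : Set (Eucl (m + 1))}
    (hO : IsLipschitzDomain O) : AEStronglyMeasurable (outerNormal O) (surfaceMeasure O) := by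
  obtain ⟨k, W, e, γ, hchart, hres⟩ := hO.exists_charts
  rw [← hres, aestronglyMeasurable_iUnion_iff]
  intro i
  have hm : Measurable fun x => graphNormal (e i) (γ i) ((e i) x).fst :=
    (measurable_graphNormal _ _).comp (lipschitzWith_frame_fst (e i)).continuous.measurable
  refine hm.aestronglyMeasurable.congr ?_
  have := (hchart i).ae_of_comp (P := fun x =>
    graphNormal (e i) (γ i) ((e i) x).fst = outerNormal O x) (by
      filter_upwards [(hchart i).ae_outerNormal_eq] with y hy
      rw [hy, graphPoint_fst])
  exact this

/-! ### The trace inequality and traces -/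

/-- The fundamental theorem of calculus for `(1 - s/ε) h(s)²`, which equals `h(0)²` at `0` and
vanishes at `ε`, followed by `2 |h h'| ≤ h² + h'²`. -/
lemma enorm_sq_le_lintegral {h h' : ℝ → ℝ} (hd : ∀ s, HasDerivAt h (h' s) s)
    (hc : Continuous h') {ε : ℝ} (hε : 0 < ε) :
    ‖h 0‖ₑ ^ 2 ≤ ENNReal.ofReal (ε⁻¹ + 1)
      * ∫⁻ s in Ioc 0 ε, (‖h s‖ₑ ^ 2 + ‖h' s‖ₑ ^ 2) := by
  have ch : Continuous h := continuous_iff_continuousAt.2 fun s => (hd s).continuousAt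
  have der : ∀ s, HasDerivAt (fun s => (1 - ε⁻¹ * s) * h s ^ 2)
      (-(ε⁻¹ * h s ^ 2 - (1 - ε⁻¹ * s) * (2 * h s * h' s))) s := by
    intro s
    have d1 : HasDerivAt (fun s : ℝ => 1 - ε⁻¹ * s) (-ε⁻¹) s := by
      simpa using ((hasDerivAt_id s).const_mul ε⁻¹).const_sub 1
    refine (d1.mul ((hd s).pow 2)).congr_deriv ?_
    push_cast
    simp only [Pi.pow_apply]
    ring
  have ci : Continuous fun s => ε⁻¹ * h s ^ 2 - (1 - ε⁻¹ * s) * (2 * h s * h' s) := by fun_prop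
  have ftc := intervalIntegral.integral_eq_sub_of_hasDerivAt (a := 0) (b := ε)
    (fun s _ => der s) (ci.neg.intervalIntegrable _ _)
  rw [intervalIntegral.integral_neg, inv_mul_cancel₀ hε.ne'] at ftc
  have e0 : h 0 ^ 2 = ∫ s in (0)..ε, (ε⁻¹ * h s ^ 2 - (1 - ε⁻¹ * s) * (2 * h s * h' s)) := by
    linarith
  have c2 : Continuous fun s => (ε⁻¹ + 1) * (h s ^ 2 + h' s ^ 2) := by fun_prop
  have hle : h 0 ^ 2 ≤ ∫ s in (0)..ε, (ε⁻¹ + 1) * (h s ^ 2 + h' s ^ 2) := by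
    rw [e0]
    refine intervalIntegral.integral_mono_on hε.le (ci.intervalIntegrable _ _)
      (c2.intervalIntegrable _ _) fun s hs => ?_
    have q1 : 0 ≤ ε⁻¹ * s := mul_nonneg (inv_nonneg.2 hε.le) hs.1
    have q2 : ε⁻¹ * s ≤ 1 := by
      rw [← inv_mul_cancel₀ hε.ne']
      exact mul_le_mul_of_nonneg_left hs.2 (inv_nonneg.2 hε.le)
    have q3 : -(2 * h s * h' s) ≤ h s ^ 2 + h' s ^ 2 := by nlinarith [sq_nonneg (h s + h' s)]
    have q4 : (1 - ε⁻¹ * s) * -(2 * h s * h' s) ≤ 1 * (h s ^ 2 + h' s ^ 2) := by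
      refine (mul_le_mul_of_nonneg_left q3 (by linarith)).trans
        (mul_le_mul_of_nonneg_right (by linarith) (by positivity))
    have q5 : 0 ≤ ε⁻¹ * h' s ^ 2 := by positivity
    linarith
  rw [intervalIntegral.integral_of_le hε.le] at hle
  have hi : IntegrableOn (fun s => (ε⁻¹ + 1) * (h s ^ 2 + h' s ^ 2)) (Ioc 0 ε) :=
    c2.integrableOn_Ioc
  have hpos : 0 ≤ ε⁻¹ + 1 := by positivity
  calc ‖h 0‖ₑ ^ 2 = ENNReal.ofReal (h 0 ^ 2) := by
        rw [← ofReal_norm, ← ENNReal.ofReal_pow (norm_nonneg _), Real.norm_eq_abs, sq_abs]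
    _ ≤ ENNReal.ofReal (∫ s in Ioc 0 ε, (ε⁻¹ + 1) * (h s ^ 2 + h' s ^ 2)) :=
        ENNReal.ofReal_le_ofReal hle
    _ = ∫⁻ s in Ioc 0 ε, ENNReal.ofReal ((ε⁻¹ + 1) * (h s ^ 2 + h' s ^ 2)) :=
        ofReal_integral_eq_lintegral_ofReal hi
          (Eventually.of_forall fun s => mul_nonneg hpos (by positivity))
    _ = ∫⁻ s in Ioc 0 ε, ENNReal.ofReal (ε⁻¹ + 1) * (‖h s‖ₑ ^ 2 + ‖h' s‖ₑ ^ 2) := by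
        congr with s
        rw [ENNReal.ofReal_mul hpos, ENNReal.ofReal_add (sq_nonneg _) (sq_nonneg _),
          ← sq_abs (h s), ← sq_abs (h' s), ENNReal.ofReal_pow (abs_nonneg _),
          ENNReal.ofReal_pow (abs_nonneg _), ← Real.norm_eq_abs, ← Real.norm_eq_abs, ofReal_norm,
          ofReal_norm]
    _ = _ := lintegral_const_mul' _ _ ENNReal.ofReal_ne_top

lemma lintegral_frame {m : ℕ} (e : Frame m) {F : Eucl (m + 1) → ℝ≥0∞} (hF : Measurable F) :
    ∫⁻ x, F x = ∫⁻ y : Eucl m, ∫⁻ s : ℝ, F (e.symm (WithLp.toLp 2 (y, s))) := by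
  have h1 := (e.symm.measurePreserving).lintegral_comp hF
  have h2 := (WithLp.volume_preserving_toLp (Eucl m) ℝ).lintegral_comp
    (hF.comp e.symm.continuous.measurable)
  have hm : Measurable fun p : Eucl m × ℝ => F (e.symm (WithLp.toLp 2 p)) :=
    (hF.comp e.symm.continuous.measurable).comp
      (WithLp.volume_preserving_toLp (Eucl m) ℝ).measurable
  rw [← h1, ← (lintegral_prod _ hm.aemeasurable)]
  exact h2.symm

lemma enorm_gradient {k : ℕ} (u : Eucl k → ℝ) (x : Eucl k) :
    ‖gradient u x‖ₑ = ‖fderiv ℝ u x‖ₑ := by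
  rw [gradient, ← ofReal_norm, LinearIsometryEquiv.norm_map, ofReal_norm]

/-- Above a boundary point whose `ε`-ball lies in `W`, the vertical segment of length `ε / 2` stays
in `O`. The one-dimensional inequality on these segments, integrated over the parameter domain,
gives the claim by Fubini. Restricting to such points keeps the segment length fixed, so the
constant is uniform even in an unbounded chart. -/
lemma IsGraphChart.lintegral_trace_le {m : ℕ} {O W : Set (Eucl (m + 1))} {e : Frame m}
    {γ : Eucl m → ℝ} (h : IsGraphChart O W e γ) (hO : IsOpen O) {ε : ℝ} (hε : 0 < ε) :
    ∃ C : ℝ≥0, ∀ u : Eucl (m + 1) → ℝ, ContDiff ℝ ∞ u →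
      ∫⁻ x in {x | Metric.ball x ε ⊆ W}, ‖u x‖ₑ ^ 2 ∂(surfaceMeasure O)
        ≤ C * ∫⁻ x in O, (‖u x‖ₑ ^ 2 + ‖gradient u x‖ₑ ^ 2) := by
  obtain ⟨K, hK⟩ := h.2.1
  have hX := measurableEmbedding_graphPoint e hK
  obtain ⟨c, hc⟩ := h.restrict_le_map
  set A : Set (Eucl (m + 1)) := {x | Metric.ball x ε ⊆ W} with hA
  have hAcl : IsClosed A := by
    have : Aᶜ = ⋃ z ∈ Wᶜ, Metric.ball z ε := by
      ext x
      simp only [hA, mem_compl_iff, mem_ofPred_eq, not_subset, mem_iUnion, exists_prop]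
      constructor
      · rintro ⟨z, hz, hzW⟩
        exact ⟨z, hzW, Metric.mem_ball_comm.1 hz⟩
      · rintro ⟨z, hzW, hz⟩
        exact ⟨z, Metric.mem_ball_comm.1 hz, hzW⟩
    rw [← isOpen_compl_iff, this]
    exact isOpen_biUnion fun z _ => Metric.isOpen_ball
  have hAW : A ⊆ W := fun x hx => hx (Metric.mem_ball_self hε)
  refine ⟨c * Real.toNNReal ((ε / 2)⁻¹ + 1), fun u hu => ?_⟩
  set c₀ : Eucl (m + 1) := e.symm (WithLp.toLp 2 (0, 1)) with hc₀
  have nc₀ : ‖c₀‖ = 1 := by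
    rw [hc₀, e.symm.norm_map, WithLp.prod_norm_eq_of_L2]
    simp
  set E : Eucl (m + 1) → ℝ≥0∞ := fun x => ‖u x‖ₑ ^ 2 + ‖gradient u x‖ₑ ^ 2 with hE
  have mE : Measurable E :=
    (hu.continuous.measurable.enorm.pow_const 2).add
      ((continuous_gradient_of_contDiff hu).measurable.enorm.pow_const 2)
  have mE' : Measurable (O.indicator E) := mE.indicator hO.measurableSet
  have hshift : ∀ y (s : ℝ), graphPoint e γ y + s • c₀
      = e.symm (WithLp.toLp 2 (y, γ y + s)) := by
    intro y s
    rw [graphPoint, hc₀, ← map_smul, ← map_add]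
    congr 1
    exact WithLp.ofLp_injective 2 (Prod.ext (by simp) (by simp))
  have pt : ∀ y, graphPoint e γ y ∈ A → ‖u (graphPoint e γ y)‖ₑ ^ 2
      ≤ ENNReal.ofReal ((ε / 2)⁻¹ + 1) *
        ∫⁻ s, O.indicator E (e.symm (WithLp.toLp 2 (y, s))) := by
    intro y hy
    set x := graphPoint e γ y with hx
    have der : ∀ s : ℝ, HasDerivAt (fun s : ℝ => u (x + s • c₀))
        (fderiv ℝ u (x + s • c₀) c₀) s := by
      intro s
      have d1 : HasFDerivAt u (fderiv ℝ u (x + s • c₀)) (x + s • c₀) :=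
        (hu.differentiable (by simp) _).hasFDerivAt
      have d2 : HasDerivAt (fun s : ℝ => x + s • c₀) c₀ s := by
        simpa using ((hasDerivAt_id s).smul_const c₀).const_add x
      exact d1.comp_hasDerivAt s d2
    have cder : Continuous fun s : ℝ => fderiv ℝ u (x + s • c₀) c₀ :=
      (continuous_fderiv_apply_of_contDiff hu c₀).comp (by fun_prop)
    have b := enorm_sq_le_lintegral der cder (half_pos hε)
    rw [zero_smul, add_zero] at b
    refine b.trans (mul_le_mul_right ?_ _)
    have s1 : ∫⁻ s in Ioc 0 (ε / 2), (‖u (x + s • c₀)‖ₑ ^ 2 + ‖fderiv ℝ u (x + s • c₀) c₀‖ₑ ^ 2)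
        ≤ ∫⁻ s in Ioc 0 (ε / 2), O.indicator E (x + s • c₀) := by
      refine setLIntegral_mono_ae' measurableSet_Ioc (Eventually.of_forall fun s hs => ?_)
      have hW : x + s • c₀ ∈ W := by
        refine hy ?_
        rw [mem_ball_iff_norm, add_sub_cancel_left, norm_smul, nc₀, mul_one,
          Real.norm_of_nonneg hs.1.le]
        linarith [hs.2]
      have hmem : x + s • c₀ ∈ O := by
        refine (h.2.2 _ hW).2 ?_
        rw [hx, hshift, e.apply_symm_apply]
        simpa using hs.1
      rw [indicator_of_mem hmem]
      refine add_le_add_right (pow_le_pow_left' ?_ 2) _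
      rw [enorm_gradient]
      refine enorm_le_iff_norm_le.2 ?_ |>.trans (le_of_eq rfl)
      have := (fderiv ℝ u (x + s • c₀)).le_opNorm c₀
      rwa [nc₀, mul_one] at this
    refine s1.trans ((setLIntegral_le_lintegral _ _).trans (le_of_eq ?_))
    simp only [hx, hshift]
    -- The integral over a whole vertical line is invariant under the shift by the graph height.
    exact lintegral_add_left_eq_self
      (fun s => O.indicator E (e.symm (WithLp.toLp 2 (y, s)))) (γ y)
  have mF : Measurable fun x : Eucl (m + 1) => A.indicator (fun x => ‖u x‖ₑ ^ 2) x :=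
    (hu.continuous.measurable.enorm.pow_const 2).indicator hAcl.measurableSet
  calc ∫⁻ x in A, ‖u x‖ₑ ^ 2 ∂(surfaceMeasure O)
      = ∫⁻ x in A, ‖u x‖ₑ ^ 2 ∂((surfaceMeasure O).restrict W) := by
        rw [Measure.restrict_restrict hAcl.measurableSet, inter_eq_self_of_subset_left hAW]
    _ = ∫⁻ x, A.indicator (fun x => ‖u x‖ₑ ^ 2) x ∂((surfaceMeasure O).restrict W) :=
        (lintegral_indicator hAcl.measurableSet _).symm
    _ ≤ ∫⁻ x, A.indicator (fun x => ‖u x‖ₑ ^ 2) x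
          ∂(c • (volume.restrict (graphPoint e γ ⁻¹' W)).map (graphPoint e γ)) :=
        lintegral_mono' hc le_rfl
    _ = c * ∫⁻ y in graphPoint e γ ⁻¹' W,
          A.indicator (fun x => ‖u x‖ₑ ^ 2) (graphPoint e γ y) := by
        rw [lintegral_smul_measure, hX.lintegral_map]; rfl
    _ ≤ c * ∫⁻ y, A.indicator (fun x => ‖u x‖ₑ ^ 2) (graphPoint e γ y) := by
        gcongr
        exact Measure.restrict_le_self
    _ ≤ c * ∫⁻ y, ENNReal.ofReal ((ε / 2)⁻¹ + 1) *
          ∫⁻ s, O.indicator E (e.symm (WithLp.toLp 2 (y, s))) := by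
        gcongr with y
        by_cases hy : graphPoint e γ y ∈ A
        · rw [indicator_of_mem hy]; exact pt y hy
        · rw [indicator_of_notMem hy]; exact zero_le
    _ = _ := by
        rw [lintegral_const_mul' _ _ ENNReal.ofReal_ne_top, ← lintegral_frame e mE',
          lintegral_indicator hO.measurableSet, ← mul_assoc, ENNReal.coe_mul]
        rfl

/-- The trace inequality for smooth functions. -/
lemma IsLipschitzDomain.exists_trace_bound {m : ℕ} {O : Set (Eucl (m + 1))}
    (hO : IsLipschitzDomain O) : ∃ C : ℝ≥0, ∀ u : Eucl (m + 1) → ℝ, ContDiff ℝ ∞ u →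
      eLpNorm u 2 (surfaceMeasure O) ≤ C * (eLpNorm u 2 (volume.restrict O)
        + eLpNorm (gradient u) 2 (volume.restrict O)) := by
  obtain ⟨hopen, k, W, e, γ, ε, hε, hchart, hcov⟩ := hO
  choose C hC using fun i => (hchart i).lintegral_trace_le hopen hε
  -- The estimate is proved for squares; `S ≤ (1 + S)²` avoids taking the root of the sum of the
  -- constants.
  refine ⟨1 + ∑ i, C i, fun u hu => eLpNorm_two_le_of_sq ?_⟩
  set A : Fin k → Set (Eucl (m + 1)) := fun i => {x | Metric.ball x ε ⊆ W i} with hA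
  -- Here the positive Lebesgue number enters: every boundary point has its whole `ε`-ball in some
  -- chart.
  have hres : (surfaceMeasure O).restrict (⋃ i, A i) = surfaceMeasure O := by
    have hsub : frontier O ⊆ ⋃ i, A i := fun x hx => by
      obtain ⟨i, hi⟩ := hcov x hx
      exact mem_iUnion.2 ⟨i, hi⟩
    rw [surfaceMeasure, Measure.restrict_restrict' isClosed_frontier.measurableSet,
      inter_eq_self_of_subset_right hsub]
  set a := eLpNorm u 2 (volume.restrict O)
  set b := eLpNorm (gradient u) 2 (volume.restrict O)
  have hI : ∫⁻ x in O, (‖u x‖ₑ ^ 2 + ‖gradient u x‖ₑ ^ 2) = a ^ 2 + b ^ 2 := by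
    rw [lintegral_add_left (hu.continuous.measurable.enorm.pow_const 2), ← eLpNorm_two_sq,
      ← eLpNorm_two_sq]
  calc ∫⁻ x, ‖u x‖ₑ ^ 2 ∂(surfaceMeasure O)
      = ∫⁻ x in ⋃ i, A i, ‖u x‖ₑ ^ 2 ∂(surfaceMeasure O) := by rw [hres]
    _ ≤ ∑' i, ∫⁻ x in A i, ‖u x‖ₑ ^ 2 ∂(surfaceMeasure O) := lintegral_iUnion_le _ _
    _ ≤ ∑' i, C i * (a ^ 2 + b ^ 2) := ENNReal.tsum_le_tsum fun i => hI ▸ hC i u hu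
    _ = (∑ i, (C i : ℝ≥0∞)) * (a ^ 2 + b ^ 2) := by rw [tsum_fintype, Finset.sum_mul]
    _ ≤ (1 + ∑ i, (C i : ℝ≥0∞)) ^ 2 * (a + b) ^ 2 := by
        refine mul_le_mul' ?_ ?_
        · set S := ∑ i, (C i : ℝ≥0∞)
          calc S ≤ 1 + S := le_add_self
            _ = 1 * (1 + S) := (one_mul _).symm
            _ ≤ (1 + S) * (1 + S) := mul_le_mul' le_self_add le_rfl
            _ = (1 + S) ^ 2 := (sq _).symm
        · have : (a + b) ^ 2 = a ^ 2 + b ^ 2 + 2 * a * b := by ring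
          rw [this]; exact le_self_add
    _ = _ := by
        push_cast
        rw [mul_pow]

lemma IsLipschitzDomain.memLp_surface {m : ℕ} {O : Set (Eucl (m + 1))}
    (hO : IsLipschitzDomain O) {u : Eucl (m + 1) → ℝ} (hu : ContDiff ℝ ∞ u)
    (hc : HasCompactSupport u) : MemLp u 2 (surfaceMeasure O) := by
  obtain ⟨C, hC⟩ := hO.exists_trace_bound
  refine ⟨hu.continuous.aestronglyMeasurable, (hC u hu).trans_lt ?_⟩
  exact ENNReal.mul_lt_top ENNReal.coe_lt_top (ENNReal.add_lt_top.2
    ⟨(memLp_contDiff hu hc 2).eLpNorm_lt_top, (memLp_gradient hu hc 2).eLpNorm_lt_top⟩)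

lemma gradient_fun_sub {k : ℕ} {u w : Eucl k → ℝ} (hu : ContDiff ℝ ∞ u) (hw : ContDiff ℝ ∞ w)
    (x : Eucl k) : gradient (fun x => u x - w x) x = gradient u x - gradient w x := by
  simp only [gradient]
  rw [fderiv_fun_sub (hu.differentiable (by simp) x) (hw.differentiable (by simp) x), map_sub]

lemma eLpNorm_sub_le_add {α F : Type*} [MeasurableSpace α] {μ : Measure α}
    [NormedAddCommGroup F] {f g h : α → F} (hf : AEStronglyMeasurable f μ)
    (hg : AEStronglyMeasurable g μ) (hh : AEStronglyMeasurable h μ) :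
    eLpNorm (fun x => f x - g x) 2 μ
      ≤ eLpNorm (fun x => f x - h x) 2 μ + eLpNorm (fun x => g x - h x) 2 μ := by
  refine le_trans (le_of_eq ?_) (eLpNorm_sub_le (hf.sub hh) (hg.sub hh) one_le_two)
  congr with x : 1
  simp

/-- Two approximating sequences have the same `H¹` limit, so by the trace inequality the boundary
values of their difference tend to zero in `L²(Γ)`. -/
lemma IsTrace.ae_eq {m : ℕ} {O : Set (Eucl (m + 1))} (hO : IsLipschitzDomain O)
    {v τ τ' : Eucl (m + 1) → ℝ} (mv : AEStronglyMeasurable v (volume.restrict O))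
    (mG : AEStronglyMeasurable (weakGradient O v) (volume.restrict O))
    (h : IsTrace O v τ) (h' : IsTrace O v τ') :
    τ =ᵐ[surfaceMeasure O] τ' := by
  obtain ⟨C, hC⟩ := hO.exists_trace_bound
  obtain ⟨mτ, u, us, u1, u2, u3⟩ := h
  obtain ⟨mτ', w, ws, w1, w2, w3⟩ := h'
  have key : ∀ j, eLpNorm (fun x => τ x - τ' x) 2 (surfaceMeasure O) ≤
      (eLpNorm (fun x => u j x - τ x) 2 (surfaceMeasure O) +
      eLpNorm (fun x => w j x - τ' x) 2 (surfaceMeasure O)) +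
      C * ((eLpNorm (fun x => u j x - v x) 2 (volume.restrict O) +
        eLpNorm (fun x => w j x - v x) 2 (volume.restrict O)) +
        (eLpNorm (fun x => gradient (u j) x - weakGradient O v x) 2 (volume.restrict O) +
        eLpNorm (fun x => gradient (w j) x - weakGradient O v x) 2 (volume.restrict O))) := by
    intro j
    have su := hO.memLp_surface (us j).1 (us j).2
    have sw := hO.memLp_surface (ws j).1 (ws j).2
    have b := hC _ ((us j).1.sub (ws j).1)
    have g : gradient (fun x => u j x - w j x) = fun x => gradient (u j) x - gradient (w j) x :=
      funext fun x => gradient_fun_sub (us j).1 (ws j).1 x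
    rw [g] at b
    have b1 := eLpNorm_sub_le_add (us j).1.continuous.aestronglyMeasurable
      (ws j).1.continuous.aestronglyMeasurable mv
    have b2 := eLpNorm_sub_le_add (continuous_gradient_of_contDiff (us j).1).aestronglyMeasurable
      (continuous_gradient_of_contDiff (ws j).1).aestronglyMeasurable mG
    have t1 : eLpNorm (fun x => τ x - τ' x) 2 (surfaceMeasure O) ≤
        (eLpNorm (fun x => u j x - τ x) 2 (surfaceMeasure O) +
        eLpNorm (fun x => w j x - τ' x) 2 (surfaceMeasure O)) +
        eLpNorm (fun x => u j x - w j x) 2 (surfaceMeasure O) := by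
      have a1 := eLpNorm_sub_le (p := 2) (sw.sub mτ').aestronglyMeasurable
        (su.sub mτ).aestronglyMeasurable one_le_two
      have a2 := eLpNorm_add_le (p := 2) ((sw.sub mτ').sub (su.sub mτ)).aestronglyMeasurable
        (su.sub sw).aestronglyMeasurable one_le_two
      refine le_trans (le_of_eq ?_) (a2.trans (add_le_add (a1.trans (le_of_eq (add_comm _ _)))
        le_rfl))
      congr with x : 1
      simp only [Pi.add_apply, Pi.sub_apply]
      ring
    exact t1.trans (add_le_add le_rfl (b.trans (mul_le_mul_right (add_le_add b1 b2) _)))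
  have lim : Tendsto (fun j => (eLpNorm (fun x => u j x - τ x) 2 (surfaceMeasure O) +
      eLpNorm (fun x => w j x - τ' x) 2 (surfaceMeasure O)) +
      C * ((eLpNorm (fun x => u j x - v x) 2 (volume.restrict O) +
        eLpNorm (fun x => w j x - v x) 2 (volume.restrict O)) +
        (eLpNorm (fun x => gradient (u j) x - weakGradient O v x) 2 (volume.restrict O) +
        eLpNorm (fun x => gradient (w j) x - weakGradient O v x) 2 (volume.restrict O))))
      atTop (𝓝 0) := by
    have := (u3.add w3).add (ENNReal.Tendsto.const_mul (a := (C : ℝ≥0∞))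
      ((u1.add w1).add (u2.add w2)) (Or.inr ENNReal.coe_ne_top))
    simpa using this
  have h0 : eLpNorm (fun x => τ x - τ' x) 2 (surfaceMeasure O) = 0 :=
    le_antisymm (ge_of_tendsto' lim key) zero_le
  filter_upwards [(eLpNorm_eq_zero_iff (mτ.sub mτ').aestronglyMeasurable two_ne_zero).1 h0]
    with x hx
  exact sub_eq_zero.1 hx

lemma trace_ae_eq {m : ℕ} {O : Set (Eucl (m + 1))} (hO : IsLipschitzDomain O)
    {v τ : Eucl (m + 1) → ℝ} {G : Eucl (m + 1) → Eucl (m + 1)} (hG : HasWeakGradient O v G)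
    (mv : AEStronglyMeasurable v (volume.restrict O))
    (mG : AEStronglyMeasurable G (volume.restrict O)) (h : IsTrace O v τ) :
    trace O v =ᵐ[surfaceMeasure O] τ := by
  have hex : ∃ τ, IsTrace O v τ := ⟨τ, h⟩
  rw [trace, dif_pos hex]
  exact hex.choose_spec.ae_eq hO mv (mG.congr (weakGradient_ae_eq hO.1 hG).symm) h

/-- Every function in `H¹` of a Lipschitz domain has a trace. -/
lemma IsLipschitzDomain.exists_isTrace {m : ℕ} {O : Set (Eucl (m + 1))}
    (hO : IsLipschitzDomain O) {v : Eucl (m + 1) → ℝ} {G : Eucl (m + 1) → Eucl (m + 1)}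
    (h : HasWeakGradient O v G) (mv : MemLp v 2 (volume.restrict O))
    (mG : MemLp G 2 (volume.restrict O)) : ∃ τ, IsTrace O v τ := by
  obtain ⟨C, hC⟩ := hO.exists_trace_bound
  have hex := fun j : ℕ => hO.exists_smooth_approx h mv mG (ε := 2⁻¹ ^ j)
    (ENNReal.pow_pos (by simp) j)
  choose u us uc u1 u2 using hex
  have t0 : Tendsto (fun j : ℕ => (2⁻¹ : ℝ≥0∞) ^ j) atTop (𝓝 0) :=
    ENNReal.tendsto_pow_atTop_nhds_zero_of_lt_one (by norm_num)
  have mu := fun j => hO.memLp_surface (us j) (uc j)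
  -- Approximation at rate `2^{-j}` makes the boundary values Cauchy with a summable modulus: the
  -- factor `4` counts two errors of functions and two of gradients, and the added `1` supplies the
  -- strict inequality.
  obtain ⟨τ, mτ, hτ⟩ := Lp.cauchy_complete_eLpNorm one_le_two mu
    (B := fun j => (C * 4 + 1) * 2⁻¹ ^ j) (by
      rw [ENNReal.tsum_mul_left, ENNReal.tsum_geometric]
      exact ENNReal.mul_ne_top (by simp [ENNReal.mul_eq_top]) (by simp)) (by
      intro N n k hn hk
      have b := hC _ ((us n).sub (us k))
      have g : gradient (fun x => u n x - u k x) = fun x => gradient (u n) x - gradient (u k) x :=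
        funext fun x => gradient_fun_sub (us n) (us k) x
      rw [g] at b
      have b1 := eLpNorm_sub_le_add (us n).continuous.aestronglyMeasurable
        (us k).continuous.aestronglyMeasurable mv.aestronglyMeasurable
      have b2 := eLpNorm_sub_le_add (continuous_gradient_of_contDiff (us n)).aestronglyMeasurable
        (continuous_gradient_of_contDiff (us k)).aestronglyMeasurable mG.aestronglyMeasurable
      have pn : (2⁻¹ : ℝ≥0∞) ^ n ≤ 2⁻¹ ^ N := pow_le_pow_right_of_le_one' (by norm_num) hn
      have pk : (2⁻¹ : ℝ≥0∞) ^ k ≤ 2⁻¹ ^ N := pow_le_pow_right_of_le_one' (by norm_num) hk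
      have tot : eLpNorm (u n - u k) 2 (surfaceMeasure O) ≤ C * 4 * 2⁻¹ ^ N := by
        refine b.trans ?_
        rw [mul_assoc]
        gcongr
        refine (add_le_add (b1.trans (add_le_add ((u1 n).trans pn) ((u1 k).trans pk)))
          (b2.trans (add_le_add ((u2 n).trans pn) ((u2 k).trans pk)))).trans (le_of_eq ?_)
        ring
      refine tot.trans_lt ?_
      rw [add_mul, one_mul]
      refine ENNReal.lt_add_right ?_ (by simp)
      exact ENNReal.mul_ne_top (by simp [ENNReal.mul_eq_top]) (by simp))
  refine ⟨τ, mτ, u, fun j => ⟨us j, uc j⟩, ?_, ?_, hτ⟩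
  · exact tendsto_of_tendsto_of_tendsto_of_le_of_le tendsto_const_nhds t0 (fun _ => zero_le) u1
  · refine tendsto_of_tendsto_of_tendsto_of_le_of_le tendsto_const_nhds t0 (fun _ => zero_le)
      fun j => le_trans (le_of_eq (eLpNorm_congr_ae ?_)) (u2 j)
    filter_upwards [weakGradient_ae_eq hO.1 h] with x hx
    rw [hx]

/-! ### Tangential gradients -/

lemma hasFDerivAt_graphPoint {m : ℕ} (e : Frame m) {γ : Eucl m → ℝ} {y : Eucl m}
    (hd : DifferentiableAt ℝ γ y) (h : Eucl m) :
    e (fderiv ℝ (graphPoint e γ) y h) = WithLp.toLp 2 (h, inner ℝ (gradient γ y) h) := by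
  let L : Eucl m × ℝ →L[ℝ] Eucl (m + 1) :=
    (e.symm.toContinuousLinearEquiv : WithLp 2 (Eucl m × ℝ) →L[ℝ] Eucl (m + 1)).comp
      ((WithLp.prodContinuousLinearEquiv 2 ℝ (Eucl m) ℝ).symm :
        Eucl m × ℝ →L[ℝ] WithLp 2 (Eucl m × ℝ))
  have h1 : HasFDerivAt (graphPoint e γ)
      (L.comp ((ContinuousLinearMap.id ℝ (Eucl m)).prod (fderiv ℝ γ y))) y :=
    L.hasFDerivAt.comp y ((hasFDerivAt_id y).prodMk hd.hasFDerivAt)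
  rw [h1.fderiv, inner_gradient_left']
  exact e.apply_symm_apply _

/-- A tangential vector is determined by its pull-back. -/
lemma eq_zero_of_adjoint_eq_zero {m : ℕ} (e : Frame m) {γ : Eucl m → ℝ} {y : Eucl m}
    (hd : DifferentiableAt ℝ γ y) {d : Eucl (m + 1)}
    (h1 : (fderiv ℝ (graphPoint e γ) y).adjoint d = 0)
    (h2 : inner ℝ d (graphNormal e γ y) = 0) : d = 0 := by
  have key : ∀ h, inner ℝ (e d).fst h + (e d).snd * inner ℝ (gradient γ y) h = 0 := by
    intro h
    have h3 : inner ℝ d (fderiv ℝ (graphPoint e γ) y h) = 0 := by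
      rw [← ContinuousLinearMap.adjoint_inner_left, h1, inner_zero_left]
    rw [← e.inner_map_map, hasFDerivAt_graphPoint e hd, WithLp.prod_inner_apply] at h3
    simpa [mul_comm] using h3
  -- A vector killed by the transposed differential is a multiple of `(∇γ, -1)`, that is, normal;
  -- orthogonality to the normal then leaves only zero.
  have hfst : (e d).fst + (e d).snd • gradient γ y = 0 := by
    refine ext_inner_right ℝ fun h => ?_
    rw [inner_add_left, inner_smul_left, inner_zero_left]
    exact key h
  have ρ0 : 0 < Real.sqrt (1 + ‖gradient γ y‖ ^ 2) := Real.sqrt_pos.2 (by positivity)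
  rw [inner_graphNormal, mul_eq_zero] at h2
  have h4 := h2.resolve_left (inv_ne_zero ρ0.ne')
  rw [eq_neg_of_add_eq_zero_left hfst, inner_neg_left, inner_smul_left,
    real_inner_self_eq_norm_sq] at h4
  simp only [conj_trivial] at h4
  have hs : (e d).snd = 0 := by
    have : (e d).snd * (1 + ‖gradient γ y‖ ^ 2) = 0 := by linarith
    exact (mul_eq_zero.1 this).resolve_right (by positivity)
  have hf : (e d).fst = 0 := by
    rw [hs, zero_smul, add_zero] at hfst; exact hfst
  have : e d = 0 := WithLp.ofLp_injective 2 (Prod.ext hf hs)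
  exact (map_eq_zero_iff e e.injective).1 this

/-- In each chart the pull-backs agree by uniqueness of weak gradients. They determine the vectors
up to the normal direction, which tangentiality excludes. -/
lemma HasTangentialGradient.ae_eq {m : ℕ} {O : Set (Eucl (m + 1))} (hO : IsLipschitzDomain O)
    {φ : Eucl (m + 1) → ℝ} {G G' : Eucl (m + 1) → Eucl (m + 1)}
    (h : HasTangentialGradient O φ G) (h' : HasTangentialGradient O φ G') :
    G =ᵐ[surfaceMeasure O] G' := by
  refine hO.ae_of_charts fun W e γ hch => ?_
  filter_upwards [(h.2 W e γ hch).ae_eq hch.isOpen_preimage (h'.2 W e γ hch), hch.ae_comp h.1,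
    hch.ae_comp h'.1, hch.ae_differentiableAt, hch.ae_outerNormal_eq] with y h1 h2 h3 h4 h5
  rw [h5] at h2 h3
  refine sub_eq_zero.1 (eq_zero_of_adjoint_eq_zero e h4.2 ?_ ?_)
  · rw [map_sub, h1, sub_self]
  · rw [inner_sub_left, h2, h3, sub_self]

lemma tangentialGradient_ae_eq {m : ℕ} {O : Set (Eucl (m + 1))} (hO : IsLipschitzDomain O)
    {φ : Eucl (m + 1) → ℝ} {G : Eucl (m + 1) → Eucl (m + 1)}
    (h : HasTangentialGradient O φ G) : tangentialGradient O φ =ᵐ[surfaceMeasure O] G := by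
  have hex : ∃ G, HasTangentialGradient O φ G := ⟨G, h⟩
  rw [tangentialGradient, dif_pos hex]
  exact hex.choose_spec.ae_eq hO h

lemma HasTangentialGradient.congr {m : ℕ} {O : Set (Eucl (m + 1))}
    {φ φ' : Eucl (m + 1) → ℝ} {G G' : Eucl (m + 1) → Eucl (m + 1)}
    (h : HasTangentialGradient O φ G) (hφ : φ =ᵐ[surfaceMeasure O] φ')
    (hG : G =ᵐ[surfaceMeasure O] G') : HasTangentialGradient O φ' G' := by
  refine ⟨?_, fun W e γ hch => (h.2 W e γ hch).congr (hch.ae_comp hφ) ?_⟩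
  · filter_upwards [h.1, hG] with x h1 h2
    rw [← h2, h1]
  · filter_upwards [hch.ae_comp hG] with y hy
    rw [hy]

lemma HasTangentialGradient.add {m : ℕ} {O : Set (Eucl (m + 1))}
    {φ φ' : Eucl (m + 1) → ℝ} {G G' : Eucl (m + 1) → Eucl (m + 1)}
    (h : HasTangentialGradient O φ G) (h' : HasTangentialGradient O φ' G') :
    HasTangentialGradient O (fun x => φ x + φ' x) (fun x => G x + G' x) := by
  refine ⟨?_, fun W e γ hch => ?_⟩
  · filter_upwards [h.1, h'.1] with x h1 h2
    rw [inner_add_left, h1, h2, add_zero]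
  · simp only [map_add]
    exact (h.2 W e γ hch).add (h'.2 W e γ hch)

lemma HasTangentialGradient.const_mul {m : ℕ} {O : Set (Eucl (m + 1))}
    {φ : Eucl (m + 1) → ℝ} {G : Eucl (m + 1) → Eucl (m + 1)}
    (h : HasTangentialGradient O φ G) (a : ℝ) :
    HasTangentialGradient O (fun x => a * φ x) (fun x => a • G x) := by
  refine ⟨?_, fun W e γ hch => ?_⟩
  · filter_upwards [h.1] with x h1
    rw [inner_smul_left, h1, mul_zero]
  · simp only [map_smul]
    exact (h.2 W e γ hch).const_mul a

lemma HasTangentialGradient.zero {m : ℕ} (O : Set (Eucl (m + 1))) :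
    HasTangentialGradient O (fun _ => 0) (fun _ => 0) := by
  refine ⟨Eventually.of_forall fun x => inner_zero_left _, fun W e γ hch => ?_⟩
  simp only [map_zero]
  exact ⟨locallyIntegrableOn_zero, locallyIntegrableOn_zero, fun ψ _ _ _ ξ => by simp⟩

lemma norm_adjoint_fderiv_graphPoint_le {m : ℕ} (e : Frame m) {γ : Eucl m → ℝ} {K : ℝ≥0}
    (hK : LipschitzWith K γ) (y : Eucl m) (x : Eucl (m + 1)) :
    ‖(fderiv ℝ (graphPoint e γ) y).adjoint x‖ ≤ (1 + K) * ‖x‖ := by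
  refine ((fderiv ℝ (graphPoint e γ) y).adjoint.le_opNorm x).trans
    (mul_le_mul_of_nonneg_right ?_ (norm_nonneg _))
  rw [LinearIsometryEquiv.norm_map]
  have := norm_fderiv_le_of_lipschitz ℝ (lipschitzWith_graphPoint e hK) (x₀ := y)
  simpa using this

lemma IsGraphChart.memLp_adjoint {m : ℕ} {O W : Set (Eucl (m + 1))} {e : Frame m}
    {γ : Eucl m → ℝ} (h : IsGraphChart O W e γ) {G : Eucl (m + 1) → Eucl (m + 1)} {p : ℝ≥0∞}
    (hG : MemLp G p (surfaceMeasure O)) :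
    MemLp (fun y => (fderiv ℝ (graphPoint e γ) y).adjoint (G (graphPoint e γ y))) p
      (volume.restrict (graphPoint e γ ⁻¹' W)) := by
  obtain ⟨K, hK⟩ := h.2.1
  have m1 : Measurable fun y => (fderiv ℝ (graphPoint e γ) y).adjoint :=
    (ContinuousLinearMap.adjoint (𝕜 := ℝ) (E := Eucl m)
      (F := Eucl (m + 1))).continuous.measurable.comp (measurable_fderiv ℝ (graphPoint e γ))
  refine (h.memLp_comp hG).of_le_mul (c := 1 + K) ?_
    (Eventually.of_forall fun y => norm_adjoint_fderiv_graphPoint_le e hK y _)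
  exact (ContinuousLinearMap.id ℝ (Eucl (m + 1) →L[ℝ] Eucl m)).aestronglyMeasurable_comp₂
    m1.aestronglyMeasurable (h.memLp_comp hG).aestronglyMeasurable

/-- Tangential gradients are stable under `L²` limits. -/
lemma HasTangentialGradient.of_tendsto {m : ℕ} {O : Set (Eucl (m + 1))}
    {φ : Eucl (m + 1) → ℝ} {G : Eucl (m + 1) → Eucl (m + 1)}
    {w : ℕ → Eucl (m + 1) → ℝ} {H : ℕ → Eucl (m + 1) → Eucl (m + 1)}
    (h : ∀ j, HasTangentialGradient O (w j) (H j))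
    (mw : ∀ j, MemLp (w j) 2 (surfaceMeasure O)) (mH : ∀ j, MemLp (H j) 2 (surfaceMeasure O))
    (mφ : MemLp φ 2 (surfaceMeasure O)) (mG : MemLp G 2 (surfaceMeasure O))
    (tφ : Tendsto (fun j => eLpNorm (fun x => w j x - φ x) 2 (surfaceMeasure O)) atTop (𝓝 0))
    (tG : Tendsto (fun j => eLpNorm (fun x => H j x - G x) 2 (surfaceMeasure O)) atTop (𝓝 0)) :
    HasTangentialGradient O φ G := by
  refine ⟨?_, fun W e γ hch => ?_⟩
  -- Tangentiality is a pointwise condition, so it passes to the limit along an almost everywhere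
  -- convergent subsequence.
  · have hm : TendstoInMeasure (surfaceMeasure O) H atTop G :=
      tendstoInMeasure_of_tendsto_eLpNorm two_ne_zero (fun j => (mH j).aestronglyMeasurable)
        mG.aestronglyMeasurable tG
    obtain ⟨ns, -, hns⟩ := hm.exists_seq_tendsto_ae
    filter_upwards [hns, ae_all_iff.2 fun j => (h (ns j)).1] with x h1 h2
    have h3 : Tendsto (fun j => inner ℝ (H (ns j) x) (outerNormal O x)) atTop
        (𝓝 (inner ℝ (G x) (outerNormal O x))) := h1.inner tendsto_const_nhds
    simp only [h2] at h3
    exact tendsto_nhds_unique h3 tendsto_const_nhds |>.symm ▸ rfl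
  · obtain ⟨K, hK⟩ := hch.2.1
    refine HasWeakGradient.of_tendsto (fun j => (h j).2 W e γ hch) (fun j => hch.memLp_comp (mw j))
      (fun j => hch.memLp_adjoint (mH j)) (hch.memLp_comp mφ) (hch.memLp_adjoint mG) ?_ ?_
    · exact tendsto_of_tendsto_of_tendsto_of_le_of_le tendsto_const_nhds tφ (fun _ => zero_le)
        fun j => hch.eLpNorm_comp_le (fun x => w j x - φ x) 2
    · refine tendsto_zero_of_le_const_mul tG (c := ENNReal.ofReal (1 + K)) ENNReal.ofReal_ne_top
        fun j => ?_
      refine le_trans ?_ (mul_le_mul_right (hch.eLpNorm_comp_le (fun x => H j x - G x) 2) _)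
      refine eLpNorm_le_mul_eLpNorm_of_ae_le_mul (Eventually.of_forall fun y => ?_) 2
      rw [← map_sub]
      exact norm_adjoint_fderiv_graphPoint_le e hK y _

/-- The product of a function in `H¹(Γ)` and a function in `W^{1,∞}(Γ)`. -/
lemma HasTangentialGradient.mul {m : ℕ} {O : Set (Eucl (m + 1))}
    {φ g : Eucl (m + 1) → ℝ} {G H : Eucl (m + 1) → Eucl (m + 1)}
    (h : HasTangentialGradient O φ G) (h' : HasTangentialGradient O g H)
    (mφ : MemLp φ 2 (surfaceMeasure O)) (mG : MemLp G 2 (surfaceMeasure O))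
    (mg : MemLp g ⊤ (surfaceMeasure O)) (mH : MemLp H ⊤ (surfaceMeasure O)) :
    HasTangentialGradient O (fun x => φ x * g x) (fun x => g x • G x + φ x • H x) := by
  refine ⟨?_, fun W e γ hch => ?_⟩
  · filter_upwards [h.1, h'.1] with x h1 h2
    rw [inner_add_left, inner_smul_left, inner_smul_left, h1, h2, mul_zero, mul_zero, add_zero]
  · simp only [map_add, map_smul]
    exact (h.2 W e γ hch).mul hch.isOpen_preimage (h'.2 W e γ hch) (hch.memLp_comp mφ)
      (hch.memLp_adjoint mG) (hch.memLp_comp mg) (hch.memLp_adjoint mH)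

/-- The surface divergence of `τ r`, for `τ ∈ H¹(Γ)` and `r ∈ W^{1,∞}(Γ)`. -/
lemma surfaceDiv_smul_ae_eq {m : ℕ} {O : Set (Eucl (m + 1))} (hO : IsLipschitzDomain O)
    {τ : Eucl (m + 1) → ℝ} {H r : Eucl (m + 1) → Eucl (m + 1)}
    (h : HasTangentialGradient O τ H) (mτ : MemLp τ 2 (surfaceMeasure O))
    (mH : MemLp H 2 (surfaceMeasure O)) (hr : ∀ i, MemW1Boundary O ⊤ (fun x => r x i)) :
    surfaceDiv O (fun y => τ y • r y) =ᵐ[surfaceMeasure O]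
      fun x => inner ℝ (r x) (H x) + τ x * surfaceDiv O r x := by
  choose mr R mR hR using hr
  have h1 : ∀ i, tangentialGradient O (fun y => (τ y • r y) i) =ᵐ[surfaceMeasure O]
      fun x => r x i • H x + τ x • R i x := fun i =>
    tangentialGradient_ae_eq hO (h.mul (hR i) mτ mH (mr i) (mR i))
  have h2 : ∀ i, tangentialGradient O (fun y => r y i) =ᵐ[surfaceMeasure O] R i := fun i =>
    tangentialGradient_ae_eq hO (hR i)
  filter_upwards [ae_all_iff.2 h1, ae_all_iff.2 h2] with x h1 h2
  simp only [surfaceDiv, h1, h2]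
  simp only [PiLp.inner_apply, PiLp.add_apply, PiLp.smul_apply, smul_eq_mul,
    Finset.sum_add_distrib, Finset.mul_sum]
  simp [mul_comm]

lemma memLp_top_surfaceDiv {m : ℕ} {O : Set (Eucl (m + 1))} (hO : IsLipschitzDomain O)
    {r : Eucl (m + 1) → Eucl (m + 1)} (hr : ∀ i, MemW1Boundary O ⊤ (fun x => r x i)) :
    MemLp (surfaceDiv O r) ⊤ (surfaceMeasure O) := by
  refine memLp_finsetSum _ fun i _ => ?_
  obtain ⟨-, G, mG, hG⟩ := hr i
  exact memLp_piLp_iff.1 (mG.ae_eq (tangentialGradient_ae_eq hO hG).symm) i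

lemma memLp_top_weakDiv {k : ℕ} {V : Set (Eucl k)} (hV : IsOpen V) {b : Eucl k → Eucl k}
    (hb : ∀ i, MemW1 V ⊤ (fun x => b x i)) : MemLp (weakDiv V b) ⊤ (volume.restrict V) := by
  refine memLp_finsetSum _ fun i _ => ?_
  obtain ⟨-, G, mG, hG⟩ := hb i
  exact memLp_piLp_iff.1 (mG.ae_eq (weakGradient_ae_eq hV hG).symm) i

/-! ### The discontinuous Galerkin step in a Hilbert space -/

/-- The curve `τ ↦ ∑ τⁱ cᵢ`. -/
noncomputable def polyCurve {X : Type*} [AddCommGroup X] [Module ℝ X] {n : ℕ}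
    (c : Fin n → X) (τ : ℝ) : X :=
  ∑ i : Fin n, τ ^ (i : ℕ) • c i

/-- The derivative of `polyCurve c`. -/
noncomputable def polyCurveDeriv {X : Type*} [AddCommGroup X] [Module ℝ X] {n : ℕ}
    (c : Fin n → X) (τ : ℝ) : X :=
  ∑ i : Fin n, (((i : ℕ) : ℝ) * τ ^ ((i : ℕ) - 1)) • c i

lemma hasDerivAt_polyCurve {X : Type*} [NormedAddCommGroup X] [NormedSpace ℝ X] {n : ℕ}
    (c : Fin n → X) (τ : ℝ) : HasDerivAt (polyCurve c) (polyCurveDeriv c τ) τ :=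
  HasDerivAt.fun_sum fun i _ => (hasDerivAt_pow (i : ℕ) τ).smul_const (c i)

lemma continuous_polyCurve {X : Type*} [NormedAddCommGroup X] [NormedSpace ℝ X] {n : ℕ}
    (c : Fin n → X) : Continuous (polyCurve c) := by
  unfold polyCurve; fun_prop

lemma continuous_polyCurveDeriv {X : Type*} [NormedAddCommGroup X] [NormedSpace ℝ X] {n : ℕ}
    (c : Fin n → X) : Continuous (polyCurveDeriv c) := by
  unfold polyCurveDeriv; fun_prop

lemma exists_sum_pow_ne_zero {n : ℕ} {x : Fin n → ℝ} (hx : x ≠ 0) {a b : ℝ} (hab : a < b) :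
    ∃ τ ∈ Icc a b, ∑ i : Fin n, τ ^ (i : ℕ) * x i ≠ 0 := by
  by_contra! hcon
  let p : Polynomial ℝ := ∑ i : Fin n, Polynomial.monomial (i : ℕ) (x i)
  have hp : p = 0 := by
    refine Polynomial.eq_zero_of_infinite_isRoot p ((Icc_infinite hab).mono fun τ hτ => ?_)
    have := hcon τ hτ
    simp only [mem_ofPred_eq, Polynomial.IsRoot, p, Polynomial.eval_finsetSum,
      Polynomial.eval_monomial]
    rw [← this]
    exact Finset.sum_congr rfl fun i _ => mul_comm _ _
  refine hx (funext fun j => ?_)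
  have h := congrArg (fun q => Polynomial.coeff q (j : ℕ)) hp
  simp only [p, Polynomial.finsetSum_coeff, Polynomial.coeff_monomial, Polynomial.coeff_zero,
    Fin.val_inj] at h
  simpa using h

lemma integral_sq_norm_polyCurve {S : Type*} [NormedAddCommGroup S] [InnerProductSpace ℝ S]
    {n : ℕ} (c : Fin n → S) (a b : ℝ) :
    ∫ τ in a..b, ‖polyCurve c τ‖ ^ 2
      = ∑ i : Fin n, ∑ j : Fin n,
        (∫ τ in a..b, τ ^ (i : ℕ) * τ ^ (j : ℕ)) * inner ℝ (c i) (c j) := by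
  have e : ∀ τ, ‖polyCurve c τ‖ ^ 2
      = ∑ i : Fin n, ∑ j : Fin n, (τ ^ (i : ℕ) * τ ^ (j : ℕ)) * inner ℝ (c i) (c j) := fun τ => by
    rw [← real_inner_self_eq_norm_sq, polyCurve, sum_inner]
    refine Finset.sum_congr rfl fun i _ => ?_
    rw [inner_sum]
    refine Finset.sum_congr rfl fun j _ => ?_
    rw [inner_smul_left, inner_smul_right]
    simp only [conj_trivial]
    ring
  simp only [e]
  rw [intervalIntegral.integral_finsetSum fun i _ =>
    Continuous.intervalIntegrable (by fun_prop) _ _]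
  refine Finset.sum_congr rfl fun i _ => ?_
  rw [intervalIntegral.integral_finsetSum fun j _ =>
    Continuous.intervalIntegrable (by fun_prop) _ _]
  refine Finset.sum_congr rfl fun j _ => ?_
  rw [intervalIntegral.integral_mul_const]

open scoped MatrixOrder in
/-- Equivalence of norms on vector valued polynomials. -/
lemma exists_le_integral_sq_norm_polyCurve (S : Type*) [NormedAddCommGroup S]
    [InnerProductSpace ℝ S] (n : ℕ) {a b : ℝ} (hab : a < b) :
    ∃ r > 0, ∀ c : Fin n → S, r * ∑ i : Fin n, ‖c i‖ ^ 2 ≤ ∫ τ in a..b, ‖polyCurve c τ‖ ^ 2 := by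
  -- The Gram matrix of the monomials; it is positive definite because a nonzero scalar polynomial
  -- cannot vanish on a whole interval.
  let M : Matrix (Fin n) (Fin n) ℝ := fun i j => ∫ τ in a..b, τ ^ (i : ℕ) * τ ^ (j : ℕ)
  have hM : M.PosDef := by
    refine Matrix.PosDef.of_dotProduct_mulVec_pos ?_ fun x hx => ?_
    · ext i j
      rw [Matrix.conjTranspose_apply, star_trivial]
      exact intervalIntegral.integral_congr fun τ _ => mul_comm _ _
    · have e : star x ⬝ᵥ (M.mulVec x) = ∫ τ in a..b, ‖polyCurve x τ‖ ^ 2 := by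
        rw [integral_sq_norm_polyCurve]
        simp only [dotProduct, Matrix.mulVec, M, Finset.mul_sum]
        refine Finset.sum_congr rfl fun i _ => Finset.sum_congr rfl fun j _ => ?_
        simp
        ring
      rw [e]
      obtain ⟨τ, hτ, hne⟩ := exists_sum_pow_ne_zero hx hab
      refine intervalIntegral.integral_pos hab
        ((continuous_polyCurve x).norm.pow 2).continuousOn (fun _ _ => by positivity)
        ⟨τ, hτ, ?_⟩
      have : polyCurve x τ ≠ 0 := hne
      positivity
  -- Writing `M = A* A` with `A` invertible reduces the vector valued case to the scalar matrix: the
  -- integral becomes `∑ₖ ‖∑ᵢ Aₖᵢ cᵢ‖²`, and `A⁻¹` recovers the coefficients.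
  obtain ⟨A, hA⟩ := CStarAlgebra.nonneg_iff_eq_star_mul_self.mp hM.posSemidef.nonneg
  have hdet : IsUnit A.det := by
    have h1 := (Matrix.isUnit_iff_isUnit_det M).1 hM.isUnit
    rw [hA, Matrix.det_mul] at h1
    exact isUnit_of_mul_isUnit_right h1
  have hMA : ∀ i j, M i j = ∑ k, A k i * A k j := fun i j => by
    rw [hA]
    simp [Matrix.mul_apply, Matrix.star_apply]
  have key : ∀ c : Fin n → S, ∫ τ in a..b, ‖polyCurve c τ‖ ^ 2
      = ∑ k, ‖∑ i : Fin n, A k i • c i‖ ^ 2 := by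
    intro c
    rw [integral_sq_norm_polyCurve]
    have : ∀ k, ‖∑ i : Fin n, A k i • c i‖ ^ 2
        = ∑ i : Fin n, ∑ j : Fin n, A k i * A k j * inner ℝ (c i) (c j) := fun k => by
      rw [← real_inner_self_eq_norm_sq, sum_inner]
      refine Finset.sum_congr rfl fun i _ => ?_
      rw [inner_sum]
      refine Finset.sum_congr rfl fun j _ => ?_
      rw [inner_smul_left, inner_smul_right]
      simp only [conj_trivial]
      ring
    simp only [this]
    have e3 : ∀ i j : Fin n, (∫ τ in a..b, τ ^ (i : ℕ) * τ ^ (j : ℕ)) * inner ℝ (c i) (c j)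
        = ∑ k, A k i * A k j * inner ℝ (c i) (c j) := fun i j => by
      rw [← Finset.sum_mul, ← hMA]
    simp only [e3]
    exact (Finset.sum_congr rfl fun i _ => Finset.sum_comm).trans Finset.sum_comm
  -- The squared Frobenius norm of `A⁻¹`, with `1` added so that `D` is positive also for `n = 0`.
  set D : ℝ := 1 + ∑ i : Fin n, ∑ k, (A⁻¹ i k) ^ 2 with hD
  have D0 : 0 < D := by positivity
  refine ⟨D⁻¹, inv_pos.2 D0, fun c => ?_⟩
  rw [key, inv_mul_le_iff₀ D0]
  set Q := ∑ k, ‖∑ i : Fin n, A k i • c i‖ ^ 2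
  have Q0 : 0 ≤ Q := by positivity
  have hci : ∀ i, ‖c i‖ ^ 2 ≤ (∑ k, (A⁻¹ i k) ^ 2) * Q := by
    intro i
    have e1 : c i = ∑ k, A⁻¹ i k • ∑ j : Fin n, A k j • c j := by
      simp only [Finset.smul_sum, smul_smul]
      rw [Finset.sum_comm]
      simp only [← Finset.sum_smul, ← Matrix.mul_apply, Matrix.nonsing_inv_mul _ hdet,
        Matrix.one_apply, ite_smul, one_smul, zero_smul]
      simp
    have e2 : ‖c i‖ ≤ ∑ k, |A⁻¹ i k| * ‖∑ j : Fin n, A k j • c j‖ := by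
      conv_lhs => rw [e1]
      refine (norm_sum_le _ _).trans (le_of_eq ?_)
      simp only [norm_smul, Real.norm_eq_abs]
    calc ‖c i‖ ^ 2 ≤ (∑ k, |A⁻¹ i k| * ‖∑ j : Fin n, A k j • c j‖) ^ 2 :=
          pow_le_pow_left₀ (norm_nonneg _) e2 2
      _ ≤ (∑ k, |A⁻¹ i k| ^ 2) * ∑ k, ‖∑ j : Fin n, A k j • c j‖ ^ 2 :=
          Finset.sum_mul_sq_le_sq_mul_sq _ _ _
      _ = _ := by simp only [sq_abs]; rfl
  calc ∑ i : Fin n, ‖c i‖ ^ 2 ≤ ∑ i : Fin n, (∑ k, (A⁻¹ i k) ^ 2) * Q :=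
        Finset.sum_le_sum fun i _ => hci i
    _ = (∑ i : Fin n, ∑ k, (A⁻¹ i k) ^ 2) * Q := by rw [Finset.sum_mul]
    _ ≤ D * Q := mul_le_mul_of_nonneg_right (by rw [hD]; linarith) Q0

section GalerkinStep

variable {S : Type*} [NormedAddCommGroup S] [InnerProductSpace ℝ S]

lemma continuous_bilin_comp (μ : S →L[ℝ] S →L[ℝ] ℝ) {f g : ℝ → S} (hf : Continuous f)
    (hg : Continuous g) : Continuous fun τ => μ (f τ) (g τ) :=
  (μ.continuous.comp hf).clm_apply hg

/-- The bilinear form of one step of the scheme, on the space of coefficients. -/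
noncomputable def stepForm (μ α : S →L[ℝ] S →L[ℝ] ℝ) (a b : ℝ) {n : ℕ} (c e : Fin n → S) : ℝ :=
  (∫ τ in a..b, (μ (polyCurveDeriv c τ) (polyCurve e τ) + α (polyCurve c τ) (polyCurve e τ)))
    + μ (polyCurve c a) (polyCurve e a)

/-- Expansion in monomials exhibits the form of the step as a finite combination of `μ` and `α` on
the coefficients, hence as a bounded bilinear form. -/
lemma stepForm_eq_sum (μ α : S →L[ℝ] S →L[ℝ] ℝ) (a b : ℝ) {n : ℕ} (c e : Fin n → S) :
    stepForm μ α a b c e = ∑ i : Fin n, ∑ j : Fin n,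
      (((∫ τ in a..b, ((i : ℕ) : ℝ) * τ ^ ((i : ℕ) - 1) * τ ^ (j : ℕ))
          + a ^ (i : ℕ) * a ^ (j : ℕ)) * μ (c i) (e j)
        + (∫ τ in a..b, τ ^ (i : ℕ) * τ ^ (j : ℕ)) * α (c i) (e j)) := by
  have e1 : ∀ τ, μ (polyCurveDeriv c τ) (polyCurve e τ) + α (polyCurve c τ) (polyCurve e τ)
      = ∑ i : Fin n, ∑ j : Fin n, (((i : ℕ) : ℝ) * τ ^ ((i : ℕ) - 1) * τ ^ (j : ℕ) * μ (c i) (e j)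
        + τ ^ (i : ℕ) * τ ^ (j : ℕ) * α (c i) (e j)) := fun τ => by
    simp only [polyCurveDeriv, polyCurve, map_sum, map_smul, sum_apply,
      smul_apply, smul_eq_mul, ← Finset.sum_add_distrib, Finset.mul_sum]
    rw [Finset.sum_comm]
    refine Finset.sum_congr rfl fun i _ => Finset.sum_congr rfl fun j _ => ?_
    ring
  have e2 : μ (polyCurve c a) (polyCurve e a)
      = ∑ i : Fin n, ∑ j : Fin n, a ^ (i : ℕ) * a ^ (j : ℕ) * μ (c i) (e j) := by
    simp only [polyCurve, map_sum, map_smul, sum_apply,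
      smul_apply, smul_eq_mul, Finset.mul_sum]
    rw [Finset.sum_comm]
    refine Finset.sum_congr rfl fun i _ => Finset.sum_congr rfl fun j _ => ?_
    ring
  rw [stepForm, e2]
  simp only [e1]
  rw [intervalIntegral.integral_finsetSum fun i _ =>
    Continuous.intervalIntegrable (by fun_prop) _ _, ← Finset.sum_add_distrib]
  refine Finset.sum_congr rfl fun i _ => ?_
  rw [intervalIntegral.integral_finsetSum fun j _ =>
    Continuous.intervalIntegrable (by fun_prop) _ _, ← Finset.sum_add_distrib]
  refine Finset.sum_congr rfl fun j _ => ?_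
  rw [intervalIntegral.integral_add (Continuous.intervalIntegrable (by fun_prop) _ _)
    (Continuous.intervalIntegrable (by fun_prop) _ _), intervalIntegral.integral_mul_const,
    intervalIntegral.integral_mul_const]
  ring

/-- The energy identity: since `2 μ(c', c)` is the derivative of `μ(c, c)`, the `μ` terms, including
the jump at `a`, add up to half the sum of the values of `μ(c, c)` at `a` and `b`, which is
nonnegative. -/
lemma stepForm_self_ge {μ α : S →L[ℝ] S →L[ℝ] ℝ} (hsymm : ∀ v w, μ v w = μ w v)
    (hpos : ∀ v, 0 ≤ μ v v) {κ : ℝ} (hα : ∀ v, κ * ‖v‖ ^ 2 ≤ α v v) {a b : ℝ}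
    (hab : a < b) {n : ℕ} (c : Fin n → S) :
    κ * ∫ τ in a..b, ‖polyCurve c τ‖ ^ 2 ≤ stepForm μ α a b c c := by
  have cP := continuous_polyCurve c
  have cP' := continuous_polyCurveDeriv c
  have der : ∀ τ, HasDerivAt (fun τ => μ (polyCurve c τ) (polyCurve c τ))
      (2 * μ (polyCurveDeriv c τ) (polyCurve c τ)) τ := by
    intro τ
    have h := hasDerivAt_polyCurve c τ
    have h1 : HasDerivAt (fun τ => μ (polyCurve c τ)) (μ (polyCurveDeriv c τ)) τ :=
      μ.hasFDerivAt.comp_hasDerivAt τ h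
    refine (h1.clm_apply h).congr_deriv ?_
    rw [hsymm (polyCurve c τ)]
    ring
  have ftc := intervalIntegral.integral_eq_sub_of_hasDerivAt (a := a) (b := b)
    (fun τ _ => der τ)
    (((continuous_bilin_comp μ cP' cP).const_mul 2).intervalIntegrable _ _)
  rw [intervalIntegral.integral_const_mul] at ftc
  have hmono : κ * ∫ τ in a..b, ‖polyCurve c τ‖ ^ 2
      ≤ ∫ τ in a..b, α (polyCurve c τ) (polyCurve c τ) := by
    rw [← intervalIntegral.integral_const_mul]
    exact intervalIntegral.integral_mono_on hab.le
      (((cP.norm.pow 2).const_mul κ).intervalIntegrable _ _)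
      ((continuous_bilin_comp α cP cP).intervalIntegrable _ _) fun τ _ => hα _
  rw [stepForm, intervalIntegral.integral_add
    ((continuous_bilin_comp μ cP' cP).intervalIntegrable _ _)
    ((continuous_bilin_comp α cP cP).intervalIntegrable _ _)]
  linarith [hpos (polyCurve c a), hpos (polyCurve c b)]

variable [CompleteSpace S]

/-- One step of the discontinuous Galerkin scheme has exactly one solution. -/
theorem existsUnique_galerkinStep {μ α : S →L[ℝ] S →L[ℝ] ℝ} (hsymm : ∀ v w, μ v w = μ w v)
    (hpos : ∀ v, 0 ≤ μ v v) {κ : ℝ} (hκ : 0 < κ) (hα : ∀ v, κ * ‖v‖ ^ 2 ≤ α v v) {a b : ℝ}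
    (hab : a < b) {n : ℕ} (ℓ : Fin n → S →L[ℝ] ℝ) :
    ∃! c : Fin n → S, ∀ e : Fin n → S, stepForm μ α a b c e = ∑ i : Fin n, ℓ i (e i) := by
  -- The `ℓ²` sum makes the space of coefficient vectors a Hilbert space, as Lax-Milgram requires.
  let E := PiLp 2 (fun _ : Fin n => S)
  let pr : Fin n → E →L[ℝ] S := fun i => PiLp.proj 2 (fun _ : Fin n => S) i
  let B : E →L[ℝ] E →L[ℝ] ℝ := ∑ i : Fin n, ∑ j : Fin n,
    (((∫ τ in a..b, ((i : ℕ) : ℝ) * τ ^ ((i : ℕ) - 1) * τ ^ (j : ℕ))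
          + a ^ (i : ℕ) * a ^ (j : ℕ)) • μ.bilinearComp (pr i) (pr j)
        + (∫ τ in a..b, τ ^ (i : ℕ) * τ ^ (j : ℕ)) • α.bilinearComp (pr i) (pr j))
  have hB : ∀ c e : E, B c e = stepForm μ α a b (WithLp.ofLp c) (WithLp.ofLp e) := by
    intro c e
    rw [stepForm_eq_sum]
    simp only [B, sum_apply, add_apply,
      smul_apply, ContinuousLinearMap.bilinearComp_apply, smul_eq_mul]
    rfl
  have hcoer : IsCoercive B := by
    obtain ⟨r, hr, hle⟩ := exists_le_integral_sq_norm_polyCurve S n hab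
    refine ⟨κ * r, mul_pos hκ hr, fun c => ?_⟩
    rw [hB, mul_assoc, mul_assoc]
    refine le_trans ?_ (stepForm_self_ge hsymm hpos hα hab _)
    refine mul_le_mul_of_nonneg_left ?_ hκ.le
    refine le_trans (le_of_eq ?_) (hle _)
    rw [← sq, PiLp.norm_sq_eq_of_L2]
  let Λ : StrongDual ℝ E := ∑ i : Fin n, (ℓ i).comp (pr i)
  have hΛ : ∀ e : E, Λ e = ∑ i : Fin n, ℓ i (WithLp.ofLp e i) := fun e => by
    simp only [Λ, sum_apply]
    rfl
  -- With the Riesz representative `F` of the right-hand side and the Lax-Milgram isomorphism `T` of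
  -- the form, the step reads `T c = F`.
  let F : E := (InnerProductSpace.toDual ℝ E).symm Λ
  have hF : ∀ e, inner ℝ F e = Λ e := fun e => InnerProductSpace.toDual_symm_apply
  let T := hcoer.continuousLinearEquivOfBilin
  have hT : ∀ c e : E, inner ℝ (T c) e = B c e := hcoer.continuousLinearEquivOfBilin_apply
  refine ⟨WithLp.ofLp (T.symm F), fun e => ?_, fun c hc => ?_⟩
  · have h1 := hB (T.symm F) (WithLp.toLp 2 e)
    rw [← hT, T.apply_symm_apply, hF, hΛ] at h1
    exact h1.symm
  · have h1 : T (WithLp.toLp 2 c) = F := by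
      refine ext_inner_right ℝ fun e => ?_
      rw [hT, hF, hB, hΛ]
      exact hc _
    rw [← h1, T.symm_apply_apply]

end GalerkinStep

/-- The Hilbert space `L²(O) × L²(O; ℝ^{m+1}) × L²(Γ) × L²(Γ; ℝ^{m+1})`, which holds a function,
its gradient, its trace and the tangential gradient of its trace. -/
abbrev GraphSpace {m : ℕ} (O : Set (Eucl (m + 1))) : Type :=
  WithLp 2 (WithLp 2 (L2 O × Lp (Eucl (m + 1)) 2 (volume.restrict O)) ×
    WithLp 2 (L2Boundary O × Lp (Eucl (m + 1)) 2 (surfaceMeasure O)))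

/-! ### Components of the graph space -/

namespace GraphSpace

variable {m : ℕ} (O : Set (Eucl (m + 1)))

/-- The function component. -/
noncomputable def valL : GraphSpace O →L[ℝ] L2 O := (WithLp.fstL 2 ℝ _ _).comp (WithLp.fstL 2 ℝ _ _)

/-- The gradient component. -/
noncomputable def gradL : GraphSpace O →L[ℝ] Lp (Eucl (m + 1)) 2 (volume.restrict O) :=
  (WithLp.sndL 2 ℝ _ _).comp (WithLp.fstL 2 ℝ _ _)

/-- The trace component. -/
noncomputable def traceL : GraphSpace O →L[ℝ] L2Boundary O :=
  (WithLp.fstL 2 ℝ _ _).comp (WithLp.sndL 2 ℝ _ _)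

/-- The tangential gradient component. -/
noncomputable def tanL : GraphSpace O →L[ℝ] Lp (Eucl (m + 1)) 2 (surfaceMeasure O) :=
  (WithLp.sndL 2 ℝ _ _).comp (WithLp.sndL 2 ℝ _ _)

variable {O}

lemma norm_sq_eq (x : GraphSpace O) :
    ‖x‖ ^ 2 = ‖valL O x‖ ^ 2 + ‖gradL O x‖ ^ 2 + (‖traceL O x‖ ^ 2 + ‖tanL O x‖ ^ 2) := by
  rw [WithLp.prod_norm_sq_eq_of_L2, WithLp.prod_norm_sq_eq_of_L2, WithLp.prod_norm_sq_eq_of_L2]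
  rfl

/-- The element with given components. -/
noncomputable def mk (v : L2 O) (G : Lp (Eucl (m + 1)) 2 (volume.restrict O)) (τ : L2Boundary O)
    (H : Lp (Eucl (m + 1)) 2 (surfaceMeasure O)) : GraphSpace O :=
  WithLp.toLp 2 (WithLp.toLp 2 (v, G), WithLp.toLp 2 (τ, H))

section mk

variable (v : L2 O) (G : Lp (Eucl (m + 1)) 2 (volume.restrict O)) (τ : L2Boundary O)
    (H : Lp (Eucl (m + 1)) 2 (surfaceMeasure O))

lemma valL_mk : valL O (mk v G τ H) = v := rfl

lemma gradL_mk : gradL O (mk v G τ H) = G := rfl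

lemma traceL_mk : traceL O (mk v G τ H) = τ := rfl

lemma tanL_mk : tanL O (mk v G τ H) = H := rfl

end mk

lemma tendsto_of_components {ι : Type*} {l : Filter ι} {x : ι → GraphSpace O} {y : GraphSpace O}
    (h1 : Tendsto (fun j => valL O (x j)) l (𝓝 (valL O y)))
    (h2 : Tendsto (fun j => gradL O (x j)) l (𝓝 (gradL O y)))
    (h3 : Tendsto (fun j => traceL O (x j)) l (𝓝 (traceL O y)))
    (h4 : Tendsto (fun j => tanL O (x j)) l (𝓝 (tanL O y))) : Tendsto x l (𝓝 y) := by
  rw [tendsto_iff_norm_sub_tendsto_zero] at *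
  have h : Tendsto (fun j => ‖x j - y‖ ^ 2) l (𝓝 0) := by
    simp only [norm_sq_eq, map_sub]
    simpa using ((h1.pow 2).add (h2.pow 2)).add ((h3.pow 2).add (h4.pow 2))
  have := h.sqrt
  simpa [Real.sqrt_sq] using this

end GraphSpace

open GraphSpace

/-! ### Test functions in the graph space and their closure -/

lemma gradient_fun_add {k : ℕ} {u w : Eucl k → ℝ} (hu : ContDiff ℝ ∞ u) (hw : ContDiff ℝ ∞ w)
    (x : Eucl k) : gradient (fun x => u x + w x) x = gradient u x + gradient w x := by
  simp only [gradient]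
  rw [fderiv_fun_add (hu.differentiable (by simp) x) (hw.differentiable (by simp) x), map_add]

lemma gradient_fun_const_mul {k : ℕ} {u : Eucl k → ℝ} (hu : ContDiff ℝ ∞ u) (a : ℝ)
    (x : Eucl k) : gradient (fun x => a * u x) x = a • gradient u x := by
  simp only [gradient]
  rw [fderiv_const_mul (hu.differentiable (by simp) x), map_smul]

lemma hasWeakGradient_gradient {k : ℕ} {V : Set (Eucl k)} {u : Eucl k → ℝ}
    (hu : ContDiff ℝ ∞ u) (hc : HasCompactSupport u) : HasWeakGradient V u (gradient u) := by
  refine ⟨locallyIntegrableOn_of_memLp one_le_two (memLp_contDiff hu hc 2),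
    locallyIntegrableOn_of_memLp one_le_two (memLp_gradient hu hc 2), fun ψ h1 h2 h3 ξ => ?_⟩
  have c1 := continuous_fderiv_apply_of_contDiff h1 ξ
  have c2 := continuous_fderiv_apply_of_contDiff hu ξ
  have e0 : ∀ x ∉ V, fderiv ℝ ψ x ξ = 0 := fun x hx =>
    image_eq_zero_of_notMem_tsupport (f := fun x => fderiv ℝ ψ x ξ) fun h =>
      hx (h3 (tsupport_fderiv_apply_subset' ψ ξ h))
  have e1 : ∀ x ∉ V, ψ x = 0 := fun x hx =>
    image_eq_zero_of_notMem_tsupport fun h => hx (h3 h)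
  rw [setIntegral_eq_integral_of_forall_compl_eq_zero fun x hx => by rw [e0 x hx, mul_zero],
    setIntegral_eq_integral_of_forall_compl_eq_zero fun x hx => by rw [e1 x hx, mul_zero]]
  simp only [inner_gradient_left']
  refine integral_mul_fderiv_eq_neg_fderiv_mul_of_integrable ?_ ?_ ?_
    (fun x _ => hu.differentiable (by simp) x) (fun x _ => h1.differentiable (by simp) x)
  · exact (c2.mul h1.continuous).integrable_of_hasCompactSupport h2.mul_left
  · exact (hu.continuous.mul c1).integrable_of_hasCompactSupport hc.mul_right
  · exact (hu.continuous.mul h1.continuous).integrable_of_hasCompactSupport hc.mul_right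

/-- The elements of the graph space that come from test functions. -/
noncomputable def smoothGraph {m : ℕ} (O : Set (Eucl (m + 1))) : Submodule ℝ (GraphSpace O) where
  carrier := {x | ∃ u : Eucl (m + 1) → ℝ, ContDiff ℝ ∞ u ∧ HasCompactSupport u ∧
    valL O x =ᵐ[volume.restrict O] u ∧ gradL O x =ᵐ[volume.restrict O] gradient u ∧
    traceL O x =ᵐ[surfaceMeasure O] u}
  zero_mem' := by
    refine ⟨fun _ => 0, contDiff_const, HasCompactSupport.zero, ?_, ?_, ?_⟩
    · rw [map_zero]; exact Lp.coeFn_zero _ _ _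
    · have : gradient (fun _ : Eucl (m + 1) => (0 : ℝ)) = 0 := by
        ext1 x; simp [gradient]
      rw [map_zero, this]; exact Lp.coeFn_zero _ _ _
    · rw [map_zero]; exact Lp.coeFn_zero _ _ _
  add_mem' := by
    rintro x y ⟨u, hu, uc, u1, u2, u3⟩ ⟨w, hw, wc, w1, w2, w3⟩
    refine ⟨fun x => u x + w x, hu.add hw, uc.add wc, ?_, ?_, ?_⟩
    · rw [map_add]
      filter_upwards [Lp.coeFn_add (valL O x) (valL O y), u1, w1] with z h h1 h2
      rw [h, Pi.add_apply, h1, h2]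
    · rw [map_add]
      filter_upwards [Lp.coeFn_add (gradL O x) (gradL O y), u2, w2] with z h h1 h2
      rw [h, Pi.add_apply, h1, h2, gradient_fun_add hu hw]
    · rw [map_add]
      filter_upwards [Lp.coeFn_add (traceL O x) (traceL O y), u3, w3] with z h h1 h2
      rw [h, Pi.add_apply, h1, h2]
  smul_mem' := by
    rintro a x ⟨u, hu, uc, u1, u2, u3⟩
    refine ⟨fun x => a * u x, contDiff_const.mul hu, uc.mul_left, ?_, ?_, ?_⟩
    · rw [map_smul]
      filter_upwards [Lp.coeFn_smul a (valL O x), u1] with z h h1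
      rw [h, Pi.smul_apply, h1, smul_eq_mul]
    · rw [map_smul]
      filter_upwards [Lp.coeFn_smul a (gradL O x), u2] with z h h1
      rw [h, Pi.smul_apply, h1, gradient_fun_const_mul hu]
    · rw [map_smul]
      filter_upwards [Lp.coeFn_smul a (traceL O x), u3] with z h h1
      rw [h, Pi.smul_apply, h1, smul_eq_mul]

lemma Lp.tendsto_eLpNorm_of_tendsto {α F : Type*} [MeasurableSpace α] {μ : Measure α}
    [NormedAddCommGroup F] {x : ℕ → Lp F 2 μ} {y : Lp F 2 μ} (h : Tendsto x atTop (𝓝 y))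
    {w : ℕ → α → F} {z : α → F} (hw : ∀ j, x j =ᵐ[μ] w j) (hz : y =ᵐ[μ] z) :
    Tendsto (fun j => eLpNorm (fun a => w j a - z a) 2 μ) atTop (𝓝 0) := by
  refine ((Lp.tendsto_Lp_iff_tendsto_eLpNorm' x y).1 h).congr fun j => eLpNorm_congr_ae ?_
  filter_upwards [hw j, hz] with a h1 h2
  rw [Pi.sub_apply, h1, h2]

/-- Weak gradients survive `L²` limits, and a sequence of test functions converging in the graph
space is exactly a sequence as in `IsTrace`. The fourth component is unconstrained in `smoothGraph`,
so in the converse direction it is kept fixed. -/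
lemma mem_closure_smoothGraph_iff {m : ℕ} {O : Set (Eucl (m + 1))} (hO : IsLipschitzDomain O)
    (x : GraphSpace O) : x ∈ (smoothGraph O).topologicalClosure ↔
      HasWeakGradient O (valL O x) (gradL O x) ∧ IsTrace O (valL O x) (traceL O x) := by
  constructor
  · intro hx
    obtain ⟨y, hy, hyx⟩ := mem_closure_iff_seq_limit.1 hx
    choose u hu uc u1 u2 u3 using hy
    have t1 := Lp.tendsto_eLpNorm_of_tendsto (((valL O).continuous.tendsto x).comp hyx) u1
      (EventuallyEq.refl _ _)
    have t2 := ((gradL O).continuous.tendsto x).comp hyx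
    have t3 := Lp.tendsto_eLpNorm_of_tendsto (((traceL O).continuous.tendsto x).comp hyx) u3
      (EventuallyEq.refl _ _)
    have hG : HasWeakGradient O (valL O x) (gradL O x) :=
      HasWeakGradient.of_tendsto (fun j => hasWeakGradient_gradient (hu j) (uc j))
        (fun j => memLp_contDiff (hu j) (uc j) 2) (fun j => memLp_gradient (hu j) (uc j) 2)
        (Lp.memLp _) (Lp.memLp _) t1
        (Lp.tendsto_eLpNorm_of_tendsto t2 u2 (EventuallyEq.refl _ _))
    exact ⟨hG, Lp.memLp _, u, fun j => ⟨hu j, uc j⟩, t1,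
      Lp.tendsto_eLpNorm_of_tendsto t2 u2 (weakGradient_ae_eq hO.1 hG).symm, t3⟩
  · rintro ⟨hG, -, u, hu, t1, t2, t3⟩
    have m1 := fun j => memLp_contDiff (V := O) (hu j).1 (hu j).2 2
    have m2 := fun j => memLp_gradient (V := O) (hu j).1 (hu j).2 2
    have m3 := fun j => hO.memLp_surface (hu j).1 (hu j).2
    refine mem_closure_iff_seq_limit.2 ⟨fun j => GraphSpace.mk (m1 j).toLp (m2 j).toLp
      (m3 j).toLp (tanL O x), fun j => ⟨u j, (hu j).1, (hu j).2, (m1 j).coeFn_toLp,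
        (m2 j).coeFn_toLp, (m3 j).coeFn_toLp⟩, tendsto_of_components ?_ ?_ ?_ ?_⟩
    · refine (Lp.tendsto_Lp_iff_tendsto_eLpNorm' _ _).2 (t1.congr fun j => eLpNorm_congr_ae ?_)
      filter_upwards [(m1 j).coeFn_toLp] with a h
      rw [valL_mk, Pi.sub_apply, h]
    · refine (Lp.tendsto_Lp_iff_tendsto_eLpNorm' _ _).2 (t2.congr fun j => eLpNorm_congr_ae ?_)
      filter_upwards [(m2 j).coeFn_toLp, weakGradient_ae_eq hO.1 hG] with a h h'
      rw [gradL_mk, Pi.sub_apply, h, h']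
    · refine (Lp.tendsto_Lp_iff_tendsto_eLpNorm' _ _).2 (t3.congr fun j => eLpNorm_congr_ae ?_)
      filter_upwards [(m3 j).coeFn_toLp] with a h
      rw [traceL_mk, Pi.sub_apply, h]
    · simp only [tanL_mk]
      exact tendsto_const_nhds

/-- The trace inequality is a closed condition on the components, so it extends from test functions
to the closure. -/
lemma IsLipschitzDomain.exists_norm_traceL_le {m : ℕ} {O : Set (Eucl (m + 1))}
    (hO : IsLipschitzDomain O) : ∃ K : ℝ, 0 ≤ K ∧ ∀ x ∈ (smoothGraph O).topologicalClosure,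
      ‖traceL O x‖ ≤ K * (‖valL O x‖ + ‖gradL O x‖) := by
  obtain ⟨K, hK⟩ := hO.exists_trace_bound
  refine ⟨K, K.2, fun x hx => ?_⟩
  have hcl : IsClosed {x : GraphSpace O | ‖traceL O x‖ ≤ K * (‖valL O x‖ + ‖gradL O x‖)} :=
    isClosed_le (by fun_prop) (by fun_prop)
  refine closure_minimal ?_ hcl hx
  rintro y ⟨u, hu, uc, u1, u2, u3⟩
  have h := hK u hu
  rw [← eLpNorm_congr_ae u1, ← eLpNorm_congr_ae u2, ← eLpNorm_congr_ae u3] at h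
  rw [mem_ofPred_eq, Lp.norm_def, Lp.norm_def, Lp.norm_def,
    ← ENNReal.toReal_add (Lp.eLpNorm_ne_top _) (Lp.eLpNorm_ne_top _), ← ENNReal.coe_toReal,
    ← ENNReal.toReal_mul]
  exact ENNReal.toReal_mono (ENNReal.mul_ne_top ENNReal.coe_ne_top
    (ENNReal.add_ne_top.2 ⟨Lp.eLpNorm_ne_top _, Lp.eLpNorm_ne_top _⟩)) h

attribute [irreducible] GraphSpace.valL GraphSpace.gradL GraphSpace.traceL GraphSpace.tanL

open GraphSpace

/-! ### Bounded bilinear forms on `L²` given by bounded weights and fields -/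

section LpForms

variable {α : Type*} [MeasurableSpace α] {μ : Measure α} {E : Type*} [NormedAddCommGroup E]
  [InnerProductSpace ℝ E]

/-- The bilinear form `(u, v) ↦ ∫ k ⟪u, v⟫` on `L²`, for a bounded weight `k`. -/
noncomputable def weightForm {k : α → ℝ} (hk : MemLp k ⊤ μ) : Lp E 2 μ →L[ℝ] Lp E 2 μ →L[ℝ] ℝ :=
  (innerSL ℝ).comp ((ContinuousLinearMap.lsmul ℝ ℝ).holderL μ ⊤ 2 2 hk.toLp)

lemma weightForm_ae {k : α → ℝ} (hk : MemLp k ⊤ μ) (u v : Lp E 2 μ) :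
    (fun x => inner ℝ ((ContinuousLinearMap.lsmul ℝ ℝ).holder 2 hk.toLp u x) (v x))
      =ᵐ[μ] fun x => k x * inner ℝ (u x) (v x) := by
  filter_upwards [(ContinuousLinearMap.lsmul ℝ ℝ).coeFn_holder (r := 2) hk.toLp u,
    hk.coeFn_toLp] with x h1 h2
  rw [h1, h2, ContinuousLinearMap.lsmul_apply, real_inner_smul_left]

lemma weightForm_apply {k : α → ℝ} (hk : MemLp k ⊤ μ) (u v : Lp E 2 μ) :
    weightForm hk u v = ∫ x, k x * inner ℝ (u x) (v x) ∂μ :=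
  integral_congr_ae (weightForm_ae hk u v)

lemma integrable_weightForm {k : α → ℝ} (hk : MemLp k ⊤ μ) (u v : Lp E 2 μ) :
    Integrable (fun x => k x * inner ℝ (u x) (v x)) μ :=
  (L2.integrable_inner (𝕜 := ℝ) _ v).congr (weightForm_ae hk u v)

lemma weightForm_symm {k : α → ℝ} (hk : MemLp k ⊤ μ) (u v : Lp E 2 μ) :
    weightForm hk u v = weightForm hk v u := by
  simp only [weightForm_apply, real_inner_comm]

lemma le_weightForm {k : α → ℝ} (hk : MemLp k ⊤ μ) {c : ℝ} (hc : ∀ᵐ x ∂μ, c ≤ k x)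
    (u : Lp E 2 μ) : c * ‖u‖ ^ 2 ≤ weightForm hk u u := by
  rw [← real_inner_self_eq_norm_sq, L2.inner_def, ← integral_const_mul, weightForm_apply]
  refine integral_mono_ae ((L2.integrable_inner u u).const_mul c) (integrable_weightForm hk u u) ?_
  filter_upwards [hc] with x hx
  exact mul_le_mul_of_nonneg_right hx real_inner_self_nonneg

/-- The bilinear form `(u, v) ↦ ∫ ⟪b, u⟫ v` on `L²`, for a bounded vector field `b`. -/
noncomputable def fieldForm {b : α → E} (hb : MemLp b ⊤ μ) :
    Lp E 2 μ →L[ℝ] Lp ℝ 2 μ →L[ℝ] ℝ :=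
  (innerSL ℝ).comp ((innerSL ℝ).holderL μ ⊤ 2 2 hb.toLp)

lemma fieldForm_ae {b : α → E} (hb : MemLp b ⊤ μ) (u : Lp E 2 μ) (v : Lp ℝ 2 μ) :
    (fun x => inner ℝ ((innerSL ℝ).holder 2 hb.toLp u x) (v x))
      =ᵐ[μ] fun x => inner ℝ (b x) (u x) * v x := by
  filter_upwards [(innerSL ℝ).coeFn_holder (r := 2) hb.toLp u, hb.coeFn_toLp] with x h1 h2
  rw [h1, h2, innerSL_apply_apply, RCLike.inner_apply, mul_comm]
  rfl

lemma fieldForm_apply {b : α → E} (hb : MemLp b ⊤ μ) (u : Lp E 2 μ) (v : Lp ℝ 2 μ) :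
    fieldForm hb u v = ∫ x, inner ℝ (b x) (u x) * v x ∂μ :=
  integral_congr_ae (fieldForm_ae hb u v)

lemma integrable_fieldForm {b : α → E} (hb : MemLp b ⊤ μ) (u : Lp E 2 μ) (v : Lp ℝ 2 μ) :
    Integrable (fun x => inner ℝ (b x) (u x) * v x) μ :=
  (L2.integrable_inner (𝕜 := ℝ) _ v).congr (fieldForm_ae hb u v)

end LpForms

/-! ### Boundedness of the coefficients -/

section Bounded

variable {m : ℕ} {O : Set (Eucl (m + 1))} {C : Coefficients m}

lemma Coefficients.Regular.memLp_b (hC : C.Regular O) : MemLp C.b ⊤ (volume.restrict O) :=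
  memLp_piLp_iff.2 fun i => (hC.b_W1 i).1

lemma Coefficients.Regular.memLp_r (hC : C.Regular O) : MemLp C.r ⊤ (surfaceMeasure O) :=
  memLp_piLp_iff.2 fun i => (hC.r_W1 i).1

/-- A Lebesgue almost everywhere bound in `O` says nothing on `Γ` by itself. By continuity the set
in `O` where it fails is open, and being null it is empty; continuity up to the boundary then
carries the bound to the closure. -/
lemma Coefficients.Regular.memLp_inner_normal (hO : IsLipschitzDomain O) (hC : C.Regular O) :
    MemLp (fun x => inner ℝ (C.b x) (outerNormal O x)) ⊤ (surfaceMeasure O) := by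
  obtain ⟨c, hc0, hc⟩ := exists_ae_norm_le_of_memLp_top hC.memLp_b
  have hbd : MapsTo C.b O (Metric.closedBall 0 c) := by
    have hop : IsOpen (O ∩ C.b ⁻¹' (Metric.closedBall 0 c)ᶜ) :=
      (hC.b_cont.mono subset_closure).isOpen_inter_preimage hO.1
        Metric.isClosed_closedBall.isOpen_compl
    have h0 : volume (O ∩ C.b ⁻¹' (Metric.closedBall 0 c)ᶜ) = 0 := by
      rw [ae_restrict_iff' hO.1.measurableSet] at hc
      refine measure_mono_null ?_ (ae_iff.1 hc)
      rintro x ⟨hx, hx'⟩ h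
      exact hx' (by simpa using h hx)
    have he := (hop.measure_eq_zero_iff volume).1 h0
    intro x hx
    by_contra hcon
    exact (he ▸ (⟨hx, hcon⟩ : x ∈ O ∩ C.b ⁻¹' (Metric.closedBall 0 c)ᶜ) : x ∈ (∅ : Set _))
  have hcl := hbd.closure_of_continuousOn hC.b_cont
  rw [Metric.isClosed_closedBall.closure_eq] at hcl
  refine memLp_top_of_bound (C := c) ?_ ?_
  · have : AEStronglyMeasurable C.b (surfaceMeasure O) :=
      (hC.b_cont.mono frontier_subset_closure).aestronglyMeasurable isClosed_frontier.measurableSet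
    exact this.inner hO.aestronglyMeasurable_outerNormal
  · rw [surfaceMeasure]
    refine (ae_restrict_iff' isClosed_frontier.measurableSet).2
      (Eventually.of_forall fun x hx => ?_)
    refine (norm_inner_le_norm _ _).trans ?_
    have h1 : ‖C.b x‖ ≤ c := by simpa using hcl (frontier_subset_closure hx)
    calc ‖C.b x‖ * ‖outerNormal O x‖ ≤ c * 1 := by
          gcongr
          exact norm_outerNormal_le O x
      _ = c := mul_one c

lemma Coefficients.Regular.memLp_reaction (hO : IsLipschitzDomain O) (hC : C.Regular O) :
    MemLp (fun x => C.c x + 1 / 2 * weakDiv O C.b x) ⊤ (volume.restrict O) :=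
  hC.c_bdd.add ((memLp_top_weakDiv hO.1 hC.b_W1).const_mul _)

lemma Coefficients.Regular.memLp_mul_q_s (hC : C.Regular O) :
    MemLp (fun x => C.q x * C.s x) ⊤ (surfaceMeasure O) :=
  hC.s_bdd.mul hC.q_bdd

lemma Coefficients.Regular.memLp_boundaryWeight (hO : IsLipschitzDomain O) (hC : C.Regular O) :
    MemLp (C.boundaryWeight O) ⊤ (surfaceMeasure O) := by
  have h := (hC.p_bdd.sub ((hC.memLp_inner_normal hO).const_mul 2⁻¹)).add
    ((memLp_top_surfaceDiv hO hC.r_W1).mul (hC.q_bdd.const_mul 2⁻¹) (r := ⊤))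
  refine h.ae_eq (Eventually.of_forall fun x => ?_)
  simp only [Pi.add_apply, Pi.sub_apply, Pi.mul_apply, Coefficients.boundaryWeight]
  ring

lemma Coefficients.Regular.memLp_drift (hC : C.Regular O) :
    MemLp (fun x => (C.q x / 2) • C.r x) ⊤ (surfaceMeasure O) := by
  have h : MemLp (fun x => C.q x / 2) ⊤ (surfaceMeasure O) := by
    simpa [div_eq_inv_mul] using hC.q_bdd.const_mul 2⁻¹
  exact hC.memLp_r.smul h (r := ⊤)

end Bounded

open GraphSpace

lemma real_inner_eq_mul (a b : ℝ) : inner ℝ a b = a * b := by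
  rw [RCLike.inner_apply, mul_comm]
  rfl

/-! ### The trial space as a closed subspace, and coercivity -/

section EnergySpace

variable {m : ℕ} {O : Set (Eucl (m + 1))} {C : Coefficients m}

/-- The elements of the graph space whose last component is the tangential gradient of the trace
component. -/
noncomputable def tangentialGraph (O : Set (Eucl (m + 1))) : Submodule ℝ (GraphSpace O) where
  carrier := {x | HasTangentialGradient O (traceL O x) (tanL O x)}
  zero_mem' := by
    rw [mem_ofPred_eq, map_zero, map_zero]
    exact (HasTangentialGradient.zero O).congr (Lp.coeFn_zero _ _ _).symm
      (Lp.coeFn_zero _ _ _).symm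
  add_mem' := by
    intro x y hx hy
    rw [mem_ofPred_eq, map_add, map_add]
    exact (HasTangentialGradient.add hx hy).congr (Lp.coeFn_add _ _).symm (Lp.coeFn_add _ _).symm
  smul_mem' := by
    intro a x hx
    rw [mem_ofPred_eq, map_smul, map_smul]
    exact (HasTangentialGradient.const_mul hx a).congr (Lp.coeFn_smul a (traceL O x)).symm
      (Lp.coeFn_smul a (tanL O x)).symm

lemma isClosed_tangentialGraph : IsClosed (tangentialGraph O : Set (GraphSpace O)) := by
  refine isClosed_of_closure_subset fun x hx => ?_
  obtain ⟨y, hy, hyx⟩ := mem_closure_iff_seq_limit.1 hx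
  exact HasTangentialGradient.of_tendsto hy (fun j => Lp.memLp _) (fun j => Lp.memLp _)
    (Lp.memLp _) (Lp.memLp _)
    (Lp.tendsto_eLpNorm_of_tendsto (((traceL O).continuous.tendsto x).comp hyx)
      (fun _ => EventuallyEq.refl _ _) (EventuallyEq.refl _ _))
    (Lp.tendsto_eLpNorm_of_tendsto (((tanL O).continuous.tendsto x).comp hyx)
      (fun _ => EventuallyEq.refl _ _) (EventuallyEq.refl _ _))

open Classical in
/-- The space `𝓑` as a closed subspace of the graph space. -/
noncomputable def energySpace (C : Coefficients m) (O : Set (Eucl (m + 1))) :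
    Submodule ℝ (GraphSpace O) :=
  (smoothGraph O).topologicalClosure ⊓
    if C.q =ᵐ[surfaceMeasure O] 0 then (tanL O).ker else tangentialGraph O

lemma isClosed_energySpace : IsClosed (energySpace C O : Set (GraphSpace O)) := by
  rw [energySpace, Submodule.coe_inf]
  refine (Submodule.isClosed_topologicalClosure _).inter ?_
  split_ifs
  · exact (tanL O).isClosed_ker
  · exact isClosed_tangentialGraph

/-- In the Robin case the trace need not have a tangential gradient, so the last component is set to
zero; otherwise it is the tangential gradient of the trace. -/
lemma mem_energySpace_iff (hO : IsLipschitzDomain O) {x : GraphSpace O} :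
    x ∈ energySpace C O ↔ HasWeakGradient O (valL O x) (gradL O x) ∧
      IsTrace O (valL O x) (traceL O x) ∧ (C.q =ᵐ[surfaceMeasure O] 0 → tanL O x = 0) ∧
      (¬ C.q =ᵐ[surfaceMeasure O] 0 → HasTangentialGradient O (traceL O x) (tanL O x)) := by
  rw [energySpace, Submodule.mem_inf, mem_closure_smoothGraph_iff hO, and_assoc]
  split_ifs with h
  · simp [h]
  · simp only [h, false_imp_iff, true_and, not_false_eq_true, true_imp_iff]
    rfl

lemma weakGradient_valL (hO : IsLipschitzDomain O) {x : GraphSpace O} (hx : x ∈ energySpace C O) :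
    weakGradient O (valL O x) =ᵐ[volume.restrict O] gradL O x :=
  weakGradient_ae_eq hO.1 ((mem_energySpace_iff hO).1 hx).1

lemma trace_valL (hO : IsLipschitzDomain O) {x : GraphSpace O} (hx : x ∈ energySpace C O) :
    trace O (valL O x) =ᵐ[surfaceMeasure O] traceL O x :=
  trace_ae_eq hO ((mem_energySpace_iff hO).1 hx).1 (Lp.aestronglyMeasurable _)
    (Lp.aestronglyMeasurable _) ((mem_energySpace_iff hO).1 hx).2.1

lemma hasTangentialGradient_trace_valL (hO : IsLipschitzDomain O) {x : GraphSpace O}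
    (hx : x ∈ energySpace C O) (hq : ¬ C.q =ᵐ[surfaceMeasure O] 0) :
    HasTangentialGradient O (trace O (valL O x)) (tanL O x) :=
  (((mem_energySpace_iff hO).1 hx).2.2.2 hq).congr (trace_valL hO hx).symm (EventuallyEq.refl _ _)

/-- The inclusion of the trial space in the image needs the existence of traces in `H¹`, hence the
density of test functions. The other inclusion needs that the chosen trace agrees with the trace
component. -/
lemma valL_image_energySpace (hO : IsLipschitzDomain O) :
    valL O '' (energySpace C O : Set (GraphSpace O)) = trialSpace C O := by
  refine Subset.antisymm ?_ fun v hv => ?_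
  · rintro _ ⟨x, hx, rfl⟩
    have h1 : valL O x ∈ H1 O :=
      ⟨Lp.memLp _, gradL O x, Lp.memLp _, ((mem_energySpace_iff hO).1 hx).1⟩
    rw [trialSpace]
    split_ifs with hq
    · exact h1
    · exact ⟨h1, (Lp.memLp (traceL O x)).ae_eq (trace_valL hO hx).symm, tanL O x, Lp.memLp _,
        hasTangentialGradient_trace_valL hO hx hq⟩
  · have hv1 : v ∈ H1 O := by
      rw [trialSpace] at hv
      split_ifs at hv
      · exact hv
      · exact hv.1
    obtain ⟨mv, G, mG, hG⟩ := hv1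
    obtain ⟨τ, hτ⟩ := hO.exists_isTrace hG mv mG
    have hG' : HasWeakGradient O v mG.toLp := hG.congr (EventuallyEq.refl _ _) mG.coeFn_toLp.symm
    have hτ' : IsTrace O v hτ.1.toLp := by
      obtain ⟨mτ, u, hu, u1, u2, u3⟩ := id hτ
      refine ⟨Lp.memLp _, u, hu, u1, u2, u3.congr fun j => eLpNorm_congr_ae ?_⟩
      filter_upwards [hτ.1.coeFn_toLp] with x hx
      rw [hx]
    by_cases hq : C.q =ᵐ[surfaceMeasure O] 0
    · exact ⟨GraphSpace.mk v mG.toLp hτ.1.toLp 0,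
        (mem_energySpace_iff hO).2 ⟨by rwa [valL_mk, gradL_mk],
          by rwa [valL_mk, traceL_mk], fun _ => tanL_mk _ _ _ _, fun h => absurd hq h⟩,
        valL_mk _ _ _ _⟩
    · rw [trialSpace, if_neg hq] at hv
      obtain ⟨-, -, H, mH, hH⟩ := hv
      refine ⟨GraphSpace.mk v mG.toLp hτ.1.toLp mH.toLp, (mem_energySpace_iff hO).2
        ⟨by rwa [valL_mk, gradL_mk], by rwa [valL_mk, traceL_mk], fun h => absurd h hq,
          fun _ => ?_⟩, valL_mk _ _ _ _⟩
      rw [traceL_mk, tanL_mk]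
      refine hH.congr ?_ mH.coeFn_toLp.symm
      exact trace_ae_eq hO hG' mv.aestronglyMeasurable (Lp.aestronglyMeasurable _) hτ'

/-- The bilinear form `m` on the graph space. -/
noncomputable def graphMassForm (hC : C.Regular O) :
    GraphSpace O →L[ℝ] GraphSpace O →L[ℝ] ℝ :=
  (weightForm (memLp_top_const (1 : ℝ))).bilinearComp (valL O) (valL O)
    + (weightForm hC.q_bdd).bilinearComp (traceL O) (traceL O)

/-- The bilinear form `a` on the graph space. -/
noncomputable def graphEnergyForm (hO : IsLipschitzDomain O) (hC : C.Regular O) :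
    GraphSpace O →L[ℝ] GraphSpace O →L[ℝ] ℝ :=
  (1 / 2 : ℝ) • ((fieldForm hC.memLp_b).bilinearComp (gradL O) (valL O)
      - ((fieldForm hC.memLp_b).bilinearComp (gradL O) (valL O)).flip)
    + (weightForm hC.ν_bdd).bilinearComp (gradL O) (gradL O)
    + (weightForm (hC.memLp_reaction hO)).bilinearComp (valL O) (valL O)
    + ((weightForm (hC.memLp_boundaryWeight hO)).bilinearComp (traceL O) (traceL O)
      + ((fieldForm hC.memLp_drift).bilinearComp (tanL O) (traceL O)
        - ((fieldForm hC.memLp_drift).bilinearComp (tanL O) (traceL O)).flip)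
      + (weightForm hC.memLp_mul_q_s).bilinearComp (tanL O) (tanL O))

lemma graphMassForm_apply (hC : C.Regular O) (x y : GraphSpace O) :
    graphMassForm hC x y = weightForm (memLp_top_const (1 : ℝ)) (valL O x) (valL O y)
      + weightForm hC.q_bdd (traceL O x) (traceL O y) := rfl

lemma graphEnergyForm_apply (hO : IsLipschitzDomain O) (hC : C.Regular O) (x y : GraphSpace O) :
    graphEnergyForm hO hC x y =
      1 / 2 * (fieldForm hC.memLp_b (gradL O x) (valL O y)
        - fieldForm hC.memLp_b (gradL O y) (valL O x))
      + weightForm hC.ν_bdd (gradL O x) (gradL O y)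
      + weightForm (hC.memLp_reaction hO) (valL O x) (valL O y)
      + (weightForm (hC.memLp_boundaryWeight hO) (traceL O x) (traceL O y)
        + (fieldForm hC.memLp_drift (tanL O x) (traceL O y)
          - fieldForm hC.memLp_drift (tanL O y) (traceL O x))
        + weightForm hC.memLp_mul_q_s (tanL O x) (tanL O y)) := rfl

lemma massForm_valL (hO : IsLipschitzDomain O) (hC : C.Regular O) {x y : GraphSpace O}
    (hx : x ∈ energySpace C O) (hy : y ∈ energySpace C O) :
    massForm C O (valL O x) (valL O y) = graphMassForm hC x y := by
  rw [massForm, graphMassForm_apply, weightForm_apply, weightForm_apply]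
  congr 1
  · exact integral_congr_ae (Eventually.of_forall fun z => by
      simp only [one_mul, real_inner_eq_mul])
  · refine integral_congr_ae ?_
    filter_upwards [trace_valL hO hx, trace_valL hO hy] with z h1 h2
    rw [h1, h2, real_inner_eq_mul, mul_assoc]

/-- By the product rule `∇_Γ·(τ r) = r·H + τ ∇_Γ·r`, and the zeroth order parts cancel in the
antisymmetric difference, leaving the drift `(q/2) r`. If `q` vanishes almost everywhere, both sides
are zero whatever the default values of the chosen gradients are. -/
lemma tangential_terms_ae_eq (hO : IsLipschitzDomain O) {q s : Eucl (m + 1) → ℝ}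
    {r : Eucl (m + 1) → Eucl (m + 1)} (hr : ∀ i, MemW1Boundary O ⊤ (fun x => r x i))
    {w v τ τ' : Eucl (m + 1) → ℝ} {H H' : Eucl (m + 1) → Eucl (m + 1)}
    (hw : w =ᵐ[surfaceMeasure O] τ) (hv : v =ᵐ[surfaceMeasure O] τ')
    (mτ : MemLp τ 2 (surfaceMeasure O)) (mτ' : MemLp τ' 2 (surfaceMeasure O))
    (mH : MemLp H 2 (surfaceMeasure O)) (mH' : MemLp H' 2 (surfaceMeasure O))
    (hH : ¬ q =ᵐ[surfaceMeasure O] 0 → HasTangentialGradient O w H)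
    (hH' : ¬ q =ᵐ[surfaceMeasure O] 0 → HasTangentialGradient O v H') :
    ∀ᵐ z ∂(surfaceMeasure O),
      q z / 2 * (surfaceDiv O (fun y => w y • r y) z * v z
          - surfaceDiv O (fun y => v y • r y) z * w z)
      + q z * s z * inner ℝ (tangentialGradient O w z) (tangentialGradient O v z)
      = (inner ℝ ((q z / 2) • r z) (H z) * τ' z - inner ℝ ((q z / 2) • r z) (H' z) * τ z)
        + q z * s z * inner ℝ (H z) (H' z) := by
  by_cases hq : q =ᵐ[surfaceMeasure O] 0
  · filter_upwards [hq] with z hz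
    simp [hz]
  · filter_upwards [hw, hv, tangentialGradient_ae_eq hO (hH hq),
      tangentialGradient_ae_eq hO (hH' hq),
      surfaceDiv_smul_ae_eq hO (hH hq) (mτ.ae_eq hw.symm) mH hr,
      surfaceDiv_smul_ae_eq hO (hH' hq) (mτ'.ae_eq hv.symm) mH' hr] with z h1 h2 h3 h4 h5 h6
    rw [h3, h4, h5, h6, h1, h2, real_inner_smul_left, real_inner_smul_left]
    ring

/-- Chosen gradients and traces are exchanged for genuine `L²` elements. With these each boundary
term is integrable by itself, so that the single boundary integral may be split. -/
lemma energyForm_eq (hO : IsLipschitzDomain O) (hC : C.Regular O) {w v : L2 O}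
    {G G' : Lp (Eucl (m + 1)) 2 (volume.restrict O)} {τ τ' : L2Boundary O}
    {H H' : Lp (Eucl (m + 1)) 2 (surfaceMeasure O)}
    (gx : weakGradient O w =ᵐ[volume.restrict O] G) (gy : weakGradient O v =ᵐ[volume.restrict O] G')
    (tx : trace O w =ᵐ[surfaceMeasure O] τ) (ty : trace O v =ᵐ[surfaceMeasure O] τ')
    (hx : ¬ C.q =ᵐ[surfaceMeasure O] 0 → HasTangentialGradient O (trace O w) H)
    (hy : ¬ C.q =ᵐ[surfaceMeasure O] 0 → HasTangentialGradient O (trace O v) H') :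
    energyForm C O w v =
      1 / 2 * (fieldForm hC.memLp_b G v - fieldForm hC.memLp_b G' w)
      + weightForm hC.ν_bdd G G' + weightForm (hC.memLp_reaction hO) w v
      + (weightForm (hC.memLp_boundaryWeight hO) τ τ'
        + (fieldForm hC.memLp_drift H τ' - fieldForm hC.memLp_drift H' τ)
        + weightForm hC.memLp_mul_q_s H H') := by
  have hbd := tangential_terms_ae_eq (s := C.s) hO hC.r_W1 tx ty (Lp.memLp _) (Lp.memLp _)
    (Lp.memLp _) (Lp.memLp _) hx hy
  rw [energyForm]
  simp only [weightForm_apply, fieldForm_apply]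
  refine congrArg₂ (· + ·) (congrArg₂ (· + ·) (congrArg₂ (· + ·) ?_ ?_) ?_) ?_
  · rw [← integral_sub (integrable_fieldForm hC.memLp_b _ _)
      (integrable_fieldForm hC.memLp_b _ _), ← integral_const_mul]
    refine integral_congr_ae ?_
    filter_upwards [gx, gy] with z h1 h2
    rw [h1, h2]
  · refine integral_congr_ae ?_
    filter_upwards [gx, gy] with z h1 h2
    rw [h1, h2]
  · exact integral_congr_ae (Eventually.of_forall fun z => by
      simp only [real_inner_eq_mul])
  · have i1 := integrable_weightForm (hC.memLp_boundaryWeight hO) τ τ'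
    have i2 : Integrable (fun z => inner ℝ ((C.q z / 2) • C.r z) (H z) * τ' z
        - inner ℝ ((C.q z / 2) • C.r z) (H' z) * τ z) (surfaceMeasure O) :=
      (integrable_fieldForm hC.memLp_drift H τ').sub (integrable_fieldForm hC.memLp_drift H' τ)
    have i3 : Integrable (fun z => C.boundaryWeight O z * inner ℝ (τ z) (τ' z)
        + (inner ℝ ((C.q z / 2) • C.r z) (H z) * τ' z
          - inner ℝ ((C.q z / 2) • C.r z) (H' z) * τ z)) (surfaceMeasure O) := i1.add i2
    rw [← integral_sub (integrable_fieldForm hC.memLp_drift H τ')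
      (integrable_fieldForm hC.memLp_drift H' τ), ← integral_add i1 i2,
      ← integral_add i3 (integrable_weightForm hC.memLp_mul_q_s H H')]
    refine integral_congr_ae ?_
    filter_upwards [hbd, tx, ty] with z h h1 h2
    rw [add_assoc, h, h1, h2, real_inner_eq_mul, ← add_assoc]

lemma energyForm_valL (hO : IsLipschitzDomain O) (hC : C.Regular O) {x y : GraphSpace O}
    (hx : x ∈ energySpace C O) (hy : y ∈ energySpace C O) :
    energyForm C O (valL O x) (valL O y) = graphEnergyForm hO hC x y :=
  (energyForm_eq hO hC (weakGradient_valL hO hx) (weakGradient_valL hO hy) (trace_valL hO hx)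
    (trace_valL hO hy) (hasTangentialGradient_trace_valL hO hx)
    (hasTangentialGradient_trace_valL hO hy)).trans (graphEnergyForm_apply hO hC x y).symm

lemma graphMassForm_symm (hC : C.Regular O) (x y : GraphSpace O) :
    graphMassForm hC x y = graphMassForm hC y x := by
  rw [graphMassForm_apply, graphMassForm_apply, weightForm_symm _ (valL O x),
    weightForm_symm _ (traceL O x)]

lemma graphMassForm_nonneg (hC : C.Regular O) (hq : ∀ᵐ x ∂(surfaceMeasure O), 0 ≤ C.q x)
    (x : GraphSpace O) : 0 ≤ graphMassForm hC x x := by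
  have h1 := le_weightForm hC.q_bdd hq (traceL O x)
  have h2 := le_weightForm (memLp_top_const (1 : ℝ))
    (Eventually.of_forall fun _ => zero_le_one) (valL O x)
  rw [zero_mul] at h1 h2
  rw [graphMassForm_apply]
  exact add_nonneg h2 h1

/-- The trace bound gives `τ² ≤ 2 K² (V² + G²)`, so the full squared norm is at most `1 + 2 K²`
times `V² + G² + H²`. Of the boundary term `A₃` only the sign is used. -/
lemma coercivity_estimate {δ ν₀ α₀ β K V G τ H A₁ A₂ A₃ A₄ : ℝ} (hδ : 0 ≤ δ) (d1 : δ ≤ ν₀)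
    (d2 : δ ≤ α₀) (d3 : δ ≤ β) (hτ0 : 0 ≤ τ) (hτ : τ ≤ K * (V + G)) (e1 : ν₀ * G ^ 2 ≤ A₁)
    (e2 : α₀ * V ^ 2 ≤ A₂) (e3 : 0 ≤ A₃) (e4 : β * H ^ 2 ≤ A₄) :
    δ / (1 + 2 * K ^ 2) * (V ^ 2 + G ^ 2 + (τ ^ 2 + H ^ 2)) ≤ A₁ + A₂ + (A₃ + A₄) := by
  have hτ2 : τ ^ 2 ≤ 2 * K ^ 2 * (V ^ 2 + G ^ 2) := by
    refine (pow_le_pow_left₀ hτ0 hτ 2).trans ?_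
    nlinarith [mul_nonneg (sq_nonneg K) (sq_nonneg (V - G))]
  have f1 := mul_le_mul_of_nonneg_right d1 (sq_nonneg G)
  have f2 := mul_le_mul_of_nonneg_right d2 (sq_nonneg V)
  have f3 := mul_le_mul_of_nonneg_right d3 (sq_nonneg H)
  have f4 : V ^ 2 + G ^ 2 + (τ ^ 2 + H ^ 2) ≤ (1 + 2 * K ^ 2) * (V ^ 2 + G ^ 2 + H ^ 2) := by
    nlinarith [mul_nonneg (sq_nonneg K) (sq_nonneg H)]
  have hD : 0 < 1 + 2 * K ^ 2 := by positivity
  calc δ / (1 + 2 * K ^ 2) * (V ^ 2 + G ^ 2 + (τ ^ 2 + H ^ 2))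
      ≤ δ / (1 + 2 * K ^ 2) * ((1 + 2 * K ^ 2) * (V ^ 2 + G ^ 2 + H ^ 2)) := by gcongr
    _ = δ * (V ^ 2 + G ^ 2 + H ^ 2) := by field_simp
    _ ≤ A₁ + A₂ + (A₃ + A₄) := by linarith

/-- The advection and drift parts are antisymmetric and vanish on the diagonal; the remaining
weighted squares are bounded below termwise, with the trace recovered from the trace inequality. -/
lemma graphEnergyForm_coercive (hO : IsLipschitzDomain O) (hC : C.Regular O)
    (hν : ∃ ν₀ > 0, ∀ᵐ x ∂(volume.restrict O), ν₀ ≤ C.ν x)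
    (hc : ∃ α₀ > 0, ∀ᵐ x ∂(volume.restrict O), α₀ ≤ C.c x + 1 / 2 * weakDiv O C.b x)
    (hp : ∀ᵐ x ∂(surfaceMeasure O), 0 ≤ C.boundaryWeight O x)
    (hqs : C.q =ᵐ[surfaceMeasure O] 0 ∨
      ((∃ q₀ > 0, ∀ᵐ x ∂(surfaceMeasure O), q₀ ≤ C.q x) ∧
        ∃ s₀ > 0, ∀ᵐ x ∂(surfaceMeasure O), s₀ ≤ C.s x)) :
    ∃ κ > 0, ∀ x ∈ energySpace C O, κ * ‖x‖ ^ 2 ≤ graphEnergyForm hO hC x x := by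
  obtain ⟨ν₀, hν0, hν⟩ := hν
  obtain ⟨α₀, hα0, hα⟩ := hc
  obtain ⟨K, hK0, hK⟩ := hO.exists_norm_traceL_le
  have hH : ∃ β > 0, ∀ x ∈ energySpace C O,
      β * ‖tanL O x‖ ^ 2 ≤ weightForm hC.memLp_mul_q_s (tanL O x) (tanL O x) := by
    rcases hqs with hq | ⟨⟨q₀, hq0, hq⟩, s₀, hs0, hs⟩
    -- In the Robin case the tangential component is zero, so any positive constant serves.
    · refine ⟨1, one_pos, fun x hx => ?_⟩
      rw [((mem_energySpace_iff hO).1 hx).2.2.1 hq]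
      simp
    · refine ⟨q₀ * s₀, mul_pos hq0 hs0, fun x _ => le_weightForm _ ?_ _⟩
      filter_upwards [hq, hs] with z h1 h2
      exact mul_le_mul h1 h2 hs0.le (hq0.le.trans h1)
  obtain ⟨β, hβ0, hβ⟩ := hH
  let δ := min (min ν₀ α₀) β
  have hδ0 : 0 < δ := lt_min (lt_min hν0 hα0) hβ0
  have d1 : δ ≤ ν₀ := (min_le_left _ _).trans (min_le_left _ _)
  have d2 : δ ≤ α₀ := (min_le_left _ _).trans (min_le_right _ _)
  have d3 : δ ≤ β := min_le_right _ _
  have hD : 0 < 1 + 2 * K ^ 2 := by positivity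
  refine ⟨δ / (1 + 2 * K ^ 2), by positivity, fun x hx => ?_⟩
  have hex : graphEnergyForm hO hC x x = weightForm hC.ν_bdd (gradL O x) (gradL O x)
      + weightForm (hC.memLp_reaction hO) (valL O x) (valL O x)
      + (weightForm (hC.memLp_boundaryWeight hO) (traceL O x) (traceL O x)
        + weightForm hC.memLp_mul_q_s (tanL O x) (tanL O x)) := by
    have key : ∀ a b c d e f : ℝ,
        1 / 2 * (a - a) + b + c + (d + (e - e) + f) = b + c + (d + f) := by intros; ring
    exact (graphEnergyForm_apply hO hC x x).trans (key _ _ _ _ _ _)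
  have e1 := le_weightForm hC.ν_bdd hν (gradL O x)
  have e2 := le_weightForm (hC.memLp_reaction hO) hα (valL O x)
  have e3 := le_weightForm (hC.memLp_boundaryWeight hO) hp (traceL O x)
  have e4 := hβ x hx
  have hτ := hK x hx.1
  rw [norm_sq_eq, hex]
  exact coercivity_estimate hδ0.le d1 d2 d3 (norm_nonneg _) hτ e1 e2 (by simpa using e3) e4

end EnergySpace

/-! ### Time stepping over the mesh -/

section AbstractScheme

variable {S Y : Type*} [NormedAddCommGroup S] [InnerProductSpace ℝ S]
  [NormedAddCommGroup Y] [NormedSpace ℝ Y]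

lemma isPiecewisePoly_range_iff (ι : S →L[ℝ] Y) {d M : ℕ} {t : ℕ → ℝ} {V : ℝ → Y} :
    IsPiecewisePoly (range ι) d M t V ↔ ∀ n < M, ∃ c : Fin (d + 1) → S,
      ∀ τ ∈ Ioc (t n) (t (n + 1)), V τ = ι (polyCurve c τ) := by
  refine forall₂_congr fun n _ => ⟨?_, ?_⟩
  · rintro ⟨φ, hφ, h⟩
    choose c hc using hφ
    refine ⟨fun i => c i, fun τ hτ => ?_⟩
    rw [h τ hτ, Finset.sum_range, polyCurve, map_sum]
    simp [hc]
  · rintro ⟨c, hc⟩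
    -- Coefficients beyond degree `d` play no role, but must lie in the range; zero is a legitimate
    -- choice.
    refine ⟨fun i => ι (if h : i < d + 1 then c ⟨i, h⟩ else 0), fun i => mem_range_self _,
      fun τ hτ => ?_⟩
    rw [hc τ hτ, Finset.sum_range, polyCurve, map_sum]
    exact Finset.sum_congr rfl fun i _ => by
      simp only [map_smul, dif_pos i.2, Fin.eta]

lemma rightLim_eq_polyCurve (ι : S →L[ℝ] Y) {n : ℕ} {a b : ℝ} (hab : a < b) {c : Fin n → S}
    {U : ℝ → Y} (hU : ∀ τ ∈ Ioc a b, U τ = ι (polyCurve c τ)) :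
    Function.rightLim U a = ι (polyCurve c a) := by
  refine rightLim_eq_of_tendsto ?_
  have h : Tendsto (fun τ => ι (polyCurve c τ)) (𝓝[>] a) (𝓝 (ι (polyCurve c a))) :=
    ((ι.continuous.comp (continuous_polyCurve c)).tendsto a).mono_left nhdsWithin_le_nhds
  refine h.congr' ?_
  filter_upwards [Ioc_mem_nhdsGT hab] with τ hτ
  exact (hU τ hτ).symm

lemma deriv_eq_polyCurveDeriv (ι : S →L[ℝ] Y) {n : ℕ} {a b : ℝ} {c : Fin n → S}
    {U : ℝ → Y} (hU : ∀ τ ∈ Ioc a b, U τ = ι (polyCurve c τ)) {τ : ℝ} (hτ : τ ∈ Ioo a b) :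
    deriv U τ = ι (polyCurveDeriv c τ) := by
  have h : U =ᶠ[𝓝 τ] fun τ => ι (polyCurve c τ) := by
    filter_upwards [Ioo_mem_nhds hτ.1 hτ.2] with σ hσ
    exact hU σ (Ioo_subset_Ioc_self hσ)
  exact ((ι.hasFDerivAt.comp_hasDerivAt τ (hasDerivAt_polyCurve c τ)).congr_of_eventuallyEq h).deriv

/-- The jump splits into the right limit, which belongs to the form of the step, and the inherited
value `u`, which contributes only to the data. -/
lemma scheme_step_eq (ι : S →L[ℝ] Y) {μ α : S →L[ℝ] S →L[ℝ] ℝ} {mf af : Y → Y → ℝ}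
    (hm : ∀ v w, mf (ι v) (ι w) = μ v w) (ha : ∀ v w, af (ι v) (ι w) = α v w) {n : ℕ} {a b : ℝ}
    (hab : a < b) {c e : Fin n → S} {u : S} {U V : ℝ → Y}
    (hU : ∀ τ ∈ Ioc a b, U τ = ι (polyCurve c τ)) (hUa : U a = ι u)
    (hV : ∀ τ ∈ Ioc a b, V τ = ι (polyCurve e τ)) :
    (∫ τ in Ioc a b, (mf (deriv U τ) (V τ) + af (U τ) (V τ)))
        + mf (Function.rightLim U a - U a) (Function.rightLim V a)
      = stepForm μ α a b c e - μ u (polyCurve e a) := by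
  rw [rightLim_eq_polyCurve ι hab hU, rightLim_eq_polyCurve ι hab hV, hUa, ← map_sub, hm,
    map_sub, sub_apply, stepForm, intervalIntegral.integral_of_le hab.le, add_sub_assoc]
  congr 1
  -- At the right end point `U` may jump and `deriv U` need not be the derivative of the polynomial;
  -- that point is null.
  rw [integral_Ioc_eq_integral_Ioo, integral_Ioc_eq_integral_Ioo]
  refine setIntegral_congr_fun measurableSet_Ioo fun τ hτ => ?_
  have hτ' := Ioo_subset_Ioc_self hτ
  simp only [deriv_eq_polyCurveDeriv ι hU hτ, hU τ hτ', hV τ hτ', hm, ha]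

lemma mesh_le {M : ℕ} {t : ℕ → ℝ} (ht : ∀ n < M, t n < t (n + 1)) {i j : ℕ} (hij : i ≤ j)
    (hj : j ≤ M) : t i ≤ t j := by
  induction j, hij using Nat.le_induction with
  | base => exact le_rfl
  | succ k _ ih => exact (ih (by omega)).trans (ht k (by omega)).le

lemma mesh_index_unique {M : ℕ} {t : ℕ → ℝ} (ht : ∀ n < M, t n < t (n + 1)) {i j : ℕ}
    (hi : i < M) (hj : j < M) {τ : ℝ} (h : τ ∈ Ioc (t i) (t (i + 1)))
    (h' : τ ∈ Ioc (t j) (t (j + 1))) : i = j := by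
  rcases lt_trichotomy i j with hlt | heq | hlt
  · exact absurd (h.2.trans (mesh_le ht (Nat.succ_le_of_lt hlt) hj.le)) (not_le.2 h'.1)
  · exact heq
  · exact absurd (h'.2.trans (mesh_le ht (Nat.succ_le_of_lt hlt) hi.le)) (not_le.2 h.1)

lemma exists_mesh_index {M : ℕ} {t : ℕ → ℝ} {τ : ℝ} (h0 : t 0 < τ) (hM : τ ≤ t M) :
    ∃ n < M, τ ∈ Ioc (t n) (t (n + 1)) := by
  induction M with
  | zero => exact absurd hM (not_le.2 h0)
  | succ k ih =>
    by_cases hk : τ ≤ t k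
    · obtain ⟨n, hn, h⟩ := ih hk
      exact ⟨n, hn.trans (Nat.lt_succ_self k), h⟩
    · exact ⟨k, Nat.lt_succ_self k, not_le.1 hk, hM⟩

/-- Existence and uniqueness for the discontinuous Galerkin scheme, for forms on a space `Y` that
are given, on the range of `ι`, by bounded forms on a Hilbert space. -/
theorem exists_unique_galerkinScheme [CompleteSpace S] (ι : S →L[ℝ] Y) {μ α : S →L[ℝ] S →L[ℝ] ℝ}
    (hsymm : ∀ v w, μ v w = μ w v) (hpos : ∀ v, 0 ≤ μ v v) {κ : ℝ} (hκ : 0 < κ)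
    (hα : ∀ v, κ * ‖v‖ ^ 2 ≤ α v v) {mf af : Y → Y → ℝ}
    (hm : ∀ v w, mf (ι v) (ι w) = μ v w) (ha : ∀ v w, af (ι v) (ι w) = α v w)
    {M : ℕ} {t : ℕ → ℝ} (ht : ∀ n < M, t n < t (n + 1)) {d : ℕ} {u₀ : Y} (hu₀ : u₀ ∈ range ι)
    {lf : ℝ → Y → ℝ}
    (hl : ∀ n < M, ∃ ℓ : Fin (d + 1) → S →L[ℝ] ℝ, ∀ e : Fin (d + 1) → S,
      ∫ τ in Ioc (t n) (t (n + 1)), lf τ (ι (polyCurve e τ)) = ∑ i : Fin (d + 1), ℓ i (e i))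
    {P : (ℝ → Y) → Prop} (hP : ∀ U, P U ↔ IsPiecewisePoly (range ι) d M t U ∧ U (t 0) = u₀ ∧
      ∀ V : ℝ → Y, IsPiecewisePoly (range ι) d M t V → ∀ n < M,
        (∫ τ in Ioc (t n) (t (n + 1)), (mf (deriv U τ) (V τ) + af (U τ) (V τ)))
          + mf (Function.rightLim U (t n) - U (t n)) (Function.rightLim V (t n))
        = ∫ τ in Ioc (t n) (t (n + 1)), lf τ (V τ)) :
    ∃ U : ℝ → Y, P U ∧ ∀ U', P U' → EqOn U' U (Icc (t 0) (t M)) := by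
  classical
  obtain ⟨s₀, rfl⟩ := hu₀
  -- the coefficients on the interval `n`, in terms of the value to the left
  have hstep : ∀ (n : ℕ) (u : S), ∃ c : Fin (d + 1) → S, n < M → ∀ c' : Fin (d + 1) → S,
      (∀ e : Fin (d + 1) → S, stepForm μ α (t n) (t (n + 1)) c' e - μ u (polyCurve e (t n))
        = ∫ τ in Ioc (t n) (t (n + 1)), lf τ (ι (polyCurve e τ))) ↔ c' = c := by
    intro n u
    by_cases hn : n < M
    · obtain ⟨ℓ, hℓ⟩ := hl n hn
      obtain ⟨c, hc, huniq⟩ := existsUnique_galerkinStep hsymm hpos hκ hα (ht n hn)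
        -- The term `μ(u, e(tₙ))` of the inherited value, moved to the right-hand side and expanded
        -- in the coefficients of `e`.
        (fun i => ℓ i + t n ^ (i : ℕ) • μ u)
      have key : ∀ c' e : Fin (d + 1) → S,
          (stepForm μ α (t n) (t (n + 1)) c' e - μ u (polyCurve e (t n))
            = ∫ τ in Ioc (t n) (t (n + 1)), lf τ (ι (polyCurve e τ))) ↔
          stepForm μ α (t n) (t (n + 1)) c' e
            = ∑ i : Fin (d + 1), (ℓ i + t n ^ (i : ℕ) • μ u) (e i) := by
        intro c' e
        rw [hℓ e, sub_eq_iff_eq_add]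
        simp only [add_apply, smul_apply, Finset.sum_add_distrib, polyCurve, map_sum, map_smul]
      refine ⟨c, fun _ c' => ⟨fun h => huniq c' fun e => (key c' e).1 (h e), ?_⟩⟩
      rintro rfl e
      exact (key c' e).2 (hc e)
    · exact ⟨0, fun h => absurd h hn⟩
  choose c hc using hstep
  -- The value of the solution at the node `t n`, computed by solving the steps one after the other.
  let u : ℕ → S := fun n => Nat.rec s₀ (fun n v => polyCurve (c n v) (t (n + 1))) n
  have hu : ∀ n, u (n + 1) = polyCurve (c n (u n)) (t (n + 1)) := fun n => rfl
  -- solutions are determined by these coefficients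
  have hchar : ∀ U : ℝ → Y, P U ↔ U (t 0) = ι s₀ ∧
      ∀ n < M, ∀ τ ∈ Ioc (t n) (t (n + 1)), U τ = ι (polyCurve (c n (u n)) τ) := by
    intro U
    have hnode : U (t 0) = ι s₀ → ∀ n, n ≤ M → (∀ k < n, ∀ τ ∈ Ioc (t k) (t (k + 1)),
        U τ = ι (polyCurve (c k (u k)) τ)) → U (t n) = ι (u n) := by
      rintro h0 (_ | n) hn h
      · exact h0
      · rw [hu]
        exact h n n.lt_succ_self _ ⟨ht n hn, le_rfl⟩
    rw [hP]
    constructor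
    · rintro ⟨hpw, h0, heq⟩
      refine ⟨h0, fun n => ?_⟩
      -- The value at `t n` is known only once the solution is determined on all earlier intervals.
      induction n using Nat.strong_induction_on with
      | _ n ih =>
        intro hn
        obtain ⟨c', hc'⟩ := (isPiecewisePoly_range_iff ι).1 hpw n hn
        have hUn := hnode h0 n hn.le fun k hk => ih k hk (hk.trans hn)
        have : c' = c n (u n) := by
          refine (hc n (u n) hn c').1 fun e => ?_
          -- The equation on one interval involves the test function only there and at its left
          -- limit point, so a single polynomial on the whole line is a sufficient test.
          have := heq (fun τ => ι (polyCurve e τ))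
            ((isPiecewisePoly_range_iff ι).2 fun _ _ => ⟨e, fun _ _ => rfl⟩) n hn
          rwa [scheme_step_eq ι hm ha (ht n hn) hc' hUn fun _ _ => rfl] at this
        rwa [← this]
    · rintro ⟨h0, h⟩
      refine ⟨(isPiecewisePoly_range_iff ι).2 fun n hn => ⟨_, h n hn⟩, h0, fun V hV n hn => ?_⟩
      obtain ⟨e, he⟩ := (isPiecewisePoly_range_iff ι).1 hV n hn
      have hUn := hnode h0 n hn.le fun k hk => h k (hk.trans hn)
      rw [scheme_step_eq ι hm ha (ht n hn) (h n hn) hUn he, (hc n (u n) hn _).2 rfl e]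
      exact setIntegral_congr_fun measurableSet_Ioc fun τ hτ => by simp only [he τ hτ]
  -- The default value `ι s₀` is the initial condition: within `[t 0, t M]` only the point `t 0`
  -- lies in no interval of the mesh.
  refine ⟨fun τ => if h : ∃ n < M, τ ∈ Ioc (t n) (t (n + 1)) then
    ι (polyCurve (c h.choose (u h.choose)) τ) else ι s₀, (hchar _).2 ⟨?_, ?_⟩,
    fun U' hU' τ hτ => ?_⟩
  · rw [dif_neg]
    rintro ⟨n, hn, h⟩
    exact absurd (mesh_le ht (Nat.zero_le n) hn.le) (not_le.2 h.1)
  · intro n hn τ hτ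
    have hex : ∃ n < M, τ ∈ Ioc (t n) (t (n + 1)) := ⟨n, hn, hτ⟩
    rw [dif_pos hex, mesh_index_unique ht hex.choose_spec.1 hn hex.choose_spec.2 hτ]
  · obtain ⟨h0, h⟩ := (hchar U').1 hU'
    by_cases hex : ∃ n < M, τ ∈ Ioc (t n) (t (n + 1))
    · simp only [dif_pos hex]
      exact h _ hex.choose_spec.1 τ hex.choose_spec.2
    · simp only [dif_neg hex]
      rcases hτ.1.eq_or_lt with he | hlt
      · rw [← he, h0]
      · exact absurd (exists_mesh_index hlt hτ.2) hex

end AbstractScheme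

open GraphSpace

/-! ### The load functional, the Hilbert model and the conclusion -/

lemma integrableOn_smul_pow {F : Type*} [NormedAddCommGroup F] [NormedSpace ℝ F] {f : ℝ → F}
    {a b : ℝ} (hf : IntegrableOn f (Ioc a b)) (i : ℕ) :
    IntegrableOn (fun τ => τ ^ i • f τ) (Ioc a b) := by
  refine hf.bdd_smul (max |a| |b| ^ i) (by fun_prop) ?_
  refine (ae_restrict_iff' measurableSet_Ioc).2 (Eventually.of_forall fun τ hτ => ?_)
  rw [norm_pow, Real.norm_eq_abs]
  exact pow_le_pow_left₀ (abs_nonneg _) (abs_le_max_abs_abs hτ.1.le hτ.2) i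

lemma inner_polyCurve_eq_sum {S F : Type*} [AddCommGroup S] [Module ℝ S]
    [NormedAddCommGroup F] [InnerProductSpace ℝ F] (L : S →ₗ[ℝ] F) (y : F) {n : ℕ}
    (e : Fin n → S) (τ : ℝ) :
    inner ℝ y (L (polyCurve e τ)) = ∑ i : Fin n, inner ℝ (L (e i)) (τ ^ (i : ℕ) • y) := by
  rw [polyCurve, map_sum, inner_sum]
  refine Finset.sum_congr rfl fun i _ => ?_
  rw [map_smul, inner_smul_right, inner_smul_right, real_inner_comm]

lemma integrableOn_inner_polyCurve {S F : Type*} [AddCommGroup S] [Module ℝ S]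
    [NormedAddCommGroup F] [InnerProductSpace ℝ F] (L : S →ₗ[ℝ] F) {f : ℝ → F} {a b : ℝ}
    (hf : IntegrableOn f (Ioc a b)) {n : ℕ} (e : Fin n → S) :
    IntegrableOn (fun τ => inner ℝ (f τ) (L (polyCurve e τ))) (Ioc a b) := by
  simp only [inner_polyCurve_eq_sum]
  exact integrable_finsetSum _ fun i _ => (integrableOn_smul_pow hf i).const_inner (𝕜 := ℝ) _

lemma integral_inner_polyCurve {S F : Type*} [AddCommGroup S] [Module ℝ S]
    [NormedAddCommGroup F] [InnerProductSpace ℝ F] [CompleteSpace F] (L : S →ₗ[ℝ] F) {f : ℝ → F}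
    {a b : ℝ} (hf : IntegrableOn f (Ioc a b)) {n : ℕ} (e : Fin n → S) :
    ∫ τ in Ioc a b, inner ℝ (f τ) (L (polyCurve e τ))
      = ∑ i : Fin n, inner ℝ (∫ τ in Ioc a b, τ ^ (i : ℕ) • f τ) (L (e i)) := by
  simp only [inner_polyCurve_eq_sum]
  rw [integral_finsetSum _ fun (i : Fin n) _ =>
    (integrableOn_smul_pow hf (i : ℕ)).const_inner (𝕜 := ℝ) (L (e i))]
  refine Finset.sum_congr rfl fun i _ => ?_
  rw [integral_inner (integrableOn_smul_pow hf i), real_inner_comm]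

/-- Against a polynomial in time the data act only through their moments `∫ τⁱ f` and `∫ τⁱ g`, so
the load is a bounded functional of the coefficients. -/
lemma exists_integral_inner_add_inner_eq {S F F' : Type*} [NormedAddCommGroup S]
    [NormedSpace ℝ S] [NormedAddCommGroup F] [InnerProductSpace ℝ F] [CompleteSpace F]
    [NormedAddCommGroup F'] [InnerProductSpace ℝ F'] [CompleteSpace F'] (L : S →L[ℝ] F)
    (L' : S →L[ℝ] F') {f : ℝ → F} {g : ℝ → F'} {a b : ℝ} (hf : IntegrableOn f (Ioc a b))
    (hg : IntegrableOn g (Ioc a b)) (n : ℕ) : ∃ ℓ : Fin n → S →L[ℝ] ℝ, ∀ e : Fin n → S,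
      ∫ τ in Ioc a b, (inner ℝ (f τ) (L (polyCurve e τ)) + inner ℝ (g τ) (L' (polyCurve e τ)))
        = ∑ i : Fin n, ℓ i (e i) := by
  refine ⟨fun i => (innerSL ℝ (∫ τ in Ioc a b, τ ^ (i : ℕ) • f τ)).comp L
    + (innerSL ℝ (∫ τ in Ioc a b, τ ^ (i : ℕ) • g τ)).comp L', fun e => ?_⟩
  have h := integral_add (integrableOn_inner_polyCurve L.toLinearMap hf e)
    (integrableOn_inner_polyCurve L'.toLinearMap hg e)
  rw [integral_inner_polyCurve L.toLinearMap hf e, integral_inner_polyCurve L'.toLinearMap hg e,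
    ← Finset.sum_add_distrib] at h
  exact h

lemma loadForm_eq {m : ℕ} {O : Set (Eucl (m + 1))} (f : L2 O) (g : L2Boundary O) {v : L2 O}
    {τ : L2Boundary O} (h : trace O v =ᵐ[surfaceMeasure O] τ) :
    loadForm f g v = inner ℝ f v + inner ℝ g τ := by
  rw [loadForm, MeasureTheory.L2.inner_def, MeasureTheory.L2.inner_def]
  simp only [real_inner_eq_mul]
  congr 1
  refine integral_congr_ae ?_
  filter_upwards [h] with x hx
  rw [hx]

/-- A closed subspace of a Hilbert space is itself one, and the forms restrict to it. Coercivity and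
the agreement with `mf` and `af`, which hold only on `E`, thereby become statements on a whole
space. -/
lemma exists_hilbert_model_of_isClosed {X Y Z : Type} [NormedAddCommGroup X]
    [InnerProductSpace ℝ X] [CompleteSpace X] [NormedAddCommGroup Y] [NormedSpace ℝ Y]
    [NormedAddCommGroup Z] [NormedSpace ℝ Z] {E : Submodule ℝ X} (hE : IsClosed (E : Set X))
    (val : X →L[ℝ] Y) (tr : X →L[ℝ] Z) (μ α : X →L[ℝ] X →L[ℝ] ℝ) {R : Y → Z → Prop}
    {mf af : Y → Y → ℝ} {B : Set Y} (hB : val '' E = B) (hR : ∀ x ∈ E, R (val x) (tr x))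
    (hsymm : ∀ v w, μ v w = μ w v) (hpos : ∀ v, 0 ≤ μ v v)
    (hα : ∃ κ > 0, ∀ v ∈ E, κ * ‖v‖ ^ 2 ≤ α v v)
    (hm : ∀ v ∈ E, ∀ w ∈ E, mf (val v) (val w) = μ v w)
    (ha : ∀ v ∈ E, ∀ w ∈ E, af (val v) (val w) = α v w) :
    ∃ (S : Type) (_ : NormedAddCommGroup S) (_ : InnerProductSpace ℝ S) (_ : CompleteSpace S)
      (ι : S →L[ℝ] Y) (tr : S →L[ℝ] Z) (μ α : S →L[ℝ] S →L[ℝ] ℝ) (κ : ℝ),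
      range ι = B ∧ (∀ v, R (ι v) (tr v)) ∧
      (∀ v w, μ v w = μ w v) ∧ (∀ v, 0 ≤ μ v v) ∧ 0 < κ ∧ (∀ v, κ * ‖v‖ ^ 2 ≤ α v v) ∧
      (∀ v w, mf (ι v) (ι w) = μ v w) ∧ ∀ v w, af (ι v) (ι w) = α v w := by
  obtain ⟨κ, hκ, hcoer⟩ := hα
  have : CompleteSpace E := hE.completeSpace_coe
  refine ⟨E, inferInstance, inferInstance, this, val.comp E.subtypeL, tr.comp E.subtypeL,
    μ.bilinearComp E.subtypeL E.subtypeL, α.bilinearComp E.subtypeL E.subtypeL,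
    κ, ?_, fun v => hR v v.2, fun v w => hsymm v w, fun v => hpos v, hκ, fun v => hcoer v v.2,
    fun v w => hm v v.2 w w.2, fun v w => ha v v.2 w w.2⟩
  rw [← hB]
  ext v
  exact ⟨fun ⟨x, hx⟩ => ⟨x, x.2, hx⟩, fun ⟨x, hx, h⟩ => ⟨⟨x, hx⟩, h⟩⟩

/-- The trial space is the image of a Hilbert space, on which the forms of the scheme are bounded
and the energy form is coercive. -/
lemma exists_hilbert_model {m : ℕ} {O : Set (Eucl (m + 1))} (hO : IsLipschitzDomain O)
    {C : Coefficients m} (hC : C.Regular O)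
    (hν : ∃ ν₀ > 0, ∀ᵐ x ∂(volume.restrict O), ν₀ ≤ C.ν x)
    (hc : ∃ α₀ > 0, ∀ᵐ x ∂(volume.restrict O), α₀ ≤ C.c x + 1 / 2 * weakDiv O C.b x)
    (hp : ∀ᵐ x ∂(surfaceMeasure O), 0 ≤ C.boundaryWeight O x)
    (hq : ∀ᵐ x ∂(surfaceMeasure O), 0 ≤ C.q x)
    (hqs : C.q =ᵐ[surfaceMeasure O] 0 ∨
      ((∃ q₀ > 0, ∀ᵐ x ∂(surfaceMeasure O), q₀ ≤ C.q x) ∧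
        ∃ s₀ > 0, ∀ᵐ x ∂(surfaceMeasure O), s₀ ≤ C.s x)) :
    ∃ (S : Type) (_ : NormedAddCommGroup S) (_ : InnerProductSpace ℝ S) (_ : CompleteSpace S)
      (ι : S →L[ℝ] L2 O) (tr : S →L[ℝ] L2Boundary O) (μ α : S →L[ℝ] S →L[ℝ] ℝ) (κ : ℝ),
      range ι = trialSpace C O ∧ (∀ v, trace O (ι v) =ᵐ[surfaceMeasure O] tr v) ∧
      (∀ v w, μ v w = μ w v) ∧ (∀ v, 0 ≤ μ v v) ∧ 0 < κ ∧ (∀ v, κ * ‖v‖ ^ 2 ≤ α v v) ∧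
      (∀ v w, massForm C O (ι v) (ι w) = μ v w) ∧
      ∀ v w, energyForm C O (ι v) (ι w) = α v w :=
  exists_hilbert_model_of_isClosed isClosed_energySpace (valL O) (traceL O) (graphMassForm hC)
    (graphEnergyForm hO hC) (R := fun v τ => trace O v =ᵐ[surfaceMeasure O] τ)
    (valL_image_energySpace hO) (fun _ hx => trace_valL hO hx) (graphMassForm_symm hC)
    (graphMassForm_nonneg hC hq) (graphEnergyForm_coercive hO hC hν hc hp hqs)
    (fun _ hv _ hw => massForm_valL hO hC hv hw) (fun _ hv _ hw => energyForm_valL hO hC hv hw)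

theorem theorem3p1 (m : ℕ) (O : Set (Eucl (m + 1))) (hO : IsLipschitzDomain O)
    (C : Coefficients m) (hC : C.Regular O)
    (hν : ∃ ν₀ > 0, ∀ᵐ x ∂(volume.restrict O), ν₀ ≤ C.ν x)
    (hc : ∃ α₀ > 0, ∀ᵐ x ∂(volume.restrict O), α₀ ≤ C.c x + 1 / 2 * weakDiv O C.b x)
    (hp : ∀ᵐ x ∂(surfaceMeasure O), 0 < C.boundaryWeight O x)
    (hq : ∀ᵐ x ∂(surfaceMeasure O), 0 ≤ C.q x)
    (hs : ∀ᵐ x ∂(surfaceMeasure O), 0 < C.s x)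
    (hqs : C.q =ᵐ[surfaceMeasure O] 0 ∨
      ((∃ q₀ > 0, ∀ᵐ x ∂(surfaceMeasure O), q₀ ≤ C.q x) ∧
        ∃ s₀ > 0, ∀ᵐ x ∂(surfaceMeasure O), s₀ ≤ C.s x))
    (T : ℝ) (hT : 0 < T) (M : ℕ) (t : ℕ → ℝ) (ht0 : t 0 = 0) (htM : t M = T)
    (ht : ∀ n < M, t n < t (n + 1)) (d : ℕ)
    (u₀ : L2 O) (hu₀ : u₀ ∈ trialSpace C O)
    (f : ℝ → L2 O) (hf : MemLp f 2 (volume.restrict (Set.Ioc 0 T)))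
    (g : ℝ → L2Boundary O) (hg : MemLp g 2 (volume.restrict (Set.Ioc 0 T))) :
    ∃ U : ℝ → L2 O, IsDGSolution C O d M t u₀ f g U ∧
      ∀ U' : ℝ → L2 O, IsDGSolution C O d M t u₀ f g U' → Set.EqOn U' U (Set.Icc 0 T) := by
  have hI : ∀ n < M, Ioc (t n) (t (n + 1)) ⊆ Ioc 0 T := fun n hn =>
    Ioc_subset_Ioc (ht0 ▸ mesh_le ht (Nat.zero_le n) hn.le) (htM ▸ mesh_le ht hn le_rfl)
  -- On a bounded time interval `L²` is contained in `L¹`, which is enough for moments against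
  -- polynomials.
  have hfi : ∀ n < M, IntegrableOn f (Ioc (t n) (t (n + 1))) := fun n hn =>
    (hf.integrable one_le_two).mono_measure (Measure.restrict_mono (hI n hn) le_rfl)
  have hgi : ∀ n < M, IntegrableOn g (Ioc (t n) (t (n + 1))) := fun n hn =>
    (hg.integrable one_le_two).mono_measure (Measure.restrict_mono (hI n hn) le_rfl)
  obtain ⟨S, _, _, _, ι, tr, μ, α, κ, hrange, htr, hsymm, hpos, hκ, hα, hm, ha⟩ :=
    exists_hilbert_model hO hC hν hc (hp.mono fun _ h => h.le) hq hqs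
  have hload : ∀ n < M, ∃ ℓ : Fin (d + 1) → S →L[ℝ] ℝ, ∀ e : Fin (d + 1) → S,
      ∫ τ in Ioc (t n) (t (n + 1)), loadForm (f τ) (g τ) (ι (polyCurve e τ))
        = ∑ i : Fin (d + 1), ℓ i (e i) := by
    intro n hn
    obtain ⟨ℓ, hℓ⟩ := exists_integral_inner_add_inner_eq ι tr (hfi n hn) (hgi n hn) (d + 1)
    refine ⟨ℓ, fun e => (integral_congr_ae (Eventually.of_forall fun τ => ?_)).trans (hℓ e)⟩
    exact loadForm_eq (f τ) (g τ) (htr (polyCurve e τ))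
  have key := exists_unique_galerkinScheme ι hsymm hpos hκ hα hm ha ht (hrange ▸ hu₀)
    (lf := fun τ => loadForm (f τ) (g τ)) hload (P := IsDGSolution C O d M t u₀ f g)
    (by rw [hrange]; exact fun U => Iff.rfl)
  rwa [ht0, htM] at key
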